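/- Let $d\ge 1$ and let $(\Omega_i,\mathcal F^i,\mathbb P_i)$, $i=1,\dots,d$, be probability spaces with increasing sequences of sub-$\sigma$-algebras $(\mathcal F^i_n)_{n\in\mathbb N}$ such that $\mathcal F^i=\sigma(\bigcup_n\mathcal F^i_n)$. Let $(\Omega,\mathcal F,\mathbb P)$ be the product probability space, $\mathcal F_n=\sigma(\mathcal F_n^1\times\cdots\times\mathcal F_n^d)$, and let $\mathbb E_n$ be the conditional expectation with respect to $\mathcal F_n$. For $\vec q=(q_1,\dots,q_d)$ with $0<q_i\le\infty$, let $\|f\|_{\vec q}$ be the mixed quasi-norm obtained by taking successively the $L_{q_1}$-norm in $x_1$, ..., the $L_{q_d}$-norm in $x_d$; for $\vec q=(r,\dots,r)$ write $r$ instead of $\vec q$. All martingales $f=(f_n)_{n\in\mathbb N}$ are with respect to $(\mathcal F_n)$, real- or complex-valued, with $f_0=0$. Put $$M(f)=\sup_n|f_n|,\qquad S_n(f)=\Big(\sum_{k=1}^n|f_k-f_{k-1}|^2\Big)^{1/2},\qquad S(f)=\sup_n S_n(f),\qquad s(f)=\Big(\sum_{n=1}^\infty\mathbb E_{n-1}|f_n-f_{n-1}|^2\Big)^{1/2}.$$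 Let $\Lambda$ be the set of nonnegative, non-decreasing, adapted sequences $(\lambda_n)_{n\in\mathbb N}$ of functions, and $\lambda_\infty=\lim_n\lambda_n$. Define $\|f\|_{H^s_{\vec q}}=\|s(f)\|_{\vec q}$; $\|f\|_{\mathcal Q_{\vec q}}=\inf\|\lambda_\infty\|_{\vec q}$ over all $\lambda\in\Lambda$ with $S_n(f)\le\lambda_{n-1}$ for all $n\ge1$; $\|f\|_{\mathcal P_{\vec q}}=\inf\|\lambda_\infty\|_{\vec q}$ over all $\lambda\in\Lambda$ with $|f_n|\le\lambda_{n-1}$ for all $n\ge 1$ (with $\inf\emptyset=\infty$). The spaces $H^s_{\vec q},\mathcal Q_{\vec q},\mathcal P_{\vec q}$ consist of the martingales for which the respective quantity is finite. An integrable function $a$, identified with the martingale $(\mathbb E_na)_n$, is an $(s,\vec p)$-atom (resp. $(S,\vec p)$-atom, $(M,\vec p)$-atom) with stopping time $\tau:\Omega\to\mathbb N\cup\{\infty\}$ if for every $n$, $\mathbb E_na=0$ almost everywhere on $\{n\le\tau\}$, and $\|O(a)\chi_{\{\tau<\infty\}}\|_\infty\le\|\chi_{\{\tau<\infty\}}\|_{\vec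 p}^{-1}$, where $O=s$ (resp. $S$, $M$). A map $T$ from a martingale space $X$ to the measurable functions is $\sigma$-sublinear if, almost everywhere, $|T(\alpha f)|=|\alpha||T f|$ for all scalars $\alpha$ and $f\in X$, and $|T(\sum_{k=1}^\infty f_k)|\le\sum_{k=1}^\infty|T f_k|$ whenever $f_k\in X$ and the series converges to an element of $X$ in the quasi-norm of $X$ and, at every time $n$, almost everywhere. Theorem. Let $0<p_i<\infty$ for $i=1,\dots,d$, and let $0<r\le\infty$ with $r>p_i$ for all $i$. Let the pair $(X_{\vec q},O)$ be $(H^s_{\vec q},s)$, or $(\mathcal Q_{\vec q},S)$, or $(\mathcal P_{\vec q},M)$. Let $T$ be a $\sigma$-sublinear operator from $X_{\vec p}$ (which contains $X_r$) to the measurable functions that is bounded from $X_r$ to $L_r$, that is, $\|Tf\|_r\le K\|f\|_{X_r}$ for all $f\in X_r$ with a finite constant $K$. Suppose that $$(Ta)\,\chi_A=T(a\chi_A)\quad\text{almost everywhere}$$ for every $(O,\vec p)$-atom $a$ with stopping time $\tau$ and every $A\in\mathcal F_\tau$. Then there is a finite constant $C$ such that $$\|Tf\|_{\vec p}\le C\,\|f\|_{X_{\vec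 p}}\qquad\text{for all } f\in X_{\vec p}.$$ -/

import Mathlib

open MeasureTheory Filter Topology
open scoped ENNReal NNReal

noncomputable section

/-! ### Mixed Lebesgue quasi-norms -/

/-- The mixed quasi-norm `‖f‖_(p₁, …, p_d)` of a `[0,∞]`-valued function on the product
`Ω₁ × ⋯ × Ω_d`: the `L_{p₁}`-norm is taken first, in the first variable, and the `L_{p_d}`-norm
last, in the last variable. -/
def mixedNorm : {d : ℕ} → {Ω : Fin d → Type*} → [∀ i, MeasurableSpace (Ω i)] →
    (∀ i, Measure (Ω i)) → (Fin d → ℝ≥0∞) → ((∀ i, Ω i) → ℝ≥0∞) → ℝ≥0∞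
  | 0, _, _, _, _, f => f (fun i => i.elim0)
  | d + 1, Ω, _, P, p, f =>
      eLpNorm (fun x : Ω (Fin.last d) =>
        mixedNorm (Ω := fun i : Fin d => Ω i.castSucc) (fun i => P i.castSucc)
          (fun i => p i.castSucc) (fun y => f (Fin.snoc (α := Ω) y x)))
        (p (Fin.last d)) (P (Fin.last d))

/-- The product filtration `ℱ_n = σ(ℱ_n^1 × ⋯ × ℱ_n^d)`. -/
def prodFiltration {d : ℕ} {Ω : Fin d → Type*} [mΩ : ∀ i, MeasurableSpace (Ω i)]
    (ℱ : ∀ i, Filtration ℕ (mΩ i)) :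
    Filtration ℕ (MeasurableSpace.pi : MeasurableSpace (∀ i, Ω i)) where
  seq n := ⨆ i, (ℱ i n).comap fun ω => ω i
  mono' _ _ h := iSup_mono fun i => MeasurableSpace.comap_mono ((ℱ i).mono h)
  le' n := iSup_mono fun i => MeasurableSpace.comap_mono ((ℱ i).le n)

/-! ### Martingale operators, on an arbitrary filtered measure space -/

section Operators

variable {Ω 𝕜 : Type*} [RCLike 𝕜] {m : MeasurableSpace Ω}

/-- Martingales, with the convention `f₀ = 0`. -/
def IsMart (μ : Measure Ω) (𝓖 : Filtration ℕ m) (f : ℕ → Ω → 𝕜) : Prop :=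
  Martingale f 𝓖 μ ∧ f 0 =ᵐ[μ] 0

/-- The maximal function `M(f) = sup_n |f_n|`. -/
def maxFun (f : ℕ → Ω → 𝕜) (ω : Ω) : ℝ≥0∞ := ⨆ n, ‖f n ω‖ₑ

/-- `S_n(f) = (∑_{k=1}^n |f_k - f_{k-1}|²)^{1/2}` (the difference of index `0` vanishes). -/
def quadVarUpTo (f : ℕ → Ω → 𝕜) (n : ℕ) (ω : Ω) : ℝ≥0∞ :=
  (∑ k ∈ Finset.range n, ‖f (k + 1) ω - f k ω‖ₑ ^ 2) ^ (1 / 2 : ℝ)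

/-- The quadratic variation `S(f) = (∑_{n=1}^∞ |f_n - f_{n-1}|²)^{1/2}`. -/
def quadVar (f : ℕ → Ω → 𝕜) (ω : Ω) : ℝ≥0∞ :=
  (∑' n, ‖f (n + 1) ω - f n ω‖ₑ ^ 2) ^ (1 / 2 : ℝ)

/-- The conditional quadratic variation
`s(f) = (∑_{n=1}^∞ 𝔼_{n-1} |f_n - f_{n-1}|²)^{1/2}`. The conditional expectation is that of
nonnegative, not necessarily integrable, functions. -/
def condQuadVar (μ : Measure Ω) (𝓖 : Filtration ℕ m) (f : ℕ → Ω → 𝕜) (ω : Ω) : ℝ≥0∞ :=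
  (∑' n, condLExp (𝓖 n) μ (fun x => ‖f (n + 1) x - f n x‖ₑ ^ 2) ω) ^ (1 / 2 : ℝ)

/-- The class `Λ` of nonnegative, non-decreasing, adapted sequences of functions. -/
structure IsControl (𝓖 : Filtration ℕ m) (l : ℕ → Ω → ℝ) : Prop where
  nonneg : ∀ n ω, 0 ≤ l n ω
  mono : ∀ ω, Monotone fun n => l n ω
  adapted : StronglyAdapted 𝓖 l

/-- `λ_∞ = lim_n λ_n = sup_n λ_n`. -/
def controlLimit (l : ℕ → Ω → ℝ) (ω : Ω) : ℝ≥0∞ := ⨆ n, ENNReal.ofReal (l n ω)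

/-- The martingale `(𝔼_n a)_n` of an integrable function `a`. -/
def martOf (μ : Measure Ω) (𝓖 : Filtration ℕ m) (a : Ω → 𝕜) : ℕ → Ω → 𝕜 := fun n => μ[a | 𝓖 n]

/-- Membership in the martingale space with quasi-norm `N`. -/
def MemHardy (μ : Measure Ω) (𝓖 : Filtration ℕ m) (N : (ℕ → Ω → 𝕜) → ℝ≥0∞)
    (f : ℕ → Ω → 𝕜) : Prop :=
  IsMart μ 𝓖 f ∧ N f < ∞

/-- `T` is a `σ`-sublinear operator from the martingale space `X` with quasi-norm `N` to the
measurable functions: `|T (∑ f_k)| ≤ ∑ |T f_k|` and `|T (α f)| = |α| |T f|` almost everywhere.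
The inequality is required of those series only which converge to a member of `X` both in the
quasi-norm of `X` and, at every time `n`, almost everywhere. -/
structure IsSigmaSublinear (μ : Measure Ω) (𝓖 : Filtration ℕ m) (N : (ℕ → Ω → 𝕜) → ℝ≥0∞)
    (T : (ℕ → Ω → 𝕜) → Ω → 𝕜) : Prop where
  aestronglyMeasurable : ∀ f, MemHardy μ 𝓖 N f → AEStronglyMeasurable (T f) μ
  series_le : ∀ (f : ℕ → Ω → 𝕜) (g : ℕ → ℕ → Ω → 𝕜), MemHardy μ 𝓖 N f →
    (∀ k, MemHardy μ 𝓖 N (g k)) →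
    (∀ n, ∀ᵐ ω ∂μ, Tendsto (fun K => ∑ k ∈ Finset.range K, g k n ω) atTop (𝓝 (f n ω))) →
    Tendsto (fun K => N (f - ∑ k ∈ Finset.range K, g k)) atTop (𝓝 0) →
    ∀ᵐ ω ∂μ, ‖T f ω‖ₑ ≤ ∑' k, ‖T (g k) ω‖ₑ
  smul_eq : ∀ (α : 𝕜) (f : ℕ → Ω → 𝕜), MemHardy μ 𝓖 N f →
    ∀ᵐ ω ∂μ, ‖T (α • f) ω‖ₑ = ‖α‖ₑ * ‖T f ω‖ₑ

end Operators

/-! ### Mixed martingale Hardy spaces on the product space -/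

section Product

variable {d : ℕ} {Ω : Fin d → Type*} [mΩ : ∀ i, MeasurableSpace (Ω i)] {𝕜 : Type*} [RCLike 𝕜]

/-- The quasi-norm of `H_p^s`. -/
def normHs (P : ∀ i, Measure (Ω i)) (ℱ : ∀ i, Filtration ℕ (mΩ i)) (p : Fin d → ℝ≥0∞)
    (f : ℕ → (∀ i, Ω i) → 𝕜) : ℝ≥0∞ :=
  mixedNorm P p (condQuadVar (Measure.pi P) (prodFiltration ℱ) f)

/-- The quasi-norm of `𝒬_p`: the infimum of `‖λ_∞‖_p` over all `λ ∈ Λ` with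
`S_n(f) ≤ λ_{n-1}` for all `n ≥ 1`. -/
def normQ (P : ∀ i, Measure (Ω i)) (ℱ : ∀ i, Filtration ℕ (mΩ i)) (p : Fin d → ℝ≥0∞)
    (f : ℕ → (∀ i, Ω i) → 𝕜) : ℝ≥0∞ :=
  ⨅ (l : ℕ → (∀ i, Ω i) → ℝ) (_ : IsControl (prodFiltration ℱ) l)
    (_ : ∀ n, ∀ᵐ ω ∂(Measure.pi P), quadVarUpTo f (n + 1) ω ≤ ENNReal.ofReal (l n ω)),
    mixedNorm P p (controlLimit l)

/-- The quasi-norm of `𝒫_p`: the infimum of `‖λ_∞‖_p` over all `λ ∈ Λ` with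
`|f_n| ≤ λ_{n-1}` for all `n ≥ 1`. -/
def normP (P : ∀ i, Measure (Ω i)) (ℱ : ∀ i, Filtration ℕ (mΩ i)) (p : Fin d → ℝ≥0∞)
    (f : ℕ → (∀ i, Ω i) → 𝕜) : ℝ≥0∞ :=
  ⨅ (l : ℕ → (∀ i, Ω i) → ℝ) (_ : IsControl (prodFiltration ℱ) l)
    (_ : ∀ n, ∀ᵐ ω ∂(Measure.pi P), ‖f (n + 1) ω‖ₑ ≤ ENNReal.ofReal (l n ω)),
    mixedNorm P p (controlLimit l)

/-- `a` is an atom with associated stopping time `τ`, with respect to the exponent vector `p` and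
the operator `O`: for `O = s, S, M` these are the `(s,p)`-, `(S,p)`- and `(M,p)`-atoms. -/
structure IsHardyAtom (P : ∀ i, Measure (Ω i)) (ℱ : ∀ i, Filtration ℕ (mΩ i)) (p : Fin d → ℝ≥0∞)
    (O : (ℕ → (∀ i, Ω i) → 𝕜) → (∀ i, Ω i) → ℝ≥0∞)
    (a : (∀ i, Ω i) → 𝕜) (τ : (∀ i, Ω i) → WithTop ℕ) : Prop where
  integrable : Integrable a (Measure.pi P)
  isStoppingTime : IsStoppingTime (prodFiltration ℱ) τ
  condExp_eq_zero : ∀ n : ℕ, ∀ᵐ ω ∂(Measure.pi P), (n : WithTop ℕ) ≤ τ ω →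
    martOf (Measure.pi P) (prodFiltration ℱ) a n ω = 0
  norm_le : eLpNorm ({ω | τ ω < ⊤}.indicator
      (O (martOf (Measure.pi P) (prodFiltration ℱ) a))) ∞ (Measure.pi P) ≤
    (mixedNorm P p ({ω | τ ω < ⊤}.indicator fun _ => 1))⁻¹

/-- `(T a) χ_A = T (a χ_A)` for all atoms `a` and all `A ∈ ℱ_τ`, where `τ` is the stopping time
associated with `a`. -/
def IsAtomLocal (P : ∀ i, Measure (Ω i)) (ℱ : ∀ i, Filtration ℕ (mΩ i)) (p : Fin d → ℝ≥0∞)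
    (O : (ℕ → (∀ i, Ω i) → 𝕜) → (∀ i, Ω i) → ℝ≥0∞)
    (T : (ℕ → (∀ i, Ω i) → 𝕜) → (∀ i, Ω i) → 𝕜) : Prop :=
  ∀ (a : (∀ i, Ω i) → 𝕜) (τ : (∀ i, Ω i) → WithTop ℕ) (h : IsHardyAtom P ℱ p O a τ)
    (A : Set (∀ i, Ω i)), MeasurableSet[h.isStoppingTime.measurableSpace] A →
    A.indicator (T (martOf (Measure.pi P) (prodFiltration ℱ) a)) =ᵐ[Measure.pi P]
      T (martOf (Measure.pi P) (prodFiltration ℱ) (A.indicator a))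

/-- `T` is bounded from the martingale space with quasi-norm `N` to the mixed space `L_q`. -/
def IsBoundedToLp (P : ∀ i, Measure (Ω i)) (ℱ : ∀ i, Filtration ℕ (mΩ i))
    (N : (ℕ → (∀ i, Ω i) → 𝕜) → ℝ≥0∞) (q : Fin d → ℝ≥0∞)
    (T : (ℕ → (∀ i, Ω i) → 𝕜) → (∀ i, Ω i) → 𝕜) : Prop :=
  ∃ C : ℝ≥0, ∀ f, MemHardy (Measure.pi P) (prodFiltration ℱ) N f →
    mixedNorm P q (fun ω => ‖T f ω‖ₑ) ≤ C * N f

end Product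

end

/-! ### Dyadic sums in `[0,∞]` -/

/-! Each of the three spaces is governed by a process attached to `f`: the partial sums of `s(f)`,
the `S_n(f)`, or the running maximum of `|f_n|`. The proof uses only the properties collected in
`IsGauge`, so the three cases are treated together. Let `λ` be a control, that is, a nondecreasing
adapted process dominating that process one step ahead.

Reduction to local bounds. Cut `f` along the dyadic levels of `λ`. The transform of `f` by the
indicators of `{2^k < λ_j ≤ 2^(k+1)}` is a multiple `s_k a_k` of an atom whose stopping time `τ_k`
is the first `n` with `λ_n > 2^k`. The sum of these pieces is `f`, so `|Tf| ≤ ∑ b_k` with `b_k =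
|s_k| |T a_k|`. Locality on `{τ_k = ∞}` shows that `b_k` lives on `{λ_∞ > 2^k}`. Locality on the
sets `A ∈ ℱ_n` inside `{τ_k = n}`, together with the boundedness on `X_r`, gives `∫_A b_k^ρ ≤ (c
2^k)^ρ P(A)`. Here `ρ = r` if `r` is finite, and otherwise `ρ` is any number above all `p_i`.
Nothing else about `T` enters the norm estimate.

From local bounds to mixed norms. The vehicle is `WeightedDom`: `∫ F^t v^(1-t/ρ) ≤ Φ(B) ∫ G^t
v^(1-t/ρ)` for all weights `v` with reverse Jensen inequalities `𝔼_n(v)^θ ≤ B(θ) 𝔼_n(v^θ)`. For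
small `t` and `F = |Tf|`, `G = λ_∞` this is elementary (`weightedDom_of_localized`): on `{τ_k = n}`
conditional Hölder separates `b_k^t` from the weight, reverse Jensen restores `v^(1-t/ρ)`, and the
dyadic sum over `k` rebuilds `λ_∞^t`.

The exponent `t` is then moved freely inside `(0, ρ)` by Rubio de Francia extrapolation
(`WeightedDom.extrapolate`): `v` is replaced by `v h` or `v h^(-κ)`, where `h` is the majorant of
`exists_majorant`. That majorant comes from iterating the maximal operator weighted by `v`, whose
`L_q(v)` bound does not depend on the weight or the filtration; hence the product structure of the
filtration causes no loss.

Finally (`WeightedDom.iterate_mixedNorm`), with the exponent equal to that of the innermost variable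
and weights depending on the other variables only, Fubini turns the inequality into one between the
inner norms on the remaining product. Extrapolate to the next exponent and repeat; when no variable
is left, the weight `1` gives the bound. -/

theorem two_zpow_pos (k : ℤ) : (0 : ℝ≥0∞) < 2 ^ k := ENNReal.zpow_pos (by simp) (by simp) k

theorem two_zpow_ne_top (k : ℤ) : (2 : ℝ≥0∞) ^ k ≠ ∞ := (ENNReal.zpow_lt_top (by simp) (by simp) k).ne

theorem two_zpow_rpow (k : ℤ) (t : ℝ) : ((2 : ℝ≥0∞) ^ k) ^ t = 2 ^ ((k : ℝ) * t) := by
  rw [← ENNReal.rpow_intCast, ENNReal.rpow_mul]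

theorem two_zpow_mono {j k : ℤ} (h : j ≤ k) : (2 : ℝ≥0∞) ^ j ≤ 2 ^ k :=
  ENNReal.zpow_le_of_le (by norm_num) h

/-- The constant in the upper bound of a dyadic sum. -/
noncomputable def dyadicConst (t : ℝ) : ℝ≥0∞ := (1 - (2 : ℝ≥0∞) ^ (-t))⁻¹

theorem dyadicConst_ne_top {t : ℝ} (ht : 0 < t) : dyadicConst t ≠ ∞ := by
  unfold dyadicConst
  rw [ENNReal.inv_ne_top]
  exact (tsub_pos_of_lt (ENNReal.rpow_lt_one_of_one_lt_of_neg (by norm_num) (by linarith))).ne'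

/-- A geometric series whose top index `J` satisfies `2^J < x ≤ 2^(J+1)`. Together with the converse
bound below it replaces powers by sums over dyadic levels. -/
theorem tsum_dyadic_le {t : ℝ} (ht : 0 < t) (x : ℝ≥0∞) :
    ∑' j : ℤ, (if (2 : ℝ≥0∞) ^ j < x then ((2 : ℝ≥0∞) ^ j) ^ t else 0) ≤
      dyadicConst t * x ^ t := by
  classical
  rcases eq_or_ne x 0 with rfl | h0
  · simp
  rcases eq_or_ne x ∞ with rfl | hx
  · rw [ENNReal.top_rpow_of_pos ht, ENNReal.mul_top]
    · exact le_top
    · simp [dyadicConst]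
  obtain ⟨J, hJ1, hJ2⟩ := ENNReal.exists_mem_Ioc_zpow (y := 2) h0 hx (by norm_num) (by simp)
  have hinj : Function.Injective (fun n : ℕ => J - (n : ℤ)) := by
    intro a b h; simpa using h
  rw [← hinj.tsum_eq]
  · calc ∑' n : ℕ, (if (2 : ℝ≥0∞) ^ (J - (n : ℤ)) < x then ((2 : ℝ≥0∞) ^ (J - (n : ℤ))) ^ t else 0)
        ≤ ∑' n : ℕ, ((2 : ℝ≥0∞) ^ J) ^ t * ((2 : ℝ≥0∞) ^ (-t)) ^ n := by
          refine ENNReal.tsum_le_tsum fun n => ?_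
          have : ((2 : ℝ≥0∞) ^ (J - (n : ℤ))) ^ t = ((2 : ℝ≥0∞) ^ J) ^ t * ((2 : ℝ≥0∞) ^ (-t)) ^ n := by
            rw [two_zpow_rpow, two_zpow_rpow, ← ENNReal.rpow_natCast, ← ENNReal.rpow_mul,
              ← ENNReal.rpow_add _ _ (by simp) (by simp)]
            congr 1; push_cast; ring
          rw [← this]; split_ifs <;> simp
      _ = dyadicConst t * ((2 : ℝ≥0∞) ^ J) ^ t := by
          rw [ENNReal.tsum_mul_left, ENNReal.tsum_geometric, mul_comm, dyadicConst]
      _ ≤ _ := by gcongr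
  · intro j hj
    simp only [Function.mem_support, ne_eq, ite_eq_right_iff, Classical.not_imp] at hj
    have : j ≤ J := by
      by_contra hlt
      have := two_zpow_mono (show J + 1 ≤ j by lia)
      exact absurd hj.1 (not_lt.2 (hJ2.trans this))
    exact ⟨(J - j).toNat, by simp; lia⟩

/-- For finite nonzero `x` the top term alone suffices, since `x ≤ 2 · 2^J`. -/
theorem rpow_le_tsum_dyadic {t : ℝ} (ht : 0 < t) (x : ℝ≥0∞) :
    x ^ t ≤ 2 ^ t * ∑' j : ℤ, (if (2 : ℝ≥0∞) ^ j < x then ((2 : ℝ≥0∞) ^ j) ^ t else 0) := by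
  rcases eq_or_ne x 0 with rfl | h0
  · simp [ht]
  rcases eq_or_ne x ∞ with rfl | hx
  · have : ∑' j : ℤ, (if (2 : ℝ≥0∞) ^ j < ∞ then ((2 : ℝ≥0∞) ^ j) ^ t else 0) = ∞ := by
      rw [eq_top_iff]
      refine le_trans ?_ (ENNReal.tsum_comp_le_tsum_of_injective (f := fun n : ℕ => (n : ℤ))
        Nat.cast_injective _)
      have h1 : ∀ n : ℕ, (1 : ℝ≥0∞) ≤
          (if (2 : ℝ≥0∞) ^ (n : ℤ) < ∞ then ((2 : ℝ≥0∞) ^ (n : ℤ)) ^ t else 0) := by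
        intro n
        rw [if_pos (two_zpow_ne_top _).lt_top]
        refine ENNReal.one_le_rpow ?_ ht
        simpa using two_zpow_mono (show (0 : ℤ) ≤ n by positivity)
      calc (∞ : ℝ≥0∞) = ∑' _ : ℕ, (1 : ℝ≥0∞) := (ENNReal.tsum_const_eq_top_of_ne_zero (by simp)).symm
        _ ≤ _ := ENNReal.tsum_le_tsum h1
    rw [this, ENNReal.mul_top]
    · exact le_top
    · simp
  obtain ⟨J, hJ1, hJ2⟩ := ENNReal.exists_mem_Ioc_zpow (y := 2) h0 hx (by norm_num) (by simp)
  calc x ^ t ≤ (2 ^ (J + 1)) ^ t := by gcongr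
    _ = 2 ^ t * (2 ^ J) ^ t := by
        rw [two_zpow_rpow, two_zpow_rpow, ← ENNReal.rpow_add _ _ (by simp) (by simp)]
        congr 1; push_cast; ring
    _ ≤ _ := by
        gcongr
        refine le_trans ?_ (ENNReal.le_tsum J)
        rw [if_pos hJ1]

/-! ### Conditional expectations of nonnegative functions -/

section CondLExp

variable {Ω : Type*} {m m0 : MeasurableSpace Ω} {μ : Measure Ω}

/-- The measures with densities `v` and `condLExp m μ v` coincide on `m`, hence integrate `φ` alike;
no integrability is involved. -/
theorem lintegral_mul_condLExp [IsFiniteMeasure μ] (hm : m ≤ m0) {φ v : Ω → ℝ≥0∞} (hφ : Measurable[m] φ)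
    (hv : Measurable v) :
    ∫⁻ ω, φ ω * condLExp m μ v ω ∂μ = ∫⁻ ω, φ ω * v ω ∂μ := by
  have hE : Measurable (condLExp m μ v) := measurable_condLExp' m μ v
  have key : (μ.withDensity (condLExp m μ v)).trim hm = (μ.withDensity v).trim hm := by
    refine @Measure.ext _ m _ _ fun s hs => ?_
    rw [trim_measurableSet_eq hm hs, trim_measurableSet_eq hm hs, withDensity_apply _ (hm s hs),
      withDensity_apply _ (hm s hs), setLIntegral_condLExp hm μ v hs]
  have h1 := lintegral_trim (μ := μ.withDensity (condLExp m μ v)) hm hφ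
  have h2 := lintegral_trim (μ := μ.withDensity v) hm hφ
  rw [lintegral_withDensity_eq_lintegral_mul _ hE (hφ.mono hm le_rfl)] at h1
  rw [lintegral_withDensity_eq_lintegral_mul _ hv (hφ.mono hm le_rfl)] at h2
  simp only [Pi.mul_apply, mul_comm (v _), mul_comm (condLExp m μ v _)] at h1 h2
  rw [← h1, ← h2, key]

theorem condLExp_mul_left [IsFiniteMeasure μ] (hm : m ≤ m0) {φ v : Ω → ℝ≥0∞} (hφ : Measurable[m] φ)
    (hv : Measurable v) :
    condLExp m μ (fun ω => φ ω * v ω) =ᵐ[μ] fun ω => φ ω * condLExp m μ v ω := by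
  refine (ae_eq_condLExp hm μ _ (hφ.mul (measurable_condLExp m μ v)) fun s hs => ?_).symm
  have h := lintegral_mul_condLExp (μ := μ) hm (hφ.indicator hs) hv
  rw [← lintegral_indicator (hm s hs), ← lintegral_indicator (hm s hs)]
  convert h using 2 <;> · ext ω; by_cases hω : ω ∈ s <;> simp [hω]

theorem condLExp_const_mul {v : Ω → ℝ≥0∞} (hv : Measurable v) (c : ℝ≥0∞) :
    condLExp m μ (fun ω => c * v ω) =ᵐ[μ] fun ω => c * condLExp m μ v ω :=
  condLExp_smul v hv.aemeasurable c

theorem condLExp_indicator' [IsFiniteMeasure μ] (hm : m ≤ m0) {s : Set Ω} (hs : MeasurableSet[m] s) {v : Ω → ℝ≥0∞}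
    (hv : Measurable v) :
    condLExp m μ (s.indicator v) =ᵐ[μ] s.indicator (condLExp m μ v) := by
  have h := condLExp_mul_left (μ := μ) hm
    (φ := s.indicator fun _ => (1 : ℝ≥0∞)) (measurable_const.indicator hs) hv
  have e : ∀ w : Ω → ℝ≥0∞, (fun ω => s.indicator (fun _ => (1 : ℝ≥0∞)) ω * w ω) = s.indicator w := by
    intro w; ext ω; by_cases hω : ω ∈ s <;> simp [hω]
  rwa [e, e] at h

theorem condLExp_pos [IsFiniteMeasure μ] (hm : m ≤ m0) {v : Ω → ℝ≥0∞} (hv : Measurable v) (h : ∀ᵐ ω ∂μ, 0 < v ω) :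
    ∀ᵐ ω ∂μ, 0 < condLExp m μ v ω := by
  set s : Set Ω := {ω | condLExp m μ v ω = 0} with hs
  have hsm : MeasurableSet[m] s := measurable_condLExp m μ v (measurableSet_singleton 0)
  have h0 : ∫⁻ ω in s, v ω ∂μ = 0 := by
    rw [← setLIntegral_condLExp hm μ v hsm, setLIntegral_congr_fun (hm s hsm) (g := fun _ => 0)]
    · simp
    · intro ω hω; exact hω
  rw [lintegral_eq_zero_iff hv, EventuallyEq, ae_restrict_iff' (hm s hsm)] at h0
  filter_upwards [h0, h] with ω h1 h2
  rw [pos_iff_ne_zero]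
  intro h3
  exact h2.ne' (h1 h3)

/-- Young's inequality with a dyadic parameter: on each side of `y = 2^j x` one of the two terms
dominates. The parameters being countable, the conditional versions hold simultaneously off one null
set. -/
theorem rpow_mul_rpow_le_add {θ : ℝ} (h0 : 0 < θ) (h1 : θ < 1) (x y : ℝ≥0∞) (j : ℤ) :
    x ^ θ * y ^ (1 - θ) ≤ (2 ^ j) ^ (1 - θ) * x + (2 ^ j) ^ (-θ) * y := by
  have hsum : ∀ z : ℝ≥0∞, z ^ θ * z ^ (1 - θ) = z := by
    intro z
    rw [← ENNReal.rpow_add_of_nonneg _ _ h0.le (by linarith)]; simp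
  rcases le_total y (2 ^ j * x) with h | h
  · refine le_trans ?_ le_self_add
    calc x ^ θ * y ^ (1 - θ) ≤ x ^ θ * (2 ^ j * x) ^ (1 - θ) := by
          gcongr
      _ = (2 ^ j) ^ (1 - θ) * (x ^ θ * x ^ (1 - θ)) := by
          rw [ENNReal.mul_rpow_of_nonneg _ _ (by linarith)]; ring
      _ = _ := by rw [hsum]
  · refine le_trans ?_ le_add_self
    have hx : x ≤ (2 ^ j)⁻¹ * y := by
      calc x = (2 ^ j)⁻¹ * (2 ^ j * x) := by
            rw [← mul_assoc, ENNReal.inv_mul_cancel (two_zpow_pos j).ne' (two_zpow_ne_top j), one_mul]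
        _ ≤ _ := by gcongr
    calc x ^ θ * y ^ (1 - θ) ≤ ((2 ^ j)⁻¹ * y) ^ θ * y ^ (1 - θ) := by gcongr
      _ = (2 ^ j) ^ (-θ) * (y ^ θ * y ^ (1 - θ)) := by
          rw [ENNReal.mul_rpow_of_nonneg _ _ h0.le, ENNReal.inv_rpow, ENNReal.rpow_neg]; ring
      _ = _ := by rw [hsum]

/-- Optimization in `j`: when `2^j` is comparable to `b / a`, both terms have the size of the
geometric mean. The constant is `3 = 1 + 2`, the `2` paying for the rounding to a power of two. -/
theorem le_rpow_mul_rpow_of_forall {θ : ℝ} (h0 : 0 < θ) (h1 : θ < 1) {a b z : ℝ≥0∞} (ha : a ≠ ∞)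
    (hb : b ≠ ∞) (h : ∀ j : ℤ, z ≤ (2 ^ j) ^ (1 - θ) * a + (2 ^ j) ^ (-θ) * b) :
    z ≤ 3 * (a ^ θ * b ^ (1 - θ)) := by
  have key : ∀ c d : ℝ≥0∞, c ≠ 0 → d ≠ 0 → c ≠ ∞ → d ≠ ∞ → a ≤ c → b ≤ d →
      z ≤ 3 * (c ^ θ * d ^ (1 - θ)) := by
    intro c d hc0 hd0 hc hd hac hbd
    obtain ⟨J, hJ1, hJ2⟩ := ENNReal.exists_mem_Ioc_zpow (x := d / c) (y := 2)
      (ENNReal.div_pos hd0 hc).ne' (ENNReal.div_ne_top hd hc0) (by norm_num) (by simp)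
    have e1 : (d / c) ^ (1 - θ) * c = c ^ θ * d ^ (1 - θ) := by
      rw [ENNReal.div_rpow_of_nonneg _ _ (by linarith), ENNReal.div_eq_inv_mul, mul_right_comm,
        ← ENNReal.rpow_neg]
      congr 1
      nth_rewrite 2 [← ENNReal.rpow_one c]
      rw [← ENNReal.rpow_add _ _ hc0 hc]; congr 1; ring
    have e2 : (d / c) ^ (-θ) * d = c ^ θ * d ^ (1 - θ) := by
      rw [ENNReal.rpow_neg, ← ENNReal.inv_rpow, ENNReal.inv_div (Or.inl hc) (Or.inl hc0),
        ENNReal.div_rpow_of_nonneg _ _ h0.le, ENNReal.div_eq_inv_mul, mul_comm (_ ⁻¹), mul_assoc,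
        ← ENNReal.rpow_neg]
      congr 1
      nth_rewrite 2 [← ENNReal.rpow_one d]
      rw [← ENNReal.rpow_add _ _ hd0 hd]; congr 1; ring
    have e3 : ((2 : ℝ≥0∞) ^ J) ^ (-θ) ≤ 2 * (d / c) ^ (-θ) := by
      have : (d / c) ≤ 2 * 2 ^ J := by
        refine hJ2.trans_eq ?_
        rw [ENNReal.zpow_add (by simp) (by simp), zpow_one, mul_comm]
      rw [ENNReal.rpow_neg, ENNReal.rpow_neg, ← ENNReal.inv_rpow, ← ENNReal.inv_rpow]
      have h2 : ((2 : ℝ≥0∞) ^ J)⁻¹ ≤ 2 * (d / c)⁻¹ := by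
        rw [← ENNReal.inv_le_inv, inv_inv, ENNReal.mul_inv (by simp) (by simp), inv_inv]
        calc 2⁻¹ * (d / c) ≤ 2⁻¹ * (2 * 2 ^ J) := by gcongr
          _ = 2 ^ J := by rw [← mul_assoc, ENNReal.inv_mul_cancel (by simp) (by simp), one_mul]
      calc _ ≤ (2 * (d / c)⁻¹) ^ θ := by gcongr
        _ = 2 ^ θ * (d / c)⁻¹ ^ θ := ENNReal.mul_rpow_of_nonneg _ _ h0.le
        _ ≤ 2 ^ (1 : ℝ) * (d / c)⁻¹ ^ θ := by gcongr; norm_num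
        _ = _ := by simp
    calc z ≤ (2 ^ J) ^ (1 - θ) * a + (2 ^ J) ^ (-θ) * b := h J
      _ ≤ (d / c) ^ (1 - θ) * c + 2 * (d / c) ^ (-θ) * d := by
          gcongr
      _ = 3 * (c ^ θ * d ^ (1 - θ)) := by
          rw [mul_assoc, e1, e2]; ring
  -- Since `a` or `b` may vanish, `key` is applied to `a + ε` and `b + ε`, and `ε` tends to `0`.
  have hlim : Tendsto (fun ε : ℝ≥0∞ => 3 * ((a + ε) ^ θ * (b + ε) ^ (1 - θ))) (𝓝[>] 0)
      (𝓝 (3 * ((a + 0) ^ θ * (b + 0) ^ (1 - θ)))) := by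
    have hc : ∀ c : ℝ≥0∞, Tendsto (fun ε : ℝ≥0∞ => c + ε) (𝓝[>] 0) (𝓝 (c + 0)) := fun c =>
      (tendsto_const_nhds.add tendsto_id).mono_left nhdsWithin_le_nhds
    have hfin : ∀ {c : ℝ≥0∞} {s : ℝ}, c ≠ ∞ → 0 ≤ s → (c + 0) ^ s ≠ ∞ := fun hc hs =>
      ENNReal.rpow_ne_top_of_nonneg hs (by simpa using hc)
    refine ENNReal.Tendsto.const_mul (ENNReal.Tendsto.mul
      ((ENNReal.continuous_rpow_const.tendsto _).comp (hc a)) (Or.inr (hfin hb (by linarith)))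
      ((ENNReal.continuous_rpow_const.tendsto _).comp (hc b)) (Or.inr (hfin ha h0.le))) (Or.inr (by simp))
  simp only [add_zero] at hlim
  refine ge_of_tendsto hlim ?_
  have : ∀ᶠ ε : ℝ≥0∞ in 𝓝[>] 0, ε < 1 :=
    nhdsWithin_le_nhds (Iio_mem_nhds (by norm_num))
  filter_upwards [self_mem_nhdsWithin, this] with ε hε hε1
  have hε0 : ε ≠ 0 := (Set.mem_Ioi.1 hε).ne'
  have hεt : ε ≠ ∞ := (hε1.trans (by simp)).ne
  exact key _ _ (by simp [hε0]) (by simp [hε0]) (by simp [ha, hεt]) (by simp [hb, hεt])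
    le_self_add le_self_add

/-- Conditional Hölder inequality, up to a numerical constant. -/
theorem condLExp_rpow_mul_rpow_le {f g : Ω → ℝ≥0∞} (hf : Measurable f)
    (hg : Measurable g) {θ : ℝ} (h0 : 0 < θ) (h1 : θ < 1)
    (hfe : ∀ᵐ ω ∂μ, condLExp m μ f ω ≠ ∞) (hge : ∀ᵐ ω ∂μ, condLExp m μ g ω ≠ ∞) :
    ∀ᵐ ω ∂μ, condLExp m μ (fun x => f x ^ θ * g x ^ (1 - θ)) ω ≤
      3 * (condLExp m μ f ω ^ θ * condLExp m μ g ω ^ (1 - θ)) := by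
  have hj : ∀ j : ℤ, ∀ᵐ ω ∂μ, condLExp m μ (fun x => f x ^ θ * g x ^ (1 - θ)) ω ≤
      (2 ^ j) ^ (1 - θ) * condLExp m μ f ω + (2 ^ j) ^ (-θ) * condLExp m μ g ω := by
    intro j
    have hmono := condLExp_mono (P := μ) (mΩ := m)
      (Eventually.of_forall fun x => rpow_mul_rpow_le_add h0 h1 (f x) (g x) j :
        (fun x => f x ^ θ * g x ^ (1 - θ)) ≤ᵐ[μ]
        (fun x => ((2 : ℝ≥0∞) ^ j) ^ (1 - θ) * f x) + (fun x => ((2 : ℝ≥0∞) ^ j) ^ (-θ) * g x))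
    have hadd := condLExp_add_left (P := μ) (mΩ := m) (X := fun x => ((2 : ℝ≥0∞) ^ j) ^ (1 - θ) * f x)
      (fun x => ((2 : ℝ≥0∞) ^ j) ^ (-θ) * g x) (hf.const_mul _).aemeasurable
    filter_upwards [hmono, hadd, condLExp_const_mul (m := m) (μ := μ) hf (((2 : ℝ≥0∞) ^ j) ^ (1 - θ)),
      condLExp_const_mul (m := m) (μ := μ) hg (((2 : ℝ≥0∞) ^ j) ^ (-θ))] with ω a1 a2 a3 a4
    rw [a2, Pi.add_apply, a3, a4] at a1
    exact a1
  filter_upwards [ae_all_iff.2 hj, hfe, hge] with ω a1 a2 a3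
  exact le_rpow_mul_rpow_of_forall h0 h1 a2 a3 a1

end CondLExp

/-! ### Weighted maximal inequality -/

section Weights

variable {Ω : Type*} {m0 : MeasurableSpace Ω}

/-- The maximal function of `k` with respect to the weight `v`. -/
noncomputable def weightMax (μ : Measure Ω) (𝓖 : Filtration ℕ m0) (v k : Ω → ℝ≥0∞) (ω : Ω) : ℝ≥0∞ :=
  ⨆ n, condLExp (𝓖 n) μ (fun x => v x * k x) ω / condLExp (𝓖 n) μ v ω

variable {μ : Measure Ω} {𝓖 : Filtration ℕ m0}

theorem measurable_weightMax (v k : Ω → ℝ≥0∞) : Measurable (weightMax μ 𝓖 v k) := by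
  unfold weightMax
  exact Measurable.iSup fun n => (measurable_condLExp' _ _ _).div (measurable_condLExp' _ _ _)

/-- Doob's weak type inequality. Split the level set according to the first `n` at which the
quotient exceeds `c`; the piece belongs to `𝓖 n`, so both conditional expectations can be removed on
it. -/
theorem mul_lintegral_weightMax_le [IsFiniteMeasure μ] {v k : Ω → ℝ≥0∞} (c : ℝ≥0∞) :
    c * ∫⁻ ω in {ω | c < weightMax μ 𝓖 v k ω}, v ω ∂μ ≤
      ∫⁻ ω in {ω | c < weightMax μ 𝓖 v k ω}, v ω * k ω ∂μ := by
  set A : ℕ → Set Ω := fun n =>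
    {ω | c < condLExp (𝓖 n) μ (fun x => v x * k x) ω / condLExp (𝓖 n) μ v ω} with hA
  have hAm : ∀ n, MeasurableSet[𝓖 n] (A n) := fun n =>
    ((measurable_condLExp (𝓖 n) μ _).div (measurable_condLExp (𝓖 n) μ v)) measurableSet_Ioi
  have hDm : ∀ n, MeasurableSet[𝓖 n] (disjointed A n) := by
    intro n
    rw [disjointed_eq_inter_compl]
    refine (hAm n).inter (MeasurableSet.iInter fun i => MeasurableSet.iInter fun hi => ?_)
    exact (𝓖.mono hi.le _ (hAm i)).compl
  have hU : {ω | c < weightMax μ 𝓖 v k ω} = ⋃ n, disjointed A n := by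
    rw [iUnion_disjointed]
    ext ω; simp [hA, weightMax, lt_iSup_iff]
  have hDm' : ∀ n, MeasurableSet (disjointed A n) := fun n => 𝓖.le n _ (hDm n)
  rw [hU, lintegral_iUnion hDm' (disjoint_disjointed A),
    lintegral_iUnion hDm' (disjoint_disjointed A), ← ENNReal.tsum_mul_left]
  refine ENNReal.tsum_le_tsum fun n => ?_
  rw [← setLIntegral_condLExp (𝓖.le n) μ v (hDm n),
    ← setLIntegral_condLExp (𝓖.le n) μ (fun ω => v ω * k ω) (hDm n),
    ← lintegral_const_mul _ (measurable_condLExp' _ _ _)]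
  refine setLIntegral_mono (measurable_condLExp' _ _ _) fun ω hω => ?_
  have : ω ∈ A n := disjointed_subset A n hω
  exact ENNReal.mul_le_of_le_div (le_of_lt this)

/-- The maximal operator does not increase constants: the quotient of `𝔼_n(v)` by itself is at most
`1`, also where it is degenerate. -/
theorem weightMax_le_add [IsFiniteMeasure μ] {v k k' : Ω → ℝ≥0∞} (hv : Measurable v)
    (hk' : Measurable k') (c : ℝ≥0∞) (h : ∀ ω, k ω ≤ k' ω + c) :
    ∀ᵐ ω ∂μ, weightMax μ 𝓖 v k ω ≤ weightMax μ 𝓖 v k' ω + c := by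
  have hn : ∀ n, ∀ᵐ ω ∂μ, condLExp (𝓖 n) μ (fun x => v x * k x) ω ≤
      condLExp (𝓖 n) μ (fun x => v x * k' x) ω + c * condLExp (𝓖 n) μ v ω := by
    intro n
    have hmono := condLExp_mono (P := μ) (mΩ := 𝓖 n) (Eventually.of_forall fun x => by
        calc v x * k x ≤ v x * (k' x + c) := by gcongr; exact h x
          _ = v x * k' x + c * v x := by ring :
      (fun x => v x * k x) ≤ᵐ[μ] (fun x => v x * k' x) + (fun x => c * v x))
    have hadd := condLExp_add_left (P := μ) (mΩ := 𝓖 n) (X := fun x => v x * k' x)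
      (fun x => c * v x) (hv.mul hk').aemeasurable
    filter_upwards [hmono, hadd, condLExp_const_mul (m := 𝓖 n) (μ := μ) hv c] with ω a1 a2 a3
    rw [a2, Pi.add_apply, a3] at a1
    exact a1
  filter_upwards [ae_all_iff.2 hn] with ω hω
  refine iSup_le fun n => ?_
  calc _ ≤ (condLExp (𝓖 n) μ (fun x => v x * k' x) ω + c * condLExp (𝓖 n) μ v ω) /
        condLExp (𝓖 n) μ v ω := by gcongr; exact hω n
    _ = condLExp (𝓖 n) μ (fun x => v x * k' x) ω / condLExp (𝓖 n) μ v ω +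
        c * condLExp (𝓖 n) μ v ω / condLExp (𝓖 n) μ v ω := ENNReal.add_div
    _ ≤ _ := by
        gcongr
        · exact le_iSup (fun n => condLExp (𝓖 n) μ (fun x => v x * k' x) ω / condLExp (𝓖 n) μ v ω) n
        · rw [mul_div_assoc]
          exact mul_le_of_le_one_right (by simp) ENNReal.div_self_le_one

/-- The constant in the strong maximal inequality. -/
noncomputable def maxConst (q : ℝ) : ℝ≥0∞ := max 1 (2 ^ q * (2 ^ q * dyadicConst (q - 1)))

theorem maxConst_ne_top {q : ℝ} (hq : 1 < q) : maxConst q ≠ ∞ := by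
  unfold maxConst
  have := dyadicConst_ne_top (t := q - 1) (by linarith)
  simp only [ne_eq, max_eq_top, ENNReal.one_ne_top, false_or]
  exact ENNReal.mul_ne_top (by simp) (ENNReal.mul_ne_top (by simp) this)

/-- Interpolation by dyadic levels. If `k'` is the part of `k` above `c`, then `M k ≤ M k' + c`, so
`{M k > 2c}` lies in `{M k' > c}`, where the weak type inequality applies. Summing over `c = 2^j`
rebuilds the powers. The constant depends on `q` alone. -/
theorem lintegral_weightMax_rpow_le [IsFiniteMeasure μ] {v k : Ω → ℝ≥0∞} (hv : Measurable v)
    (hk : Measurable k) {q : ℝ} (hq : 1 < q) :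
    ∫⁻ ω, v ω * weightMax μ 𝓖 v k ω ^ q ∂μ ≤ maxConst q * ∫⁻ ω, v ω * k ω ^ q ∂μ := by
  have hM := measurable_weightMax (μ := μ) (𝓖 := 𝓖) v k
  have hq0 : 0 < q := by linarith
  have hlev : ∀ j : ℤ, ∫⁻ ω, v ω * (if (2 : ℝ≥0∞) ^ j < weightMax μ 𝓖 v k ω / 2 then ((2 : ℝ≥0∞) ^ j) ^ q
      else 0) ∂μ ≤ ∫⁻ ω, v ω * k ω * (if (2 : ℝ≥0∞) ^ j < k ω then ((2 : ℝ≥0∞) ^ j) ^ (q - 1) else 0) ∂μ := by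
    intro j
    set c : ℝ≥0∞ := 2 ^ j with hc
    have hc0 : c ≠ 0 := (two_zpow_pos j).ne'
    have hct : c ≠ ∞ := two_zpow_ne_top j
    set k' : Ω → ℝ≥0∞ := {ω | c < k ω}.indicator k with hk'
    have hks : MeasurableSet {ω | c < k ω} := measurableSet_lt measurable_const hk
    have hk'm : Measurable k' := hk.indicator hks
    have hcq : c ^ q = c ^ (q - 1) * c := by
      nth_rewrite 3 [← ENNReal.rpow_one c]
      rw [← ENNReal.rpow_add _ _ hc0 hct]; congr 1; ring
    have hle : ∀ ω, k ω ≤ k' ω + c := by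
      intro ω
      by_cases h : c < k ω
      · simp [hk', h]
      · exact (not_lt.1 h).trans le_add_self
    have hae := weightMax_le_add (μ := μ) (𝓖 := 𝓖) hv hk'm c hle
    have hms : MeasurableSet {ω | c < weightMax μ 𝓖 v k' ω} :=
      measurableSet_lt measurable_const (measurable_weightMax _ _)
    calc ∫⁻ ω, v ω * (if c < weightMax μ 𝓖 v k ω / 2 then c ^ q else 0) ∂μ
        ≤ ∫⁻ ω, {ω | c < weightMax μ 𝓖 v k' ω}.indicator (fun ω => c ^ q * v ω) ω ∂μ := by
          refine lintegral_mono_ae ?_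
          filter_upwards [hae] with ω hω
          by_cases h : c < weightMax μ 𝓖 v k ω / 2
          · have : c < weightMax μ 𝓖 v k' ω := by
              rw [ENNReal.lt_div_iff_mul_lt (by simp) (by simp), mul_two] at h
              exact lt_of_add_lt_add_right (h.trans_le hω)
            simp [h, this, mul_comm]
          · simp [h]
      _ = c ^ (q - 1) * (c * ∫⁻ ω in {ω | c < weightMax μ 𝓖 v k' ω}, v ω ∂μ) := by
          rw [lintegral_indicator hms, lintegral_const_mul _ hv, hcq, mul_assoc]
      _ ≤ c ^ (q - 1) * ∫⁻ ω in {ω | c < weightMax μ 𝓖 v k' ω}, v ω * k' ω ∂μ := by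
          gcongr; exact mul_lintegral_weightMax_le c
      _ ≤ c ^ (q - 1) * ∫⁻ ω, v ω * k' ω ∂μ := by
          gcongr; exact Measure.restrict_le_self
      _ = _ := by
          have hm : Measurable fun ω => v ω * k' ω := hv.mul hk'm
          rw [← lintegral_const_mul _ hm]
          refine lintegral_congr fun ω => ?_
          by_cases h : c < k ω
          · simp [hk', h]; ring
          · simp [hk', h]
  have hfm : ∀ (f : Ω → ℝ≥0∞) (t : ℝ) (j : ℤ), Measurable f →
      Measurable fun ω => if (2 : ℝ≥0∞) ^ j < f ω then ((2 : ℝ≥0∞) ^ j) ^ t else 0 := fun f t j hf =>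
    Measurable.ite (measurableSet_lt measurable_const hf) measurable_const measurable_const
  calc ∫⁻ ω, v ω * weightMax μ 𝓖 v k ω ^ q ∂μ
      ≤ ∫⁻ ω, (2 ^ q * 2 ^ q) * ∑' j : ℤ, v ω * (if (2 : ℝ≥0∞) ^ j < weightMax μ 𝓖 v k ω / 2 then
          ((2 : ℝ≥0∞) ^ j) ^ q else 0) ∂μ := by
        refine lintegral_mono fun ω => ?_
        have h1 : weightMax μ 𝓖 v k ω ^ q = 2 ^ q * (weightMax μ 𝓖 v k ω / 2) ^ q := by
          rw [← ENNReal.mul_rpow_of_nonneg _ _ hq0.le, ENNReal.mul_div_cancel (by simp) (by simp)]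
        rw [ENNReal.tsum_mul_left, h1]
        calc _ ≤ v ω * (2 ^ q * (2 ^ q * _)) := by
              gcongr; exact rpow_le_tsum_dyadic hq0 _
          _ = _ := by ring
    _ = (2 ^ q * 2 ^ q) * ∑' j : ℤ, ∫⁻ ω, v ω * (if (2 : ℝ≥0∞) ^ j < weightMax μ 𝓖 v k ω / 2 then
          ((2 : ℝ≥0∞) ^ j) ^ q else 0) ∂μ := by
        rw [lintegral_const_mul, lintegral_tsum]
        · exact fun j => (hv.mul (hfm _ q j (hM.div_const 2))).aemeasurable
        · exact Measurable.tsum fun j => hv.mul (hfm _ q j (hM.div_const 2))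
    _ ≤ (2 ^ q * 2 ^ q) * ∑' j : ℤ, ∫⁻ ω, v ω * k ω * (if (2 : ℝ≥0∞) ^ j < k ω then
          ((2 : ℝ≥0∞) ^ j) ^ (q - 1) else 0) ∂μ := by
        exact mul_le_mul' le_rfl (ENNReal.tsum_le_tsum hlev)
    _ = (2 ^ q * 2 ^ q) * ∫⁻ ω, v ω * k ω * ∑' j : ℤ, (if (2 : ℝ≥0∞) ^ j < k ω then
          ((2 : ℝ≥0∞) ^ j) ^ (q - 1) else 0) ∂μ := by
        rw [← lintegral_tsum]
        · simp_rw [ENNReal.tsum_mul_left]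
        · exact fun j => ((hv.mul hk).mul (hfm _ _ j hk)).aemeasurable
    _ ≤ (2 ^ q * 2 ^ q) * ∫⁻ ω, dyadicConst (q - 1) * (v ω * k ω ^ q) ∂μ := by
        refine mul_le_mul' le_rfl (lintegral_mono fun ω => ?_)
        have hkq : k ω * k ω ^ (q - 1) = k ω ^ q := by
          nth_rewrite 1 [← ENNReal.rpow_one (k ω)]
          rw [← ENNReal.rpow_add_of_nonneg _ _ (by norm_num) (by linarith)]; congr 1; ring
        calc _ ≤ v ω * k ω * (dyadicConst (q - 1) * k ω ^ (q - 1)) := by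
              exact mul_le_mul' le_rfl (tsum_dyadic_le (by linarith) _)
          _ = dyadicConst (q - 1) * (v ω * (k ω * k ω ^ (q - 1))) := by ring
          _ = _ := by rw [hkq]
    _ = (2 ^ q * (2 ^ q * dyadicConst (q - 1))) * ∫⁻ ω, v ω * k ω ^ q ∂μ := by
        have hm : Measurable fun ω => v ω * k ω ^ q := hv.mul (hk.pow_const q)
        rw [lintegral_const_mul _ hm]; ring
    _ ≤ _ := by gcongr; exact le_max_right _ _

/-- Rubio de Francia's majorant: `k` is dominated by some `h` with `𝔼_n(v h) ≤ C h 𝔼_n(v)`, with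
control of the weighted `L_q`-norm. -/
theorem exists_majorant {q : ℝ} (hq : 1 < q) : ∃ C : ℝ≥0, C ≠ 0 ∧
    ∀ {Ω : Type*} {m0 : MeasurableSpace Ω} (μ : Measure Ω) [IsFiniteMeasure μ] (𝓖 : Filtration ℕ m0)
      (v k : Ω → ℝ≥0∞), Measurable v → Measurable k → (∀ᵐ ω ∂μ, 0 < v ω) → ∫⁻ ω, v ω ∂μ ≠ ∞ →
      ∃ h : Ω → ℝ≥0∞, Measurable h ∧ (∀ ω, k ω ≤ h ω) ∧
        ∫⁻ ω, v ω * h ω ^ q ∂μ ≤ C * ∫⁻ ω, v ω * k ω ^ q ∂μ ∧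
        ∀ n, ∀ᵐ ω ∂μ, condLExp (𝓖 n) μ (fun x => v x * h x) ω ≤
          C * (h ω * condLExp (𝓖 n) μ v ω) := by
  have hq0 : 0 < q := by linarith
  set B := maxConst q with hB
  have hB1 : 1 ≤ B := le_max_left _ _
  have hBt : B ≠ ∞ := maxConst_ne_top hq
  -- Chosen so that `c ^ q * B = 1/2`. The majorant is `∑ c^(2i) M^i k`: one factor `c^i` is spent
  -- on bounding the sum by a supremum, the other makes the weighted `L_q`-norms of the terms
  -- summable. The lower bound `1` built into `maxConst` ensures `c < 1`.
  set c : ℝ≥0∞ := (2 * B)⁻¹ ^ (1 / q) with hc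
  have h2B : 1 < 2 * B := by
    calc (1 : ℝ≥0∞) < 2 * 1 := by norm_num
      _ ≤ 2 * B := by gcongr
  have h2Bt : 2 * B ≠ ∞ := ENNReal.mul_ne_top (by simp) hBt
  have hc1 : c < 1 := ENNReal.rpow_lt_one (ENNReal.inv_lt_one.2 h2B) (by positivity)
  have hct : c ≠ ∞ := (hc1.trans ENNReal.one_lt_top).ne
  have hc0 : c ≠ 0 := by
    rw [hc]
    exact (ENNReal.rpow_pos (ENNReal.inv_pos.2 h2Bt) (by simp; exact fun h => by simp [h] at hB1)).ne'
  have hcq : c ^ q = (2 * B)⁻¹ := by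
    rw [hc, ← ENNReal.rpow_mul, one_div_mul_cancel hq0.ne', ENNReal.rpow_one]
  have hcB : c ^ q * B = 2⁻¹ := by
    rw [hcq, ENNReal.mul_inv (by simp) (by simp), mul_assoc,
      ENNReal.inv_mul_cancel (by rintro h; simp [h] at hB1) hBt, mul_one]
  set S : ℝ≥0∞ := (1 - c)⁻¹ with hS
  have hSt : S ≠ ∞ := by
    rw [hS, ENNReal.inv_ne_top]; exact (tsub_pos_of_lt hc1).ne'
  set K : ℝ≥0∞ := max 1 (max (S ^ q * 2) (c ^ 2)⁻¹) with hK
  have hKt : K ≠ ∞ := by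
    rw [hK]
    simp only [ne_eq, max_eq_top, ENNReal.one_ne_top, false_or, not_or]
    exact ⟨ENNReal.mul_ne_top (ENNReal.rpow_ne_top_of_nonneg hq0.le hSt) (by simp),
      ENNReal.inv_ne_top.2 (pow_ne_zero 2 hc0)⟩
  refine ⟨K.toNNReal, ?_, ?_⟩
  · rw [ne_eq, ENNReal.toNNReal_eq_zero_iff, not_or]
    exact ⟨(lt_of_lt_of_le one_pos (le_max_left _ _)).ne', hKt⟩
  intro Ω m0 μ _ 𝓖 v k hv hk hv0 hvt
  rw [ENNReal.coe_toNNReal hKt]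
  set M : ℕ → Ω → ℝ≥0∞ := fun i => (weightMax μ 𝓖 v)^[i] k with hMdef
  have hM0 : M 0 = k := rfl
  have hMs : ∀ i, M (i + 1) = weightMax μ 𝓖 v (M i) := fun i =>
    Function.iterate_succ_apply' _ _ _
  have hMm : ∀ i, Measurable (M i) := by
    intro i
    cases i with
    | zero => exact hk
    | succ i => rw [hMs]; exact measurable_weightMax _ _
  have hMq : ∀ i, ∫⁻ ω, v ω * M i ω ^ q ∂μ ≤ B ^ i * ∫⁻ ω, v ω * k ω ^ q ∂μ := by
    intro i
    induction i with
    | zero => simp [hM0]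
    | succ i ih =>
      rw [hMs]
      refine (lintegral_weightMax_rpow_le hv (hMm i) hq).trans ?_
      rw [pow_succ', mul_assoc]
      gcongr
  refine ⟨fun ω => ∑' i, c ^ (2 * i) * M i ω, ?_, ?_, ?_, ?_⟩
  · exact Measurable.tsum fun i => (hMm i).const_mul _
  · intro ω
    refine le_trans ?_ (ENNReal.le_tsum 0)
    simp [hM0]
  · have hpt : ∀ ω, (∑' i, c ^ (2 * i) * M i ω) ^ q ≤ S ^ q * ∑' i, (c ^ q) ^ i * M i ω ^ q := by
      intro ω
      have h1 : ∑' i, c ^ (2 * i) * M i ω ≤ S * ⨆ i, c ^ i * M i ω := by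
        rw [hS, ← ENNReal.tsum_geometric, ← ENNReal.tsum_mul_right]
        refine ENNReal.tsum_le_tsum fun i => ?_
        calc c ^ (2 * i) * M i ω = c ^ i * (c ^ i * M i ω) := by rw [two_mul, pow_add]; ring
          _ ≤ _ := by gcongr; exact le_iSup (fun i => c ^ i * M i ω) i
      have h2 : (⨆ i, c ^ i * M i ω) ^ q ≤ ∑' i, (c ^ q) ^ i * M i ω ^ q := by
        rw [← ENNReal.le_rpow_inv_iff hq0]
        refine iSup_le fun i => ?_
        rw [ENNReal.le_rpow_inv_iff hq0]
        refine le_trans (le_of_eq ?_) (ENNReal.le_tsum i)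
        rw [ENNReal.mul_rpow_of_nonneg _ _ hq0.le]
        congr 1
        generalize c = c'
        rw [← ENNReal.rpow_natCast, ← ENNReal.rpow_natCast,
          ← ENNReal.rpow_mul, ← ENNReal.rpow_mul, mul_comm q]
      calc _ ≤ (S * ⨆ i, c ^ i * M i ω) ^ q := by gcongr
        _ = S ^ q * (⨆ i, c ^ i * M i ω) ^ q := ENNReal.mul_rpow_of_nonneg _ _ hq0.le
        _ ≤ _ := by gcongr
    calc ∫⁻ ω, v ω * (∑' i, c ^ (2 * i) * M i ω) ^ q ∂μ
        ≤ ∫⁻ ω, S ^ q * ∑' i, (c ^ q) ^ i * (v ω * M i ω ^ q) ∂μ := by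
          refine lintegral_mono fun ω => ?_
          calc _ ≤ v ω * (S ^ q * ∑' i, (c ^ q) ^ i * M i ω ^ q) := by gcongr; exact hpt ω
            _ = S ^ q * (v ω * ∑' i, (c ^ q) ^ i * M i ω ^ q) := by ring
            _ = _ := by
              rw [← ENNReal.tsum_mul_left]; congr 2; ext i; ring
      _ = S ^ q * ∑' i, (c ^ q) ^ i * ∫⁻ ω, v ω * M i ω ^ q ∂μ := by
          have hm : ∀ i, Measurable fun ω => v ω * M i ω ^ q := fun i =>
            hv.mul ((hMm i).pow_const q)
          rw [lintegral_const_mul _ (Measurable.tsum fun i => (hm i).const_mul _),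
            lintegral_tsum fun i => ((hm i).const_mul _).aemeasurable]
          congr 2; ext i; exact lintegral_const_mul _ (hm i)
      _ ≤ S ^ q * ∑' i, (c ^ q) ^ i * (B ^ i * ∫⁻ ω, v ω * k ω ^ q ∂μ) := by
          gcongr with i; exact hMq i
      _ = S ^ q * 2 * ∫⁻ ω, v ω * k ω ^ q ∂μ := by
          simp_rw [← mul_assoc, ← mul_pow, hcB, ENNReal.tsum_mul_right]
          rw [ENNReal.tsum_geometric, ENNReal.one_sub_inv_two, inv_inv, mul_assoc]
      _ ≤ _ := by
          gcongr; exact (le_max_left _ _).trans (le_max_right _ _)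
  -- Applying `M` shifts the series by one index, so `M h ≤ c⁻² h`.
  · intro n
    have hE : condLExp (𝓖 n) μ (fun x => v x * ∑' i, c ^ (2 * i) * M i x) =ᵐ[μ]
        ∑' i, condLExp (𝓖 n) μ (fun x => c ^ (2 * i) * (v x * M i x)) := by
      have := condLExp_tsum (P := μ) (𝓖 n) (X := fun (i : ℕ) x => c ^ (2 * i) * (v x * M i x))
        fun i => ((hv.mul (hMm i)).const_mul _).aemeasurable
      convert this using 2
      ext x
      simp only [ENNReal.tsum_apply]
      rw [← ENNReal.tsum_mul_left]; congr 1; ext i; ring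
    have hi : ∀ i, condLExp (𝓖 n) μ (fun x => c ^ (2 * i) * (v x * M i x)) =ᵐ[μ]
        fun x => c ^ (2 * i) * condLExp (𝓖 n) μ (fun x => v x * M i x) x := fun i =>
      condLExp_const_mul (hv.mul (hMm i)) _
    filter_upwards [hE, ae_all_iff.2 hi, condLExp_pos (𝓖.le n) hv hv0,
      condLExp_ne_top (mΩ := 𝓖 n) hvt] with ω a1 a2 a3 a4
    rw [a1, ENNReal.tsum_apply]
    calc ∑' i, condLExp (𝓖 n) μ (fun x => c ^ (2 * i) * (v x * M i x)) ω
        ≤ ∑' i, (c ^ 2)⁻¹ * condLExp (𝓖 n) μ v ω * (c ^ (2 * (i + 1)) * M (i + 1) ω) := by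
          refine ENNReal.tsum_le_tsum fun i => ?_
          rw [a2 i]
          have h1 : condLExp (𝓖 n) μ (fun x => v x * M i x) ω ≤ M (i + 1) ω * condLExp (𝓖 n) μ v ω := by
            rw [← ENNReal.div_le_iff a3.ne' a4, hMs]
            exact le_iSup (fun n => condLExp (𝓖 n) μ (fun x => v x * M i x) ω /
              condLExp (𝓖 n) μ v ω) n
          have h2 : c ^ (2 * i) = (c ^ 2)⁻¹ * c ^ (2 * (i + 1)) := by
            rw [mul_add, pow_add, mul_one, mul_comm (c ^ (2 * i)), ← mul_assoc,
              ENNReal.inv_mul_cancel (pow_ne_zero 2 hc0) (ENNReal.pow_ne_top hct), one_mul]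
          rw [h2]
          calc _ ≤ (c ^ 2)⁻¹ * c ^ (2 * (i + 1)) * (M (i + 1) ω * condLExp (𝓖 n) μ v ω) := by gcongr
            _ = _ := by ring
      _ = (c ^ 2)⁻¹ * condLExp (𝓖 n) μ v ω * ∑' i, c ^ (2 * (i + 1)) * M (i + 1) ω :=
          ENNReal.tsum_mul_left
      _ ≤ (c ^ 2)⁻¹ * condLExp (𝓖 n) μ v ω * ∑' i, c ^ (2 * i) * M i ω := by
          exact mul_le_mul' le_rfl (ENNReal.tsum_comp_le_tsum_of_injective (add_left_injective 1)
            (fun i => c ^ (2 * i) * M i ω))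
      _ = (c ^ 2)⁻¹ * ((∑' i, c ^ (2 * i) * M i ω) * condLExp (𝓖 n) μ v ω) := by ring
      _ ≤ _ := by
          gcongr; exact (le_max_right _ _).trans (le_max_right _ _)

end Weights

/-! ### The class `A_∞` of weights relative to a filtration -/

section AInf

variable {Ω : Type*} {m0 : MeasurableSpace Ω}

/-- Weights satisfying reverse Jensen inequalities conditionally on each `𝓖 n`, for all exponents
`θ ∈ (0,1)`, with constants `B θ`. -/
structure IsAInf (μ : Measure Ω) (𝓖 : Filtration ℕ m0) (B : ℝ → ℝ≥0) (v : Ω → ℝ≥0∞) : Prop where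
  measurable : Measurable v
  pos : ∀ᵐ ω ∂μ, 0 < v ω
  lintegral_ne_top : ∫⁻ ω, v ω ∂μ ≠ ∞
  rpow_condLExp_le : ∀ (n : ℕ) (θ : ℝ), 0 < θ → θ < 1 → ∀ᵐ ω ∂μ,
    condLExp (𝓖 n) μ v ω ^ θ ≤ B θ * condLExp (𝓖 n) μ (fun x => v x ^ θ) ω

variable {μ : Measure Ω} {𝓖 : Filtration ℕ m0}

theorem IsAInf.ae_ne_top {B : ℝ → ℝ≥0} {v : Ω → ℝ≥0∞} (h : IsAInf μ 𝓖 B v) :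
    ∀ᵐ ω ∂μ, v ω ≠ ∞ := by
  filter_upwards [ae_lt_top h.measurable h.lintegral_ne_top] with ω hω using hω.ne

theorem isAInf_one [IsFiniteMeasure μ] : IsAInf μ 𝓖 1 (fun _ => 1) where
  measurable := measurable_const
  pos := by simp
  lintegral_ne_top := by simp
  rpow_condLExp_le n θ _ _ := by
    simp [condLExp_const (𝓖.le n)]

/-- The quotient `H = 𝔼_n(v h) / 𝔼_n(v)` is measurable at time `n` and at most `C h`. Multiplying
the reverse Jensen inequality of `v` by `H^θ` therefore yields that of `v h`. -/
theorem IsAInf.mul_majorant [IsFiniteMeasure μ] {B : ℝ → ℝ≥0} {v h : Ω → ℝ≥0∞}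
    (hv : IsAInf μ 𝓖 B v) (hh : Measurable h) (hh0 : ∀ᵐ ω ∂μ, 0 < h ω)
    (hvh : ∫⁻ ω, v ω * h ω ∂μ ≠ ∞) {C : ℝ≥0}
    (hC : ∀ n, ∀ᵐ ω ∂μ, condLExp (𝓖 n) μ (fun x => v x * h x) ω ≤
      C * (h ω * condLExp (𝓖 n) μ v ω)) :
    IsAInf μ 𝓖 (fun θ => B θ * C ^ θ) (fun ω => v ω * h ω) where
  measurable := hv.measurable.mul hh
  pos := by filter_upwards [hv.pos, hh0] with ω h1 h2 using ENNReal.mul_pos h1.ne' h2.ne'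
  lintegral_ne_top := hvh
  rpow_condLExp_le n θ h0 h1 := by
    set H : Ω → ℝ≥0∞ := fun ω => condLExp (𝓖 n) μ (fun x => v x * h x) ω / condLExp (𝓖 n) μ v ω
    have hHm : Measurable[𝓖 n] H :=
      (measurable_condLExp (𝓖 n) μ _).div (measurable_condLExp (𝓖 n) μ v)
    have hvm := hv.measurable
    have hEpos := condLExp_pos (𝓖.le n) hvm hv.pos
    have hEfin := condLExp_ne_top (mΩ := 𝓖 n) hv.lintegral_ne_top
    have hHh : ∀ᵐ ω ∂μ, H ω ≤ C * h ω := by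
      filter_upwards [hC n, hEpos, hEfin] with ω a1 a2 a3
      rw [ENNReal.div_le_iff a2.ne' a3, mul_assoc]
      exact a1
    have hpull := condLExp_mul_left (μ := μ) (𝓖.le n) (hHm.pow_const θ) (hvm.pow_const θ)
    have hmono := condLExp_mono (P := μ) (mΩ := 𝓖 n)
      (X := fun ω => H ω ^ θ * v ω ^ θ) (Y := fun ω => (C : ℝ≥0∞) ^ θ * (v ω * h ω) ^ θ) (by
        filter_upwards [hHh] with ω hω
        rw [ENNReal.mul_rpow_of_nonneg (v ω) _ h0.le]
        calc H ω ^ θ * v ω ^ θ ≤ (C * h ω) ^ θ * v ω ^ θ := by gcongr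
          _ = _ := by rw [ENNReal.mul_rpow_of_nonneg _ _ h0.le]; ring)
    have hconst := condLExp_const_mul (m := 𝓖 n) (μ := μ) ((hvm.mul hh).pow_const θ)
      ((C : ℝ≥0∞) ^ θ)
    filter_upwards [hEpos, hEfin, hpull, hmono, hconst, hv.rpow_condLExp_le n θ h0 h1]
      with ω a1 a2 a3 a4 a5 a6
    have e1 : condLExp (𝓖 n) μ (fun x => v x * h x) ω = H ω * condLExp (𝓖 n) μ v ω :=
      (ENNReal.div_mul_cancel a1.ne' a2).symm
    rw [a3] at a4
    calc _ = H ω ^ θ * condLExp (𝓖 n) μ v ω ^ θ := by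
          rw [e1, ENNReal.mul_rpow_of_nonneg _ _ h0.le]
      _ ≤ H ω ^ θ * (B θ * condLExp (𝓖 n) μ (fun x => v x ^ θ) ω) := by gcongr
      _ = B θ * (H ω ^ θ * condLExp (𝓖 n) μ (fun x => v x ^ θ) ω) := by ring
      _ ≤ B θ * condLExp (𝓖 n) μ (fun ω => (C : ℝ≥0∞) ^ θ * (v ω * h ω) ^ θ) ω := by gcongr
      _ = B θ * ((C : ℝ≥0∞) ^ θ * condLExp (𝓖 n) μ (fun ω => (v ω * h ω) ^ θ) ω) := by
          congr 1
      _ = _ := by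
          rw [ENNReal.coe_mul, ENNReal.coe_rpow_of_nonneg _ h0.le]; ring

/-- The `A_∞` constants of `v h ^ (-κ)`. -/
noncomputable def negPowConst (B : ℝ → ℝ≥0) (C : ℝ≥0) (κ : ℝ) (θ : ℝ) : ℝ≥0 :=
  C ^ (κ * θ) * (B (θ * (1 / (1 + κ * θ)) + (1 - 1 / (1 + κ * θ))) * 3) ^ (1 + κ * θ)

/-- With `H = 𝔼_n(v h) / 𝔼_n(v) ≤ C h`, the mean of `v h^(-κ)` is at most `C^κ H^(-κ) 𝔼_n(v)`. For
the opposite side, a power of `v` is interpolated between `(v h^(-κ))^θ` and `v h`, and reverse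
Jensen for `v` is combined with conditional Hölder; the powers of `H` then cancel. The floor `ε`
keeps `h^(-κ)` bounded, hence the new weight integrable. -/
theorem IsAInf.mul_rpow_neg_majorant [IsFiniteMeasure μ] {B : ℝ → ℝ≥0} {v h : Ω → ℝ≥0∞}
    (hv : IsAInf μ 𝓖 B v) (hh : Measurable h) {ε : ℝ≥0∞} (hε : ε ≠ 0) (hεh : ∀ ω, ε ≤ h ω)
    (hvh : ∫⁻ ω, v ω * h ω ∂μ ≠ ∞) {C : ℝ≥0} (hC0 : C ≠ 0)
    (hC : ∀ n, ∀ᵐ ω ∂μ, condLExp (𝓖 n) μ (fun x => v x * h x) ω ≤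
      C * (h ω * condLExp (𝓖 n) μ v ω)) {κ : ℝ} (hκ : 0 < κ) :
    IsAInf μ 𝓖 (negPowConst B C κ) (fun ω => v ω * h ω ^ (-κ)) := by
  have hvm := hv.measurable
  have hh0 : ∀ ω, 0 < h ω := fun ω => (pos_iff_ne_zero.2 hε).trans_le (hεh ω)
  have hht : ∀ᵐ ω ∂μ, h ω ≠ ∞ := by
    filter_upwards [ae_lt_top (hvm.mul hh) hvh, hv.pos] with ω h1 h2 h3
    simp [h3, ENNReal.mul_top h2.ne'] at h1
  have hint : ∫⁻ ω, v ω * h ω ^ (-κ) ∂μ ≠ ∞ := by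
    have hle : ∫⁻ ω, v ω * h ω ^ (-κ) ∂μ ≤ ∫⁻ ω, v ω * ε ^ (-κ) ∂μ := by
      refine lintegral_mono fun ω => ?_
      rw [ENNReal.rpow_neg, ENNReal.rpow_neg]
      have := hεh ω
      gcongr
    refine ne_top_of_le_ne_top ?_ hle
    rw [lintegral_mul_const _ hvm]
    refine ENNReal.mul_ne_top hv.lintegral_ne_top ?_
    rw [ENNReal.rpow_neg, ENNReal.inv_ne_top]
    simp [ENNReal.rpow_eq_zero_iff, hε, hκ.le]
  refine ⟨hvm.mul (hh.pow_const _), ?_, hint, fun n θ h0 h1 => ?_⟩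
  · filter_upwards [hv.pos, hht] with ω a1 a2
    refine ENNReal.mul_pos a1.ne' ?_
    rw [ENNReal.rpow_neg, ne_eq, ENNReal.inv_eq_zero]
    exact ENNReal.rpow_ne_top_of_nonneg hκ.le a2
  set H : Ω → ℝ≥0∞ := fun ω => condLExp (𝓖 n) μ (fun x => v x * h x) ω / condLExp (𝓖 n) μ v ω
    with hHdef
  have hHm : Measurable[𝓖 n] H :=
    (measurable_condLExp (𝓖 n) μ _).div (measurable_condLExp (𝓖 n) μ v)
  have hEpos := condLExp_pos (𝓖.le n) hvm hv.pos
  have hEfin := condLExp_ne_top (mΩ := 𝓖 n) hv.lintegral_ne_top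
  have hE'pos := condLExp_pos (𝓖.le n) (hvm.mul hh) (by
    filter_upwards [hv.pos] with ω a1 using ENNReal.mul_pos a1.ne' (hh0 ω).ne')
  have hE'fin := condLExp_ne_top (mΩ := 𝓖 n) hvh
  have hHh : ∀ᵐ ω ∂μ, h ω ^ (-κ) ≤ C ^ κ * H ω ^ (-κ) := by
    filter_upwards [hC n, hEpos, hEfin, hE'pos, hE'fin] with ω a1 a2 a3 a4 a5
    have h1 : H ω ≤ C * h ω := by
      rw [ENNReal.div_le_iff a2.ne' a3, mul_assoc]
      exact a1
    have hH0 : H ω ≠ 0 := (ENNReal.div_pos a4.ne' a3).ne'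
    have hC0' : (C : ℝ≥0∞) ^ κ ≠ 0 := by
      simp [ENNReal.rpow_eq_zero_iff, hC0]
    have hCt : (C : ℝ≥0∞) ^ κ ≠ ∞ := ENNReal.rpow_ne_top_of_nonneg hκ.le (by simp)
    rw [ENNReal.rpow_neg, ENNReal.rpow_neg]
    calc (h ω ^ κ)⁻¹ = C ^ κ * (C ^ κ * h ω ^ κ)⁻¹ := by
          rw [ENNReal.mul_inv (Or.inl hC0') (Or.inl hCt), ← mul_assoc,
            ENNReal.mul_inv_cancel hC0' hCt, one_mul]
      _ = C ^ κ * ((C * h ω) ^ κ)⁻¹ := by rw [ENNReal.mul_rpow_of_nonneg _ _ hκ.le]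
      _ ≤ _ := by gcongr
  -- upper bound for the conditional expectation of the new weight
  have hup : ∀ᵐ ω ∂μ, condLExp (𝓖 n) μ (fun x => v x * h x ^ (-κ)) ω ≤
      C ^ κ * H ω ^ (-κ) * condLExp (𝓖 n) μ v ω := by
    have hmono := condLExp_mono (P := μ) (mΩ := 𝓖 n)
      (X := fun ω => v ω * h ω ^ (-κ)) (Y := fun ω => (C : ℝ≥0∞) ^ κ * H ω ^ (-κ) * v ω) (by
        filter_upwards [hHh] with ω hω
        rw [mul_comm]; gcongr)
    filter_upwards [hmono, condLExp_mul_left (μ := μ) (𝓖.le n)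
      ((hHm.pow_const (-κ)).const_mul ((C : ℝ≥0∞) ^ κ)) hvm] with ω a1 a2
    rw [a2] at a1; exact a1
  -- The value for which `h` disappears from `((v h^(-κ))^θ)^η (v h)^(1-η)`, leaving `v^α`.
  set η : ℝ := 1 / (1 + κ * θ) with hη
  have hκθ : 0 < κ * θ := by positivity
  have hη0 : 0 < η := by positivity
  have hη1 : η < 1 := by rw [hη, div_lt_one (by positivity)]; linarith
  have hηeq : η * (1 + κ * θ) = 1 := by rw [hη]; field_simp
  set α : ℝ := θ * η + (1 - η) with hα
  have hα0 : 0 < α := by have : 0 < θ * η := by positivity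
                         linarith
  have hα1 : α < 1 := by nlinarith
  -- Finiteness follows from `x^θ ≤ 1 + x`.
  have hfinθ : ∀ᵐ ω ∂μ, condLExp (𝓖 n) μ (fun x => (v x * h x ^ (-κ)) ^ θ) ω ≠ ∞ := by
    refine condLExp_ne_top (ne_top_of_le_ne_top ?_ (lintegral_mono (g := fun ω =>
      1 + v ω * h ω ^ (-κ)) fun ω => ?_))
    · rw [lintegral_add_left measurable_const]
      exact ENNReal.add_ne_top.2 ⟨by simp, hint⟩
    · rcases le_total (v ω * h ω ^ (-κ)) 1 with hle | hle
      · exact (ENNReal.rpow_le_one hle h0.le).trans le_self_add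
      · refine le_trans ?_ le_add_self
        calc _ ≤ (v ω * h ω ^ (-κ)) ^ (1 : ℝ) := ENNReal.rpow_le_rpow_of_exponent_le hle h1.le
          _ = _ := ENNReal.rpow_one _
  have hhold := condLExp_rpow_mul_rpow_le (m := 𝓖 n) (μ := μ)
    (f := fun x => (v x * h x ^ (-κ)) ^ θ) (g := fun x => v x * h x)
    ((hvm.mul (hh.pow_const _)).pow_const _) (hvm.mul hh) hη0 hη1 hfinθ hE'fin
  have hcongr : (fun x => v x ^ α) =ᵐ[μ]
      fun x => ((v x * h x ^ (-κ)) ^ θ) ^ η * (v x * h x) ^ (1 - η) := by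
    filter_upwards [hv.pos, hv.ae_ne_top, hht] with ω a1 a2 a3
    have a4 := (hh0 ω).ne'
    rw [ENNReal.mul_rpow_of_nonneg _ _ h0.le, ENNReal.mul_rpow_of_nonneg _ _ hη0.le,
      ENNReal.mul_rpow_of_nonneg (v ω) (h ω) (by linarith), ← ENNReal.rpow_mul, ← ENNReal.rpow_mul,
      ← ENNReal.rpow_mul]
    calc v ω ^ α = v ω ^ α * h ω ^ (0 : ℝ) := by simp
      _ = v ω ^ (θ * η + (1 - η)) * h ω ^ (-κ * θ * η + (1 - η)) := by
          congr 2; linear_combination hηeq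
      _ = _ := by
          rw [ENNReal.rpow_add _ _ a1.ne' a2, ENNReal.rpow_add _ _ a4 a3]; ring_nf
  filter_upwards [hup, hhold, condLExp_congr_ae (mΩ := 𝓖 n) hcongr, hEpos, hEfin, hE'pos, hE'fin,
    hv.rpow_condLExp_le n α hα0 hα1] with ω a1 a2 a3 a4 a5 a6 a7 a8
  set E := condLExp (𝓖 n) μ v ω
  set X := condLExp (𝓖 n) μ (fun x => (v x * h x ^ (-κ)) ^ θ) ω
  have e1 : condLExp (𝓖 n) μ (fun x => v x * h x) ω = H ω * E :=
      (ENNReal.div_mul_cancel a4.ne' a5).symm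
  have hH0 : H ω ≠ 0 := (ENNReal.div_pos a6.ne' a5).ne'
  have hHt : H ω ≠ ∞ := ENNReal.div_ne_top a7 a4.ne'
  have k1 : E ^ (θ * η) * E ^ (1 - η) ≤ B α * 3 * X ^ η * H ω ^ (1 - η) * E ^ (1 - η) := by
    rw [← ENNReal.rpow_add _ _ a4.ne' a5]
    calc E ^ α ≤ B α * (3 * (X ^ η * (H ω * E) ^ (1 - η))) := by
          refine a8.trans ?_
          rw [a3, ← e1]; gcongr
      _ = _ := by
          rw [ENNReal.mul_rpow_of_nonneg _ _ (by linarith : 0 ≤ 1 - η)]; ring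
  have k2 : E ^ (θ * η) ≤ B α * 3 * X ^ η * H ω ^ (1 - η) := by
    have z0 : E ^ (1 - η) ≠ 0 := (ENNReal.rpow_pos a4 a5).ne'
    have zt : E ^ (1 - η) ≠ ∞ := ENNReal.rpow_ne_top_of_nonneg (by linarith) a5
    exact (ENNReal.mul_le_mul_iff_left z0 zt).1 k1
  have hη' : 0 < 1 + κ * θ := by positivity
  have k3 : E ^ θ ≤ (B α * 3) ^ (1 + κ * θ) * X * H ω ^ (κ * θ) := by
    calc E ^ θ = (E ^ (θ * η)) ^ (1 + κ * θ) := by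
          rw [← ENNReal.rpow_mul, mul_assoc, hηeq, mul_one]
      _ ≤ (B α * 3 * X ^ η * H ω ^ (1 - η)) ^ (1 + κ * θ) := by gcongr
      _ = _ := by
          rw [ENNReal.mul_rpow_of_nonneg _ _ hη'.le, ENNReal.mul_rpow_of_nonneg _ (X ^ η) hη'.le,
            ← ENNReal.rpow_mul, ← ENNReal.rpow_mul, hηeq, ENNReal.rpow_one]
          congr 2; linear_combination -hηeq
  calc _ ≤ (C ^ κ * H ω ^ (-κ) * E) ^ θ := by gcongr
    _ = C ^ (κ * θ) * H ω ^ (-κ * θ) * E ^ θ := by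
        rw [ENNReal.mul_rpow_of_nonneg _ _ h0.le, ENNReal.mul_rpow_of_nonneg _ _ h0.le,
          ← ENNReal.rpow_mul, ← ENNReal.rpow_mul]
    _ ≤ C ^ (κ * θ) * H ω ^ (-κ * θ) * ((B α * 3) ^ (1 + κ * θ) * X * H ω ^ (κ * θ)) := by gcongr
    _ = C ^ (κ * θ) * (B α * 3) ^ (1 + κ * θ) * X * (H ω ^ (-κ * θ) * H ω ^ (κ * θ)) := by ring
    _ = C ^ (κ * θ) * (B α * 3) ^ (1 + κ * θ) * X := by
        rw [← ENNReal.rpow_add _ _ hH0 hHt]; simp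
    _ = _ := by
        congr 1
        rw [negPowConst, ENNReal.coe_mul, ENNReal.coe_rpow_of_nonneg _ hκθ.le,
          ENNReal.coe_rpow_of_nonneg _ hη'.le]
        rfl

end AInf

/-! ### Extrapolation -/

section Extrapolation

variable {Ω : Type*} {m0 : MeasurableSpace Ω}

/-- `F` is dominated by `G` in the weighted `L_p`-spaces with weights `v ^ (1 - p / ρ)`, `v ∈ A_∞`. -/
def WeightedDom (μ : Measure Ω) (𝓖 : Filtration ℕ m0) (ρ p : ℝ) (Φ : (ℝ → ℝ≥0) → ℝ≥0)
    (F G : Ω → ℝ≥0∞) : Prop :=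
  ∀ (B : ℝ → ℝ≥0) (v : Ω → ℝ≥0∞), IsAInf μ 𝓖 B v →
    ∫⁻ ω, F ω ^ p * v ω ^ (1 - p / ρ) ∂μ ≤ Φ B * ∫⁻ ω, G ω ^ p * v ω ^ (1 - p / ρ) ∂μ

/-- The weighted integral is an `L_p` integral against `v dμ` of `x v^(-1/ρ)`, a function
independent of `p`. This is the reason for the exponent `1 - p/ρ`: extrapolation takes place over
the fixed measure `v dμ`, and passing to the weight `v h` only inserts `h^(1-p/ρ)`. -/
theorem rpow_mul_rpow_one_sub_div {x v : ℝ≥0∞} (hv0 : v ≠ 0) (hvt : v ≠ ∞) {p ρ : ℝ} (hp : 0 < p) :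
    x ^ p * v ^ (1 - p / ρ) = v * (x * v ^ (-(1 / ρ))) ^ p := by
  rw [ENNReal.mul_rpow_of_nonneg _ _ hp.le, ← ENNReal.rpow_mul, sub_eq_add_neg,
    ENNReal.rpow_add _ _ hv0 hvt, ENNReal.rpow_one,
    show -(1 / ρ) * p = -(p / ρ) by ring]
  ring

theorem rpow_mul_mul_rpow_one_sub_div {x v : ℝ≥0∞} (hv0 : v ≠ 0) (hvt : v ≠ ∞) {p ρ : ℝ}
    (hp : 0 < p) (hpρ : p / ρ < 1) (h : ℝ≥0∞) :
    x ^ p * (v * h) ^ (1 - p / ρ) = v * ((x * v ^ (-(1 / ρ))) ^ p * h ^ (1 - p / ρ)) := by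
  rw [ENNReal.mul_rpow_of_nonneg _ _ (by linarith), ← mul_assoc, ← mul_assoc,
    ← rpow_mul_rpow_one_sub_div hv0 hvt hp]

theorem rpow_self_mul {x : ℝ≥0∞} {a b : ℝ} (ha : 0 ≤ a) (hb : 0 ≤ b) :
    x ^ a * x ^ b = x ^ (a + b) := (ENNReal.rpow_add_of_nonneg _ _ ha hb).symm

variable {μ : Measure Ω} {𝓖 : Filtration ℕ m0}

theorem WeightedDom.lintegral_mul_le [IsFiniteMeasure μ] {ρ p : ℝ} (hp : 0 < p) (hpρ : p < ρ)
    {Φ : (ℝ → ℝ≥0) → ℝ≥0} {F G : Ω → ℝ≥0∞} (hFG : WeightedDom μ 𝓖 ρ p Φ F G) {B B' : ℝ → ℝ≥0}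
    {v h : Ω → ℝ≥0∞} (hv : IsAInf μ 𝓖 B v) (hvh : IsAInf μ 𝓖 B' (fun ω => v ω * h ω)) :
    ∫⁻ ω, v ω * ((F ω * v ω ^ (-(1 / ρ))) ^ p * h ω ^ (1 - p / ρ)) ∂μ ≤
      Φ B' * ∫⁻ ω, v ω * ((G ω * v ω ^ (-(1 / ρ))) ^ p * h ω ^ (1 - p / ρ)) ∂μ := by
  have hlt : p / ρ < 1 := by rw [div_lt_one (hp.trans hpρ)]; exact hpρ
  have key : ∀ F : Ω → ℝ≥0∞, ∫⁻ ω, v ω * ((F ω * v ω ^ (-(1 / ρ))) ^ p * h ω ^ (1 - p / ρ)) ∂μ =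
      ∫⁻ ω, F ω ^ p * (v ω * h ω) ^ (1 - p / ρ) ∂μ := by
    intro F
    refine lintegral_congr_ae ?_
    filter_upwards [hv.pos, hv.ae_ne_top] with ω a1 a2
    exact (rpow_mul_mul_rpow_one_sub_div a1.ne' a2 hp hlt _).symm
  rw [key F, key G]
  exact hFG B' _ hvh

theorem lintegral_mul_ne_top_of_rpow {v h : Ω → ℝ≥0∞}
    (hvm : Measurable v) (hvt : ∫⁻ ω, v ω ∂μ ≠ ∞) {q : ℝ} (hq : 1 ≤ q) (hh : ∫⁻ ω, v ω * h ω ^ q ∂μ ≠ ∞) :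
    ∫⁻ ω, v ω * h ω ∂μ ≠ ∞ := by
  refine ne_top_of_le_ne_top (ENNReal.add_ne_top.2 ⟨hvt, hh⟩) ?_
  rw [← lintegral_add_left hvm]
  refine lintegral_mono fun ω => ?_
  rcases le_total (h ω) 1 with hle | hle
  · refine le_trans ?_ le_self_add
    exact mul_le_of_le_one_right (by simp) hle
  · refine le_trans ?_ le_add_self
    refine mul_le_mul' le_rfl ?_
    calc h ω = h ω ^ (1 : ℝ) := (ENNReal.rpow_one _).symm
      _ ≤ _ := ENNReal.rpow_le_rpow_of_exponent_le hle hq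

/-- Extrapolation to larger exponents. -/
theorem WeightedDom.extrapolate_up [IsFiniteMeasure μ] {ρ p₀ p : ℝ} (hp₀ : 0 < p₀) (hp : p₀ < p)
    (hpρ : p < ρ) (Φ : (ℝ → ℝ≥0) → ℝ≥0) : ∃ Φ' : (ℝ → ℝ≥0) → ℝ≥0, ∀ F G : Ω → ℝ≥0∞,
      Measurable F → Measurable G → WeightedDom μ 𝓖 ρ p₀ Φ F G → WeightedDom μ 𝓖 ρ p Φ' F G := by
  have hp0 : 0 < p := hp₀.trans hp
  have hρ : 0 < ρ := hp0.trans hpρ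
  set s₀ : ℝ := 1 - p₀ / ρ with hs₀
  have hs₀0 : 0 < s₀ := by
    rw [hs₀, sub_pos, div_lt_one hρ]; linarith
  -- The majorant will dominate `f^e`, with `e` such that `f^p = f^p₀ (f^e)^s₀`. Since `q = p / e`,
  -- the requirement `q > 1` is exactly `p < ρ`.
  set e : ℝ := (p - p₀) / s₀ with he
  have he0 : 0 < e := div_pos (by linarith) hs₀0
  have hes : e * s₀ = p - p₀ := by rw [he]; field_simp
  set q : ℝ := p / e with hq
  have hqe : e * q = p := by rw [hq]; field_simp
  have hq1 : 1 < q := by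
    rw [hq, lt_div_iff₀ he0, one_mul, he, div_lt_iff₀ hs₀0, hs₀]
    have : p * (p₀ / ρ) < p₀ := by
      rw [← mul_div_assoc, div_lt_iff₀ hρ]; nlinarith
    linarith
  set τ : ℝ := p₀ / p with hτ
  have hτ0 : 0 < τ := by positivity
  have hτ1 : τ < 1 := by rw [hτ, div_lt_one hp0]; exact hp
  obtain ⟨C, hC0, hC⟩ := exists_majorant hq1
  refine ⟨fun B => (Φ (fun θ => B θ * C ^ θ) * (C * 2) ^ (1 - τ)) ^ τ⁻¹, ?_⟩
  intro F G hF hG hFG B v hv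
  have hvm := hv.measurable
  set f : Ω → ℝ≥0∞ := fun ω => F ω * v ω ^ (-(1 / ρ)) with hf
  set g : Ω → ℝ≥0∞ := fun ω => G ω * v ω ^ (-(1 / ρ)) with hg
  have hfm : Measurable f := hF.mul (hvm.pow_const _)
  have hgm : Measurable g := hG.mul (hvm.pow_const _)
  have hcv : ∀ F : Ω → ℝ≥0∞, ∫⁻ ω, F ω ^ p * v ω ^ (1 - p / ρ) ∂μ =
      ∫⁻ ω, v ω * (F ω * v ω ^ (-(1 / ρ))) ^ p ∂μ := by
    intro F
    refine lintegral_congr_ae ?_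
    filter_upwards [hv.pos, hv.ae_ne_top] with ω a1 a2
    exact rpow_mul_rpow_one_sub_div a1.ne' a2 hp0
  rw [hcv F, hcv G]
  set K : ℝ≥0 := (Φ (fun θ => B θ * C ^ θ) * (C * 2) ^ (1 - τ)) ^ τ⁻¹ with hK
  -- Truncation makes `X` finite, so that a power of `X` can be cancelled at the end.
  have htrunc : ∀ N : ℕ, ∫⁻ ω, v ω * (min (f ω) N) ^ p ∂μ ≤ K * ∫⁻ ω, v ω * g ω ^ p ∂μ := by
    intro N
    set X : ℝ≥0∞ := ∫⁻ ω, v ω * (min (f ω) N) ^ p ∂μ with hX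
    set V : ℝ≥0∞ := ∫⁻ ω, v ω ∂μ with hV
    rcases eq_or_ne X 0 with hX0 | hX0
    · rw [hX0]; exact zero_le
    have hmN : Measurable fun ω => min (f ω) (N : ℝ≥0∞) := hfm.min measurable_const
    have hXt : X ≠ ∞ := by
      refine ne_top_of_le_ne_top (b := V * (N : ℝ≥0∞) ^ p) ?_ ?_
      · exact ENNReal.mul_ne_top hv.lintegral_ne_top
          (ENNReal.rpow_ne_top_of_nonneg hp0.le (by simp))
      · rw [hV, ← lintegral_mul_const _ hvm]
        refine lintegral_mono fun ω => ?_
        gcongr; exact min_le_right _ _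
    have hV0 : V ≠ 0 := by
      intro h0
      apply hX0
      rw [hV, lintegral_eq_zero_iff hvm] at h0
      rw [hX, ← lintegral_zero (μ := μ)]
      refine lintegral_congr_ae ?_
      filter_upwards [h0] with ω hω
      simp [hω]
    -- The floor makes the majorant positive, and since `V ε^q = X` it at most doubles the integral.
    set ε : ℝ≥0∞ := (X / V) ^ (1 / q) with hε
    have hq0 : 0 < q := by linarith
    have hεq : ε ^ q = X / V := by
      rw [hε, ← ENNReal.rpow_mul, one_div_mul_cancel hq0.ne', ENNReal.rpow_one]
    have hε0 : ε ≠ 0 := by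
      intro h; rw [h, ENNReal.zero_rpow_of_pos hq0] at hεq
      exact (ENNReal.div_pos hX0 hv.lintegral_ne_top).ne hεq
    obtain ⟨h, hhm, hkh, hhq, hhC⟩ := hC μ 𝓖 v (fun ω => max ((min (f ω) N) ^ e) ε) hvm
      ((hmN.pow_const e).max measurable_const) hv.pos hv.lintegral_ne_top
    have hhq' : ∫⁻ ω, v ω * h ω ^ q ∂μ ≤ C * 2 * X := by
      refine hhq.trans ?_
      rw [mul_assoc]
      gcongr
      calc ∫⁻ ω, v ω * (max ((min (f ω) N) ^ e) ε) ^ q ∂μ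
          ≤ ∫⁻ ω, (v ω * (min (f ω) N) ^ p + v ω * ε ^ q) ∂μ := by
            refine lintegral_mono fun ω => ?_
            rw [← mul_add]
            refine mul_le_mul' le_rfl ?_
            rcases le_total ((min (f ω) N) ^ e) ε with hle | hle
            · rw [max_eq_right hle]; exact le_add_self
            · rw [max_eq_left hle, ← ENNReal.rpow_mul, hqe]; exact le_self_add
        _ = X + V * ε ^ q := by
            have hm : Measurable fun ω => v ω * (min (f ω) (N : ℝ≥0∞)) ^ p :=
              hvm.mul (hmN.pow_const p)
            rw [lintegral_add_left hm, lintegral_mul_const _ hvm]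
        _ = 2 * X := by
            rw [hεq, ENNReal.mul_div_cancel hV0 hv.lintegral_ne_top, two_mul]
    have hhqt : ∫⁻ ω, v ω * h ω ^ q ∂μ ≠ ∞ := ne_top_of_le_ne_top
      (ENNReal.mul_ne_top (by simp [ENNReal.mul_eq_top]) hXt) hhq'
    have hh0 : ∀ ω, 0 < h ω := fun ω =>
      (pos_iff_ne_zero.2 hε0).trans_le ((le_max_right _ _).trans (hkh ω))
    have hvh := lintegral_mul_ne_top_of_rpow hvm hv.lintegral_ne_top hq1.le hhqt
    have hw := hv.mul_majorant hhm (Eventually.of_forall hh0) hvh hhC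
    have hdom := hFG.lintegral_mul_le hp₀ (hp.trans hpρ) hv hw
    have h1 : X ≤ ∫⁻ ω, v ω * (f ω ^ p₀ * h ω ^ s₀) ∂μ := by
      refine lintegral_mono fun ω => mul_le_mul' le_rfl ?_
      calc (min (f ω) N) ^ p = (min (f ω) N) ^ p₀ * ((min (f ω) N) ^ e) ^ s₀ := by
            rw [← ENNReal.rpow_mul, hes, rpow_self_mul hp₀.le (by linarith)]; congr 1; ring
        _ ≤ _ := by
            gcongr
            · exact min_le_left _ _
            · exact (le_max_left _ _).trans (hkh ω)
    have h2 : ∫⁻ ω, v ω * (g ω ^ p₀ * h ω ^ s₀) ∂μ ≤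
        (∫⁻ ω, v ω * g ω ^ p ∂μ) ^ τ * (∫⁻ ω, v ω * h ω ^ q ∂μ) ^ (1 - τ) := by
      refine le_trans (le_of_eq ?_) (ENNReal.lintegral_mul_norm_pow_le
        (hvm.mul (hgm.pow_const p)).aemeasurable (hvm.mul (hhm.pow_const q)).aemeasurable hτ0.le
        (by linarith : 0 ≤ 1 - τ) (by ring))
      refine lintegral_congr fun ω => ?_
      have e1 : p * τ = p₀ := by rw [hτ]; field_simp
      have e2 : q * (1 - τ) = s₀ := by
        have : e * (q * (1 - τ)) = e * s₀ := by
          rw [← mul_assoc, hqe, hes, mul_sub, e1, mul_one]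
        exact mul_left_cancel₀ he0.ne' this
      rw [Pi.mul_apply, Pi.mul_apply, ENNReal.mul_rpow_of_nonneg _ _ hτ0.le,
        ENNReal.mul_rpow_of_nonneg _ _ (by linarith : 0 ≤ 1 - τ), ← ENNReal.rpow_mul,
        ← ENNReal.rpow_mul, e1, e2, mul_mul_mul_comm, rpow_self_mul hτ0.le (by linarith)]
      simp
    set Y := ∫⁻ ω, v ω * g ω ^ p ∂μ with hY
    set Φ₀ : ℝ≥0 := Φ (fun θ => B θ * C ^ θ)
    -- Hölder puts `X^(1-τ)` on the right through the norm of `h`; it is absorbed by the left-hand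
    -- side.
    have h3 : X ^ τ * X ^ (1 - τ) ≤ Φ₀ * (C * 2) ^ (1 - τ) * Y ^ τ * X ^ (1 - τ) := by
      rw [rpow_self_mul hτ0.le (by linarith), add_sub_cancel, ENNReal.rpow_one]
      calc X ≤ _ := h1
        _ ≤ _ := hdom
        _ ≤ Φ₀ * (Y ^ τ * (∫⁻ ω, v ω * h ω ^ q ∂μ) ^ (1 - τ)) := by gcongr
        _ ≤ Φ₀ * (Y ^ τ * (C * 2 * X) ^ (1 - τ)) := by gcongr
        _ = _ := by rw [ENNReal.mul_rpow_of_nonneg _ X (by linarith : 0 ≤ 1 - τ)]; ring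
    have h4 : X ^ τ ≤ Φ₀ * (C * 2) ^ (1 - τ) * Y ^ τ :=
      (ENNReal.mul_le_mul_iff_left (ENNReal.rpow_pos (pos_iff_ne_zero.2 hX0) hXt).ne'
        (ENNReal.rpow_ne_top_of_nonneg (by linarith) hXt)).1 h3
    calc X = (X ^ τ) ^ τ⁻¹ := by rw [← ENNReal.rpow_mul, mul_inv_cancel₀ hτ0.ne', ENNReal.rpow_one]
      _ ≤ (Φ₀ * (C * 2) ^ (1 - τ) * Y ^ τ) ^ τ⁻¹ := by gcongr
      _ = (Φ₀ * (C * 2) ^ (1 - τ)) ^ τ⁻¹ * Y := by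
          rw [ENNReal.mul_rpow_of_nonneg _ _ (by positivity), ← ENNReal.rpow_mul Y,
            mul_inv_cancel₀ hτ0.ne', ENNReal.rpow_one]
      _ = K * Y := by
          rw [hK, ENNReal.coe_rpow_of_nonneg _ (by positivity), ENNReal.coe_mul,
            ENNReal.coe_rpow_of_nonneg _ (by linarith)]
          rfl
  have hsup : ∫⁻ ω, v ω * f ω ^ p ∂μ = ⨆ N : ℕ, ∫⁻ ω, v ω * (min (f ω) N) ^ p ∂μ := by
    rw [← lintegral_iSup]
    · refine lintegral_congr fun ω => ?_
      rw [← ENNReal.mul_iSup]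
      congr 1
      refine le_antisymm ?_ (iSup_le fun N => by gcongr; exact min_le_left _ _)
      have hlim : Tendsto (fun N : ℕ => (min (f ω) N) ^ p) atTop (𝓝 ((min (f ω) ∞) ^ p)) :=
        (ENNReal.continuous_rpow_const.tendsto _).comp
          (tendsto_const_nhds.min ENNReal.tendsto_nat_nhds_top)
      rw [min_eq_left le_top] at hlim
      exact le_of_tendsto' hlim fun N => le_iSup (fun N : ℕ => (min (f ω) (N : ℝ≥0∞)) ^ p) N
    · exact fun N => hvm.mul ((hfm.min measurable_const).pow_const p)
    · intro N N' hN ω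
      dsimp only
      gcongr
  rw [hsup]
  exact iSup_le htrunc

/-- Extrapolation to smaller exponents. -/
theorem WeightedDom.extrapolate_down [IsFiniteMeasure μ] {ρ p₀ p : ℝ} (hp0 : 0 < p) (hp : p < p₀)
    (hpρ : p₀ < ρ) (Φ : (ℝ → ℝ≥0) → ℝ≥0) : ∃ Φ' : (ℝ → ℝ≥0) → ℝ≥0, ∀ F G : Ω → ℝ≥0∞,
      Measurable F → Measurable G → WeightedDom μ 𝓖 ρ p₀ Φ F G → WeightedDom μ 𝓖 ρ p Φ' F G := by
  have hp₀ : 0 < p₀ := hp0.trans hp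
  have hρ : 0 < ρ := hp₀.trans hpρ
  set s₀ : ℝ := 1 - p₀ / ρ with hs₀
  have hs₀0 : 0 < s₀ := by
    rw [hs₀, sub_pos, div_lt_one hρ]; linarith
  -- The majorant of `g^e` is taken with exponent `2`, as `(g^e)^2 = g^p`. The exponent `κ` makes
  -- `g^p₀ (g^e)^(-κ s₀) = g^p`; with these choices `h` also drops out of the Hölder inequality in
  -- `h2`, because `κ s₀ τ = 2 (1 - τ)`.
  set e : ℝ := p / 2 with he
  have he0 : 0 < e := by positivity
  set κ : ℝ := (p₀ - p) / (s₀ * e) with hκ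
  have hκ0 : 0 < κ := div_pos (by linarith) (by positivity)
  have hκs : e * (κ * s₀) = p₀ - p := by rw [hκ]; field_simp
  set τ : ℝ := p / p₀ with hτ
  have hτ0 : 0 < τ := by positivity
  have hτ1 : τ < 1 := by rw [hτ, div_lt_one hp₀]; exact hp
  obtain ⟨C, hC0, hC⟩ := exists_majorant (q := 2) (by norm_num)
  -- Adding `C` gives one constant for both Hölder factors, and a nonzero one, as needed when the
  -- right-hand integral is infinite.
  refine ⟨fun B => Φ (negPowConst B C κ) + C, ?_⟩
  intro F G hF hG hFG B v hv
  have hvm := hv.measurable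
  set f : Ω → ℝ≥0∞ := fun ω => F ω * v ω ^ (-(1 / ρ)) with hf
  set g : Ω → ℝ≥0∞ := fun ω => G ω * v ω ^ (-(1 / ρ)) with hg
  have hfm : Measurable f := hF.mul (hvm.pow_const _)
  have hgm : Measurable g := hG.mul (hvm.pow_const _)
  have hcv : ∀ F : Ω → ℝ≥0∞, ∫⁻ ω, F ω ^ p * v ω ^ (1 - p / ρ) ∂μ =
      ∫⁻ ω, v ω * (F ω * v ω ^ (-(1 / ρ))) ^ p ∂μ := by
    intro F
    refine lintegral_congr_ae ?_
    filter_upwards [hv.pos, hv.ae_ne_top] with ω a1 a2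
    exact rpow_mul_rpow_one_sub_div a1.ne' a2 hp0
  rw [hcv F, hcv G]
  set K : ℝ≥0 := Φ (negPowConst B C κ) + C with hK
  have hK0 : (K : ℝ≥0∞) ≠ 0 := by
    rw [ne_eq, ENNReal.coe_eq_zero, hK]
    exact (lt_of_lt_of_le (pos_iff_ne_zero.2 hC0) le_add_self).ne'
  set Y := ∫⁻ ω, v ω * g ω ^ p ∂μ with hY
  rcases eq_or_ne Y ∞ with hYt | hYt
  · rw [hYt, ENNReal.mul_top hK0]; exact le_top
  set V : ℝ≥0∞ := ∫⁻ ω, v ω ∂μ with hV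
  -- The majorant needs a positive floor `ε` for its negative powers; `δ` is the price of that floor
  -- and tends to `0` afterwards.
  have hstep : ∀ δ : ℝ≥0∞, δ ≠ 0 → δ ≠ ∞ → ∫⁻ ω, v ω * f ω ^ p ∂μ ≤ K * (Y + δ) := by
    intro δ hδ0 hδt
    have hV1 : V + 1 ≠ ∞ := ENNReal.add_ne_top.2 ⟨hv.lintegral_ne_top, by simp⟩
    set ε : ℝ≥0∞ := (δ / (V + 1)) ^ (1 / 2 : ℝ) with hε
    have hε2 : ε ^ (2 : ℝ) = δ / (V + 1) := by
      rw [hε, ← ENNReal.rpow_mul]; norm_num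
    have hε0 : ε ≠ 0 := by
      intro h; rw [h, ENNReal.zero_rpow_of_pos (by norm_num)] at hε2
      exact (ENNReal.div_pos hδ0 hV1).ne hε2
    have hεV : V * ε ^ (2 : ℝ) ≤ δ := by
      rw [hε2]
      calc V * (δ / (V + 1)) ≤ (V + 1) * (δ / (V + 1)) := by gcongr; exact le_self_add
        _ = δ := ENNReal.mul_div_cancel (by simp) hV1
    obtain ⟨h, hhm, hkh, hhq, hhC⟩ := hC μ 𝓖 v (fun ω => max (g ω ^ e) ε) hvm
      ((hgm.pow_const e).max measurable_const) hv.pos hv.lintegral_ne_top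
    have hhq' : ∫⁻ ω, v ω * h ω ^ (2 : ℝ) ∂μ ≤ C * (Y + δ) := by
      refine hhq.trans ?_
      gcongr
      calc ∫⁻ ω, v ω * (max (g ω ^ e) ε) ^ (2 : ℝ) ∂μ
          ≤ ∫⁻ ω, (v ω * g ω ^ p + v ω * ε ^ (2 : ℝ)) ∂μ := by
            refine lintegral_mono fun ω => ?_
            rw [← mul_add]
            refine mul_le_mul' le_rfl ?_
            rcases le_total (g ω ^ e) ε with hle | hle
            · rw [max_eq_right hle]; exact le_add_self
            · rw [max_eq_left hle, ← ENNReal.rpow_mul, he, div_mul_cancel₀ _ (by norm_num)]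
              exact le_self_add
        _ = Y + V * ε ^ (2 : ℝ) := by
            have hm : Measurable fun ω => v ω * g ω ^ p := hvm.mul (hgm.pow_const p)
            rw [lintegral_add_left hm, lintegral_mul_const _ hvm]
        _ ≤ _ := by gcongr
    have hhqt : ∫⁻ ω, v ω * h ω ^ (2 : ℝ) ∂μ ≠ ∞ := ne_top_of_le_ne_top
      (ENNReal.mul_ne_top (by simp) (ENNReal.add_ne_top.2 ⟨hYt, hδt⟩)) hhq'
    have hεh : ∀ ω, ε ≤ h ω := fun ω => (le_max_right _ _).trans (hkh ω)
    have hvh := lintegral_mul_ne_top_of_rpow hvm hv.lintegral_ne_top (by norm_num) hhqt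
    have hht : ∀ᵐ ω ∂μ, h ω ≠ ∞ := by
      filter_upwards [ae_lt_top (hvm.mul hhm) hvh, hv.pos] with ω h1 h2 h3
      simp [h3, ENNReal.mul_top h2.ne'] at h1
    have hw := hv.mul_rpow_neg_majorant hhm hε0 hεh hvh hC0 hhC hκ0
    have hdom := hFG.lintegral_mul_le hp₀ hpρ hv hw
    simp_rw [← ENNReal.rpow_mul] at hdom
    have h1 : ∫⁻ ω, v ω * (g ω ^ p₀ * h ω ^ (-κ * s₀)) ∂μ ≤ Y := by
      refine lintegral_mono fun ω => mul_le_mul' le_rfl ?_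
      rcases eq_or_ne (g ω) 0 with h0 | h0
      · simp [h0, hp₀]
      rcases eq_or_ne (g ω) ∞ with ht | ht
      · simp [ht, hp0]
      calc g ω ^ p₀ * h ω ^ (-κ * s₀) ≤ g ω ^ p₀ * (g ω ^ e) ^ (-κ * s₀) := by
            gcongr g ω ^ p₀ * ?_
            rw [neg_mul, ENNReal.rpow_neg, ENNReal.rpow_neg]
            gcongr
            exact (le_max_left _ _).trans (hkh ω)
        _ = g ω ^ p := by
            rw [← ENNReal.rpow_mul, ← ENNReal.rpow_add _ _ h0 ht]
            congr 1; linear_combination -hκs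
    have h2 : ∫⁻ ω, v ω * f ω ^ p ∂μ ≤
        (∫⁻ ω, v ω * (f ω ^ p₀ * h ω ^ (-κ * s₀)) ∂μ) ^ τ *
          (∫⁻ ω, v ω * h ω ^ (2 : ℝ) ∂μ) ^ (1 - τ) := by
      refine le_trans (le_of_eq ?_) (ENNReal.lintegral_mul_norm_pow_le
        (hvm.mul ((hfm.pow_const p₀).mul (hhm.pow_const _))).aemeasurable
        (hvm.mul (hhm.pow_const _)).aemeasurable hτ0.le
        (by linarith : 0 ≤ 1 - τ) (by ring))
      refine lintegral_congr_ae ?_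
      filter_upwards [hht] with ω hω
      have e1 : p₀ * τ = p := by rw [hτ]; field_simp
      have e2 : -κ * s₀ * τ + 2 * (1 - τ) = 0 := by
        have : e * (-κ * s₀ * τ + 2 * (1 - τ)) = 0 := by
          rw [he] at hκs ⊢
          linear_combination -τ * hκs - e1
        exact (mul_eq_zero.1 this).resolve_left he0.ne'
      have e3 : h ω ^ (-κ * s₀ * τ) * h ω ^ (2 * (1 - τ)) = 1 := by
        rw [← ENNReal.rpow_add _ _ ((pos_iff_ne_zero.2 hε0).trans_le (hεh ω)).ne' hω, e2,
          ENNReal.rpow_zero]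
      have e4 : v ω ^ τ * v ω ^ (1 - τ) = v ω := by
        rw [rpow_self_mul hτ0.le (by linarith)]; simp
      simp only [Pi.mul_apply]
      rw [ENNReal.mul_rpow_of_nonneg _ _ hτ0.le, ENNReal.mul_rpow_of_nonneg _ _ hτ0.le,
        ENNReal.mul_rpow_of_nonneg _ _ (by linarith : 0 ≤ 1 - τ), ← ENNReal.rpow_mul,
        ← ENNReal.rpow_mul, ← ENNReal.rpow_mul, e1]
      calc v ω * f ω ^ p = (v ω ^ τ * v ω ^ (1 - τ)) * f ω ^ p *
            (h ω ^ (-κ * s₀ * τ) * h ω ^ (2 * (1 - τ))) := by rw [e3, e4, mul_one]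
        _ = _ := by ring
    have hK1 : (Φ (negPowConst B C κ) : ℝ≥0∞) ≤ K := by
      rw [ENNReal.coe_le_coe, hK]; exact le_self_add
    have hK2 : (C : ℝ≥0∞) ≤ K := by
      rw [ENNReal.coe_le_coe, hK]; exact le_add_self
    calc _ ≤ _ := h2
      _ ≤ (K * (Y + δ)) ^ τ * (K * (Y + δ)) ^ (1 - τ) := by
          have h3 := hdom.trans (mul_le_mul' hK1 (h1.trans le_self_add : _ ≤ Y + δ))
          have h4 := hhq'.trans (mul_le_mul' hK2 (le_refl (Y + δ)))
          have h5 : 0 ≤ 1 - τ := by linarith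
          gcongr
      _ = _ := by rw [rpow_self_mul hτ0.le (by linarith)]; simp
  have hlim : Tendsto (fun δ : ℝ≥0∞ => K * (Y + δ)) (𝓝[>] 0) (𝓝 (K * (Y + 0))) :=
    ENNReal.Tendsto.const_mul ((tendsto_const_nhds.add tendsto_id).mono_left nhdsWithin_le_nhds)
      (Or.inr (by simp))
  rw [add_zero] at hlim
  refine ge_of_tendsto hlim ?_
  have : ∀ᶠ ε : ℝ≥0∞ in 𝓝[>] 0, ε < 1 := nhdsWithin_le_nhds (Iio_mem_nhds (by norm_num))
  filter_upwards [self_mem_nhdsWithin, this] with δ hδ hδ1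
  exact hstep δ (Set.mem_Ioi.1 hδ).ne' (hδ1.trans (by simp)).ne

/-- Extrapolation: weighted domination for one exponent in `(0, ρ)` implies it for all of them. -/
theorem WeightedDom.extrapolate [IsFiniteMeasure μ] {ρ p₀ p : ℝ} (hp₀ : 0 < p₀) (hp₀ρ : p₀ < ρ)
    (hp0 : 0 < p) (hpρ : p < ρ) (Φ : (ℝ → ℝ≥0) → ℝ≥0) :
    ∃ Φ' : (ℝ → ℝ≥0) → ℝ≥0, ∀ F G : Ω → ℝ≥0∞,
      Measurable F → Measurable G → WeightedDom μ 𝓖 ρ p₀ Φ F G → WeightedDom μ 𝓖 ρ p Φ' F G := by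
  rcases lt_trichotomy p₀ p with h | rfl | h
  · exact WeightedDom.extrapolate_up hp₀ h hpρ Φ
  · exact ⟨Φ, fun _ _ _ _ h => h⟩
  · exact WeightedDom.extrapolate_down hp0 h hp₀ρ Φ

end Extrapolation

/-! ### Mixed norms -/

section MixedNorm

universe u

/-! ### Splitting off the last variable -/

section Snoc

variable {d : ℕ} {Ω : Fin (d + 1) → Type*} [∀ i, MeasurableSpace (Ω i)]

theorem mixedNorm_succ (P : ∀ i, Measure (Ω i)) (p : Fin (d + 1) → ℝ≥0∞) (f : (∀ i, Ω i) → ℝ≥0∞) :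
    mixedNorm P p f = eLpNorm (fun x : Ω (Fin.last d) =>
        mixedNorm (Ω := fun i : Fin d => Ω i.castSucc) (fun i => P i.castSucc)
          (fun i => p i.castSucc) (fun y => f (Fin.snoc (α := Ω) y x)))
        (p (Fin.last d)) (P (Fin.last d)) := rfl

theorem measurable_snoc :
    Measurable fun z : Ω (Fin.last d) × (∀ i : Fin d, Ω i.castSucc) =>
      (Fin.snoc (α := Ω) z.2 z.1 : ∀ i, Ω i) := by
  rw [measurable_pi_iff]
  intro i
  induction i using Fin.lastCases with
  | last => simpa using measurable_fst
  | cast i =>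
    simp only [Fin.snoc_castSucc]
    exact (measurable_pi_apply i).comp measurable_snd

theorem measurePreserving_snoc (P : ∀ i, Measure (Ω i)) [∀ i, IsProbabilityMeasure (P i)] :
    MeasurePreserving (fun z : Ω (Fin.last d) × (∀ i : Fin d, Ω i.castSucc) =>
        (Fin.snoc (α := Ω) z.2 z.1 : ∀ i, Ω i))
      ((P (Fin.last d)).prod (Measure.pi fun i : Fin d => P i.castSucc)) (Measure.pi P) := by
  refine ⟨measurable_snoc, (Measure.pi_eq fun s hs => ?_).symm⟩
  rw [Measure.map_apply measurable_snoc (MeasurableSet.univ_pi hs)]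
  have : (fun z : Ω (Fin.last d) × (∀ i : Fin d, Ω i.castSucc) =>
        (Fin.snoc (α := Ω) z.2 z.1 : ∀ i, Ω i)) ⁻¹' Set.univ.pi s =
      s (Fin.last d) ×ˢ Set.univ.pi fun i : Fin d => s i.castSucc := by
    ext z
    simp only [Set.mem_preimage, Set.mem_pi, Set.mem_univ, true_imp_iff, Set.mem_prod]
    rw [Fin.forall_fin_succ']
    simp [and_comm]
  rw [this, Measure.prod_prod, Measure.pi_pi, Fin.prod_univ_castSucc, mul_comm]

variable {P : ∀ i, Measure (Ω i)} [∀ i, IsProbabilityMeasure (P i)]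

theorem ae_ae_snoc {Q : (∀ i, Ω i) → Prop} (h : ∀ᵐ ω ∂Measure.pi P, Q ω) :
    ∀ᵐ x ∂P (Fin.last d), ∀ᵐ y ∂Measure.pi fun i : Fin d => P i.castSucc,
      Q (Fin.snoc (α := Ω) y x) :=
  Measure.ae_ae_of_ae_prod ((measurePreserving_snoc P).quasiMeasurePreserving.ae h)

theorem ae_of_ae_ae_snoc {Q : (∀ i, Ω i) → Prop} (hQ : MeasurableSet {ω | Q ω})
    (h : ∀ᵐ x ∂P (Fin.last d), ∀ᵐ y ∂Measure.pi fun i : Fin d => P i.castSucc,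
      Q (Fin.snoc (α := Ω) y x)) : ∀ᵐ ω ∂Measure.pi P, Q ω := by
  rw [← (measurePreserving_snoc P).map_eq, ae_map_iff measurable_snoc.aemeasurable hQ]
  exact (Measure.ae_prod_iff_ae_ae (measurable_snoc hQ)).2 h

theorem lintegral_snoc {f : (∀ i, Ω i) → ℝ≥0∞} (hf : Measurable f) :
    ∫⁻ ω, f ω ∂Measure.pi P = ∫⁻ x, ∫⁻ y, f (Fin.snoc (α := Ω) y x)
      ∂(Measure.pi fun i : Fin d => P i.castSucc) ∂P (Fin.last d) := by
  rw [← (measurePreserving_snoc P).lintegral_comp hf]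
  exact lintegral_prod _ (hf.comp measurable_snoc).aemeasurable

end Snoc

theorem mixedNorm_mono_ae : ∀ {d : ℕ} {Ω : Fin d → Type*} [∀ i, MeasurableSpace (Ω i)]
    {P : ∀ i, Measure (Ω i)} [∀ i, IsProbabilityMeasure (P i)] (p : Fin d → ℝ≥0∞)
    {f g : (∀ i, Ω i) → ℝ≥0∞}, f ≤ᵐ[Measure.pi P] g → mixedNorm P p f ≤ mixedNorm P p g
  | 0, Ω, _, P, _, p, f, g, h => by
    have : ∀ᵐ ω ∂Measure.pi P, f ω ≤ g ω := h
    rw [Measure.pi_of_empty P (fun i => i.elim0), ae_dirac_eq] at this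
    exact this
  | d + 1, Ω, _, P, _, p, f, g, h => by
    rw [mixedNorm_succ, mixedNorm_succ]
    refine eLpNorm_mono_enorm_ae ?_
    filter_upwards [ae_ae_snoc h] with x hx
    exact mixedNorm_mono_ae _ hx

theorem mixedNorm_congr_ae {d : ℕ} {Ω : Fin d → Type*} [∀ i, MeasurableSpace (Ω i)]
    {P : ∀ i, Measure (Ω i)} [∀ i, IsProbabilityMeasure (P i)] (p : Fin d → ℝ≥0∞)
    {f g : (∀ i, Ω i) → ℝ≥0∞} (h : f =ᵐ[Measure.pi P] g) : mixedNorm P p f = mixedNorm P p g :=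
  le_antisymm (mixedNorm_mono_ae p h.le) (mixedNorm_mono_ae p h.symm.le)

theorem mixedNorm_const : ∀ {d : ℕ} {Ω : Fin d → Type*} [∀ i, MeasurableSpace (Ω i)]
    {P : ∀ i, Measure (Ω i)} [∀ i, IsProbabilityMeasure (P i)] {p : Fin d → ℝ≥0∞},
    (∀ i, p i ≠ 0) → ∀ c : ℝ≥0∞, mixedNorm P p (fun _ => c) = c
  | 0, _, _, _, _, _, _, _ => rfl
  | d + 1, Ω, _, P, _, p, hp, c => by
    rw [mixedNorm_succ]
    simp_rw [mixedNorm_const (P := fun i : Fin d => P i.castSucc) (fun i => hp i.castSucc)]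
    rw [eLpNorm_const _ (hp _) (IsProbabilityMeasure.ne_zero _)]
    simp

theorem mixedNorm_const_mul {c : ℝ≥0∞} (hc : c ≠ ∞) : ∀ {d : ℕ} {Ω : Fin d → Type*}
    [∀ i, MeasurableSpace (Ω i)] {P : ∀ i, Measure (Ω i)} {p : Fin d → ℝ≥0∞},
    (∀ i, p i ≠ 0) → (∀ i, p i ≠ ∞) → ∀ f : (∀ i, Ω i) → ℝ≥0∞,
    mixedNorm P p (fun ω => c * f ω) = c * mixedNorm P p f
  | 0, _, _, _, _, _, _, _ => rfl
  | d + 1, Ω, _, P, p, hp0, hpt, f => by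
    have hr : 0 < (p (Fin.last d)).toReal := ENNReal.toReal_pos (hp0 _) (hpt _)
    simp_rw [mixedNorm_succ, mixedNorm_const_mul hc (P := fun i : Fin d => P i.castSucc)
      (fun i => hp0 i.castSucc) (fun i => hpt i.castSucc),
      eLpNorm_eq_lintegral_rpow_enorm_toReal (hp0 _) (hpt _), enorm_eq_self,
      ENNReal.mul_rpow_of_nonneg _ _ hr.le]
    rw [lintegral_const_mul' _ _ (ENNReal.rpow_ne_top_of_nonneg hr.le hc),
      ENNReal.mul_rpow_of_nonneg _ _ (by positivity), ← ENNReal.rpow_mul,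
      mul_one_div_cancel hr.ne', ENNReal.rpow_one]

/-- For finite exponents the norm is an iterated integral, so Tonelli measurability applies. The
parameter space absorbs the last variable at each step of the recursion. -/
theorem measurable_mixedNorm : ∀ {d : ℕ} {X : Type u} [MeasurableSpace X] {Ω : Fin d → Type u}
    [∀ i, MeasurableSpace (Ω i)] {P : ∀ i, Measure (Ω i)} [∀ i, IsProbabilityMeasure (P i)]
    {p : Fin d → ℝ≥0∞}, (∀ i, p i ≠ 0) → (∀ i, p i ≠ ∞) →
    ∀ {f : X → (∀ i, Ω i) → ℝ≥0∞}, Measurable (Function.uncurry f) →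
      Measurable fun x => mixedNorm P p (f x)
  | 0, X, _, Ω, _, P, _, p, _, _, f, hf => by
    exact hf.comp (measurable_id.prodMk measurable_const)
  | d + 1, X, _, Ω, _, P, _, p, hp0, hpt, f, hf => by
    simp_rw [mixedNorm_succ, eLpNorm_eq_lintegral_rpow_enorm_toReal (hp0 _) (hpt _), enorm_eq_self]
    refine Measurable.pow_const ?_ _
    refine Measurable.lintegral_prod_right'
      (f := fun z : X × Ω (Fin.last d) => mixedNorm (fun i : Fin d => P i.castSucc)
        (fun i => p i.castSucc) (fun y => f z.1 (Fin.snoc (α := Ω) y z.2)) ^ (p (Fin.last d)).toReal) ?_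
    refine Measurable.pow_const ?_ _
    refine measurable_mixedNorm (X := X × Ω (Fin.last d)) (fun i => hp0 _) (fun i => hpt _)
      (f := fun (z : X × Ω (Fin.last d)) y => f z.1 (Fin.snoc (α := Ω) y z.2)) ?_
    exact hf.comp ((measurable_fst.comp measurable_fst).prodMk
      (measurable_snoc.comp ((measurable_snd.comp measurable_fst).prodMk measurable_snd)))

theorem measurable_mixedNorm_snoc {d : ℕ} {Ω : Fin (d + 1) → Type*}
    [∀ i, MeasurableSpace (Ω i)] {P : ∀ i, Measure (Ω i)} [∀ i, IsProbabilityMeasure (P i)]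
    {p : Fin (d + 1) → ℝ≥0∞} (hp0 : ∀ i, p i ≠ 0) (hpt : ∀ i, p i ≠ ∞)
    {f : (∀ i, Ω i) → ℝ≥0∞} (hf : Measurable f) :
    Measurable fun x : Ω (Fin.last d) => mixedNorm (fun i : Fin d => P i.castSucc)
          (fun i => p i.castSucc) (fun y => f (Fin.snoc (α := Ω) y x)) :=
  measurable_mixedNorm (fun _ => hp0 _) (fun _ => hpt _)
    (f := fun (x : Ω (Fin.last d)) y => f (Fin.snoc (α := Ω) y x)) (hf.comp measurable_snoc)

theorem mixedNorm_const_exponent {r : ℝ≥0∞} (hr0 : r ≠ 0) (hrt : r ≠ ∞) :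
    ∀ {d : ℕ} {Ω : Fin d → Type*} [∀ i, MeasurableSpace (Ω i)] {P : ∀ i, Measure (Ω i)}
    [∀ i, IsProbabilityMeasure (P i)] {f : (∀ i, Ω i) → ℝ≥0∞}, Measurable f →
    mixedNorm P (fun _ => r) f ^ r.toReal = ∫⁻ ω, f ω ^ r.toReal ∂Measure.pi P
  | 0, Ω, _, P, _, f, hf => by
    rw [Measure.pi_of_empty P (fun i => i.elim0), lintegral_dirac]; rfl
  | d + 1, Ω, _, P, _, f, hf => by
    have hr : 0 < r.toReal := ENNReal.toReal_pos hr0 hrt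
    rw [mixedNorm_succ, eLpNorm_eq_lintegral_rpow_enorm_toReal hr0 hrt, ← ENNReal.rpow_mul,
      one_div_mul_cancel hr.ne', ENNReal.rpow_one, lintegral_snoc (hf.pow_const _)]
    refine lintegral_congr fun x => ?_
    rw [enorm_eq_self]
    exact mixedNorm_const_exponent hr0 hrt (hf.comp (measurable_snoc.comp measurable_prodMk_left))

/-- Serves the case `r = ∞`, where the `L_r` bound becomes a pointwise bound; nested essential
suprema are compared one variable at a time. -/
theorem ae_le_mixedNorm_top : ∀ {d : ℕ} {Ω : Fin d → Type*} [∀ i, MeasurableSpace (Ω i)]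
    {P : ∀ i, Measure (Ω i)} [∀ i, IsProbabilityMeasure (P i)] {f : (∀ i, Ω i) → ℝ≥0∞},
    Measurable f → ∀ᵐ ω ∂Measure.pi P, f ω ≤ mixedNorm P (fun _ => ∞) f
  | 0, Ω, _, P, _, f, hf => by
    rw [Measure.pi_of_empty P (fun i => i.elim0), ae_dirac_eq]
    exact le_refl (f _)
  | d + 1, Ω, _, P, _, f, hf => by
    refine ae_of_ae_ae_snoc (measurableSet_le hf measurable_const) ?_
    rw [mixedNorm_succ, eLpNorm_exponent_top]
    filter_upwards [enorm_ae_le_eLpNormEssSup (fun x : Ω (Fin.last d) =>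
        mixedNorm (fun i : Fin d => P i.castSucc) (fun _ => ∞)
          (fun y => f (Fin.snoc (α := Ω) y x))) (P (Fin.last d))] with x hx
    filter_upwards [ae_le_mixedNorm_top (P := fun i : Fin d => P i.castSucc)
      (hf.comp (measurable_snoc.comp (measurable_prodMk_left (x := x))))] with y hy
    exact hy.trans hx

theorem ae_lt_top_of_mixedNorm_lt_top : ∀ {d : ℕ} {Ω : Fin d → Type*} [∀ i, MeasurableSpace (Ω i)]
    {P : ∀ i, Measure (Ω i)} [∀ i, IsProbabilityMeasure (P i)] {p : Fin d → ℝ≥0∞},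
    (∀ i, p i ≠ 0) → (∀ i, p i ≠ ∞) → ∀ {f : (∀ i, Ω i) → ℝ≥0∞},
    Measurable f → mixedNorm P p f < ∞ → ∀ᵐ ω ∂Measure.pi P, f ω < ∞
  | 0, Ω, _, P, _, p, _, _, f, hf, h => by
    rw [Measure.pi_of_empty P (fun i => i.elim0), ae_dirac_eq]
    exact h
  | d + 1, Ω, _, P, _, p, hp0, hpt, f, hf, h => by
    refine ae_of_ae_ae_snoc (measurableSet_lt hf measurable_const) ?_
    have hr : 0 < (p (Fin.last d)).toReal := ENNReal.toReal_pos (hp0 _) (hpt _)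
    rw [mixedNorm_succ, eLpNorm_eq_lintegral_rpow_enorm_toReal (hp0 _) (hpt _)] at h
    simp_rw [enorm_eq_self] at h
    have hlt := (ENNReal.rpow_lt_top_iff_of_pos (by positivity)).1 h
    filter_upwards [ae_lt_top ((measurable_mixedNorm_snoc hp0 hpt hf).pow_const _) hlt.ne] with x hx
    exact ae_lt_top_of_mixedNorm_lt_top (fun i => hp0 _) (fun i => hpt _)
      (hf.comp (measurable_snoc.comp (measurable_prodMk_left (x := x))))
      ((ENNReal.rpow_lt_top_iff_of_pos hr).1 hx)

theorem ae_eq_zero_of_mixedNorm_eq_zero : ∀ {d : ℕ} {Ω : Fin d → Type*} [∀ i, MeasurableSpace (Ω i)]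
    {P : ∀ i, Measure (Ω i)} [∀ i, IsProbabilityMeasure (P i)] {p : Fin d → ℝ≥0∞},
    (∀ i, p i ≠ 0) → (∀ i, p i ≠ ∞) → ∀ {f : (∀ i, Ω i) → ℝ≥0∞},
    Measurable f → mixedNorm P p f = 0 → ∀ᵐ ω ∂Measure.pi P, f ω = 0
  | 0, Ω, _, P, _, p, _, _, f, hf, h => by
    rw [Measure.pi_of_empty P (fun i => i.elim0), ae_dirac_eq]
    exact h
  | d + 1, Ω, _, P, _, p, hp0, hpt, f, hf, h => by
    refine ae_of_ae_ae_snoc (hf (measurableSet_singleton 0)) ?_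
    have hr : 0 < (p (Fin.last d)).toReal := ENNReal.toReal_pos (hp0 _) (hpt _)
    rw [mixedNorm_succ, eLpNorm_eq_lintegral_rpow_enorm_toReal (hp0 _) (hpt _),
      ENNReal.rpow_eq_zero_iff_of_pos (by positivity)] at h
    simp_rw [enorm_eq_self] at h
    rw [lintegral_eq_zero_iff ((measurable_mixedNorm_snoc hp0 hpt hf).pow_const _)] at h
    filter_upwards [h] with x hx
    exact ae_eq_zero_of_mixedNorm_eq_zero (fun i => hp0 _) (fun i => hpt _)
      (hf.comp (measurable_snoc.comp (measurable_prodMk_left (x := x))))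
      ((ENNReal.rpow_eq_zero_iff_of_pos hr).1 hx)

/-- Dominated convergence in each variable in turn, the inner norms of `F` being finite almost
everywhere. It gives convergence of the atomic decomposition in quasi-norm. -/
theorem tendsto_mixedNorm_zero : ∀ {d : ℕ} {Ω : Fin d → Type*} [∀ i, MeasurableSpace (Ω i)]
    {P : ∀ i, Measure (Ω i)} [∀ i, IsProbabilityMeasure (P i)] {p : Fin d → ℝ≥0∞},
    (∀ i, p i ≠ 0) → (∀ i, p i ≠ ∞) → ∀ {f : ℕ → (∀ i, Ω i) → ℝ≥0∞} {F : (∀ i, Ω i) → ℝ≥0∞},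
    (∀ n, Measurable (f n)) → Measurable F → (∀ n, f n ≤ᵐ[Measure.pi P] F) → mixedNorm P p F < ∞ →
    (∀ᵐ ω ∂Measure.pi P, Tendsto (fun n => f n ω) atTop (𝓝 0)) →
    Tendsto (fun n => mixedNorm P p (f n)) atTop (𝓝 0)
  | 0, Ω, _, P, _, p, _, _, f, F, _, _, _, _, h => by
    rw [Measure.pi_of_empty P (fun i => i.elim0), ae_dirac_eq] at h
    exact h
  | d + 1, Ω, _, P, _, p, hp0, hpt, f, F, hf, hF, hfF, hFt, h => by
    have hr : 0 < (p (Fin.last d)).toReal := ENNReal.toReal_pos (hp0 _) (hpt _)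
    rw [mixedNorm_succ, eLpNorm_eq_lintegral_rpow_enorm_toReal (hp0 _) (hpt _)] at hFt
    simp_rw [mixedNorm_succ, eLpNorm_eq_lintegral_rpow_enorm_toReal (hp0 _) (hpt _)]
    simp_rw [enorm_eq_self] at hFt ⊢
    have hlt := (ENNReal.rpow_lt_top_iff_of_pos (by positivity)).1 hFt
    have hmeas : ∀ n, Measurable fun x : Ω (Fin.last d) => mixedNorm (fun i : Fin d => P i.castSucc)
        (fun i => p i.castSucc) (fun y => f n (Fin.snoc (α := Ω) y x)) ^ (p (Fin.last d)).toReal :=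
      fun n => (measurable_mixedNorm_snoc hp0 hpt (hf n)).pow_const _
    have hfF' := fun n => ae_ae_snoc (hfF n)
    have key := tendsto_lintegral_of_dominated_convergence (μ := P (Fin.last d)) (f := fun _ => 0)
      (fun x : Ω (Fin.last d) => mixedNorm (fun i : Fin d => P i.castSucc)
        (fun i => p i.castSucc) (fun y => F (Fin.snoc (α := Ω) y x)) ^ (p (Fin.last d)).toReal)
      hmeas ?_ hlt.ne ?_
    · have h0 : (0 : ℝ≥0∞) = (∫⁻ _ : Ω (Fin.last d), 0 ∂P (Fin.last d)) ^ (1 / (p (Fin.last d)).toReal) := by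
        rw [lintegral_zero, ENNReal.zero_rpow_of_pos (by positivity)]
      rw [h0]
      exact (ENNReal.continuous_rpow_const.tendsto _).comp key
    · intro n
      filter_upwards [hfF' n] with x hx
      exact ENNReal.rpow_le_rpow (mixedNorm_mono_ae _ hx) hr.le
    · filter_upwards [ae_ae_snoc h, ae_all_iff.2 hfF',
        ae_lt_top ((measurable_mixedNorm_snoc hp0 hpt hF).pow_const _) hlt.ne] with x h1 h2 h3
      have := tendsto_mixedNorm_zero (P := fun i : Fin d => P i.castSucc)
        (p := fun i => p i.castSucc) (fun i => hp0 _) (fun i => hpt _)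
        (f := fun n y => f n (Fin.snoc (α := Ω) y x)) (F := fun y => F (Fin.snoc (α := Ω) y x))
        (fun n => (hf n).comp (measurable_snoc.comp (measurable_prodMk_left (x := x))))
        (hF.comp (measurable_snoc.comp (measurable_prodMk_left (x := x)))) h2
        ((ENNReal.rpow_lt_top_iff_of_pos hr).1 h3) h1
      have h4 := (ENNReal.continuous_rpow_const (y := (p (Fin.last d)).toReal)).tendsto 0 |>.comp this
      rwa [ENNReal.zero_rpow_of_pos hr] at h4

end MixedNorm

/-! ### Weighted inequalities on product spaces -/

section PullBack

theorem condLExp_comp_comap {Z Y : Type*} {mZ : MeasurableSpace Z} {m mY : MeasurableSpace Y}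
    {μ : Measure Z} {Q : Measure Y} [IsFiniteMeasure μ] [IsFiniteMeasure Q] {η : Z → Y}
    (hη : MeasurePreserving η μ Q) (hm : m ≤ mY) {v : Y → ℝ≥0∞} (hv : Measurable v) :
    condLExp (m.comap η) μ (fun z => v (η z)) =ᵐ[μ] fun z => condLExp m Q v (η z) := by
  have hle : m.comap η ≤ mZ := (MeasurableSpace.comap_mono hm).trans hη.measurable.comap_le
  refine (ae_eq_condLExp hle μ _
    ((measurable_condLExp m Q v).comp (comap_measurable η)) ?_).symm
  rintro s ⟨t, ht, rfl⟩
  change ∫⁻ z in η ⁻¹' t, condLExp m Q v (η z) ∂μ = _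
  rw [hη.setLIntegral_comp_preimage (hm t ht) (measurable_condLExp' m Q v),
    hη.setLIntegral_comp_preimage (hm t ht) hv, setLIntegral_condLExp hm Q v ht]

/-- For `s` in the product σ-algebra, `∫_s w(y)` is the integral over `Y` of `w` times the measure
of the section of `s` at `y`, which is `b`-measurable in `y`; hence `w` may be replaced by its
conditional expectation given `b`. -/
theorem condLExp_comp_snd {X Y : Type*} {a mX : MeasurableSpace X} {b mY : MeasurableSpace Y}
    {P : Measure X} {Q : Measure Y} [IsFiniteMeasure P] [IsFiniteMeasure Q]
    (ha : a ≤ mX) (hb : b ≤ mY) {v : Y → ℝ≥0∞} (hv : Measurable v) :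
    condLExp (a.prod b) (P.prod Q) (fun z => v z.2) =ᵐ[P.prod Q] fun z => condLExp b Q v z.2 := by
  have hle : a.prod b ≤ mX.prod mY :=
    sup_le_sup (MeasurableSpace.comap_mono ha) (MeasurableSpace.comap_mono hb)
  refine (ae_eq_condLExp hle _ _ ((measurable_condLExp b Q v).comp
    (@measurable_snd X Y a b)) fun s hs => ?_).symm
  have key : ∀ w : Y → ℝ≥0∞, Measurable w →
      ∫⁻ z in s, w z.2 ∂(P.prod Q) = ∫⁻ y, P.trim ha ((fun x => (x, y)) ⁻¹' s) * w y ∂Q := by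
    intro w hw
    rw [← lintegral_indicator (hle s hs), lintegral_prod_symm _
      ((Measurable.indicator (f := fun z : X × Y => w z.2) (hw.comp measurable_snd)
        (hle s hs)).aemeasurable)]
    refine lintegral_congr fun y => ?_
    have hsy : MeasurableSet[a] ((fun x => (x, y)) ⁻¹' s) := @measurable_prodMk_right X Y a b y s hs
    rw [trim_measurableSet_eq ha hsy, mul_comm, ← lintegral_indicator_const (ha _ hsy)]
    refine lintegral_congr fun x => ?_
    by_cases hx : (x, y) ∈ s
    · rw [Set.indicator_of_mem hx, Set.indicator_of_mem (by exact hx)]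
    · rw [Set.indicator_of_notMem hx, Set.indicator_of_notMem (by exact hx)]
  change ∫⁻ z in s, condLExp b Q v z.2 ∂(P.prod Q) = _
  rw [key _ (measurable_condLExp' b Q v), key _ hv]
  exact lintegral_mul_condLExp hb (@measurable_measure_prodMk_right X Y a b (P.trim ha) _ s hs) hv

/-- The product of two filtrations. -/
def pairFiltration {X Y : Type*} {mX : MeasurableSpace X} {mY : MeasurableSpace Y}
    (𝓐 : Filtration ℕ mX) (𝓑 : Filtration ℕ mY) : Filtration ℕ (mX.prod mY) where
  seq n := (𝓐 n).prod (𝓑 n)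
  mono' _ _ h := sup_le_sup (MeasurableSpace.comap_mono (𝓐.mono h))
    (MeasurableSpace.comap_mono (𝓑.mono h))
  le' n := sup_le_sup (MeasurableSpace.comap_mono (𝓐.le n)) (MeasurableSpace.comap_mono (𝓑.le n))

/-- Conditional expectations commute with `η`, so the pulled back weight keeps the same constants
`B`; this lets the estimates survive the removal of variables. -/
theorem IsAInf.comp {Z Y : Type*} {mZ : MeasurableSpace Z} {mY : MeasurableSpace Y}
    {μ : Measure Z} {Q : Measure Y} {η : Z → Y}
    (hη : MeasurePreserving η μ Q) {𝓖 : Filtration ℕ mZ} {𝓑 : Filtration ℕ mY}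
    (h : ∀ (n : ℕ) {v : Y → ℝ≥0∞}, Measurable v →
      condLExp (𝓖 n) μ (fun z => v (η z)) =ᵐ[μ] fun z => condLExp (𝓑 n) Q v (η z))
    {B : ℝ → ℝ≥0} {v : Y → ℝ≥0∞} (hv : IsAInf Q 𝓑 B v) : IsAInf μ 𝓖 B (fun z => v (η z)) where
  measurable := hv.measurable.comp hη.measurable
  pos := hη.quasiMeasurePreserving.ae hv.pos
  lintegral_ne_top := by rw [hη.lintegral_comp hv.measurable]; exact hv.lintegral_ne_top
  rpow_condLExp_le n θ h0 h1 := by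
    filter_upwards [h n hv.measurable, h n (hv.measurable.pow_const θ),
      hη.quasiMeasurePreserving.ae (hv.rpow_condLExp_le n θ h0 h1)] with z h1 h2 h3
    rw [h1, h2]
    exact h3

/-- It suffices to test the inequality upstairs on the weights `v ∘ η`. -/
theorem WeightedDom.of_comp {Z Y : Type*} {mZ : MeasurableSpace Z} {mY : MeasurableSpace Y}
    {μ : Measure Z} {Q : Measure Y} {η : Z → Y}
    (hη : MeasurePreserving η μ Q) {𝓖 : Filtration ℕ mZ} {𝓑 : Filtration ℕ mY}
    (h : ∀ (n : ℕ) {v : Y → ℝ≥0∞}, Measurable v →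
      condLExp (𝓖 n) μ (fun z => v (η z)) =ᵐ[μ] fun z => condLExp (𝓑 n) Q v (η z))
    {ρ p : ℝ} {Φ : (ℝ → ℝ≥0) → ℝ≥0} {F G : Y → ℝ≥0∞} (hF : Measurable F) (hG : Measurable G)
    (hd : WeightedDom μ 𝓖 ρ p Φ (fun z => F (η z)) (fun z => G (η z))) :
    WeightedDom Q 𝓑 ρ p Φ F G := by
  intro B v hv
  have := hd B _ (hv.comp hη h)
  rwa [hη.lintegral_comp (f := fun y => F y ^ p * v y ^ (1 - p / ρ))
      ((hF.pow_const p).mul (hv.measurable.pow_const _)),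
    hη.lintegral_comp (f := fun y => G y ^ p * v y ^ (1 - p / ρ))
      ((hG.pow_const p).mul (hv.measurable.pow_const _))] at this

/-- A weighted inequality on a product space implies one for the `L_p`-norms in the first variable. -/
theorem WeightedDom.eLpNorm_fst {X Y : Type*} {mX : MeasurableSpace X} {mY : MeasurableSpace Y}
    {P : Measure X} {Q : Measure Y} [IsProbabilityMeasure P] [IsProbabilityMeasure Q]
    {𝓐 : Filtration ℕ mX} {𝓑 : Filtration ℕ mY} {ρ : ℝ} {p : ℝ≥0∞} (hp0 : p ≠ 0) (hpt : p ≠ ∞)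
    {Φ : (ℝ → ℝ≥0) → ℝ≥0} {F G : X × Y → ℝ≥0∞} (hF : Measurable F) (hG : Measurable G)
    (hd : WeightedDom (P.prod Q) (pairFiltration 𝓐 𝓑) ρ p.toReal Φ F G) :
    WeightedDom Q 𝓑 ρ p.toReal Φ (fun y => eLpNorm (fun x => F (x, y)) p P)
      (fun y => eLpNorm (fun x => G (x, y)) p P) := by
  intro B v hv
  have hr : 0 < p.toReal := ENNReal.toReal_pos hp0 hpt
  have key : ∀ H : X × Y → ℝ≥0∞, Measurable H →
      ∫⁻ y, eLpNorm (fun x => H (x, y)) p P ^ p.toReal * v y ^ (1 - p.toReal / ρ) ∂Q =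
        ∫⁻ z, H z ^ p.toReal * v z.2 ^ (1 - p.toReal / ρ) ∂(P.prod Q) := by
    intro H hH
    have hm : Measurable fun z : X × Y => H z ^ p.toReal * v z.2 ^ (1 - p.toReal / ρ) :=
      (hH.pow_const _).mul ((hv.measurable.comp measurable_snd).pow_const _)
    rw [lintegral_prod_symm _ hm.aemeasurable]
    refine lintegral_congr fun y => ?_
    rw [eLpNorm_eq_lintegral_rpow_enorm_toReal hp0 hpt, ← ENNReal.rpow_mul,
      one_div_mul_cancel hr.ne', ENNReal.rpow_one,
      ← lintegral_mul_const _ (by simp only [enorm_eq_self]; exact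
        (hH.comp measurable_prodMk_right).pow_const _)]
    simp
  rw [key F hF, key G hG]
  exact hd B _ (hv.comp measurePreserving_snd fun n v hv =>
    condLExp_comp_snd (𝓐.le n) (𝓑.le n) hv)

end PullBack

/-! ### Integrating out the coordinates one by one -/

section Iterate

universe u

theorem measurePreserving_snoc_prod {d : ℕ} {Ω : Fin (d + 1) → Type*} [∀ i, MeasurableSpace (Ω i)]
    (P : ∀ i, Measure (Ω i)) [∀ i, IsProbabilityMeasure (P i)] {Y : Type*} [MeasurableSpace Y]
    (Q : Measure Y) [IsProbabilityMeasure Q] :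
    MeasurePreserving (fun w : (∀ i, Ω i) × Y =>
        ((fun i : Fin d => w.1 i.castSucc), (w.1 (Fin.last d), w.2)))
      ((Measure.pi P).prod Q)
      ((Measure.pi fun i : Fin d => P i.castSucc).prod ((P (Fin.last d)).prod Q)) := by
  have h1 : MeasurePreserving (fun ω : ∀ i, Ω i =>
      ((fun i : Fin d => ω i.castSucc), ω (Fin.last d))) (Measure.pi P)
      ((Measure.pi fun i : Fin d => P i.castSucc).prod (P (Fin.last d))) := by
    have hm : Measurable fun ω : ∀ i, Ω i => ((fun i : Fin d => ω i.castSucc), ω (Fin.last d)) := by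
      fun_prop
    refine ⟨hm, ?_⟩
    rw [← (measurePreserving_snoc P).map_eq, Measure.map_map hm measurable_snoc]
    have : (fun ω : ∀ i, Ω i => ((fun i : Fin d => ω i.castSucc), ω (Fin.last d))) ∘
        (fun z : Ω (Fin.last d) × (∀ i : Fin d, Ω i.castSucc) =>
        (Fin.snoc (α := Ω) z.2 z.1 : ∀ i, Ω i)) = Prod.swap := by
      ext z <;> simp
    rw [this, Measure.prod_swap]
  exact (measurePreserving_prodAssoc _ _ _).comp (h1.prod (MeasurePreserving.id Q))

/-- `Z` is a fixed filtered space which splits into the coordinates still to be integrated and a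
factor `Y` carrying the weights. In the induction only the splitting changes: the last coordinate
joins `Y`, the inner norms in the others are treated by the induction hypothesis, and then this
coordinate is integrated out. With no coordinate left the weights on `Y` are pulled back to `Z`. The
bound `Φ'` is fixed before `F` and `G`, so the final constant is uniform. -/
theorem WeightedDom.iterate_mixedNorm : ∀ {d : ℕ} {Ω : Fin d → Type u} [mΩ : ∀ i, MeasurableSpace (Ω i)]
    (P : ∀ i, Measure (Ω i)) [∀ i, IsProbabilityMeasure (P i)] (ℱ : ∀ i, Filtration ℕ (mΩ i))
    (p : Fin d → ℝ≥0∞) {ρ : ℝ}, (∀ i, p i ≠ 0) → (∀ i, p i ≠ ∞) → (∀ i, (p i).toReal < ρ) →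
    ∀ {Y Z : Type u} [mY : MeasurableSpace Y] [mZ : MeasurableSpace Z]
    (Q : Measure Y) [IsProbabilityMeasure Q] (μ : Measure Z) [IsProbabilityMeasure μ]
    (𝓑 : Filtration ℕ mY) (𝓖 : Filtration ℕ mZ) (X : ∀ i, Z → Ω i) (η : Z → Y),
    MeasurePreserving (fun z => ((fun i => X i z), η z)) μ ((Measure.pi P).prod Q) →
    (∀ n, 𝓖 n = (⨆ i, (ℱ i n).comap (X i)) ⊔ (𝓑 n).comap η) →
    ∀ {t q : ℝ}, 0 < t → t < ρ → 0 < q → q < ρ → ∀ Φ : (ℝ → ℝ≥0) → ℝ≥0,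
    ∃ Φ' : (ℝ → ℝ≥0) → ℝ≥0, ∀ F G : (∀ i, Ω i) × Y → ℝ≥0∞, Measurable F → Measurable G →
      WeightedDom μ 𝓖 ρ t Φ (fun z => F ((fun i => X i z), η z)) (fun z => G ((fun i => X i z), η z)) →
      WeightedDom Q 𝓑 ρ q Φ' (fun y => mixedNorm P p fun x => F (x, y))
        (fun y => mixedNorm P p fun x => G (x, y))
  | 0, Ω, mΩ, P, _, ℱ, p, ρ, hp0, hpt, hpρ, Y, Z, mY, mZ, Q, _, μ, _, 𝓑, 𝓖, X, η, hXη, h𝓖, t, q,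
      ht, htρ, hq, hqρ, Φ => by
    obtain ⟨Φ', hΦ'⟩ := WeightedDom.extrapolate (μ := Q) (𝓖 := 𝓑) ht htρ hq hqρ Φ
    refine ⟨Φ', fun F G hF hG h => ?_⟩
    have hη : MeasurePreserving η μ Q := measurePreserving_snd.comp hXη
    have hm : Measurable fun y : Y => ((fun i : Fin 0 => (i.elim0 : Ω i)), y) :=
      measurable_const.prodMk measurable_id
    refine hΦ' _ _ (hF.comp hm) (hG.comp hm) (WeightedDom.of_comp hη (𝓖 := 𝓖) ?_ (hF.comp hm)
      (hG.comp hm) ?_)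
    · intro n v hv
      rw [h𝓖 n, iSup_of_empty, bot_sup_eq]
      exact condLExp_comp_comap hη (𝓑.le n) hv
    · have e : ∀ z, (fun i : Fin 0 => (i.elim0 : Ω i)) = fun i => X i z :=
        fun z => funext fun i => i.elim0
      have e' : ∀ (H : (∀ i, Ω i) × Y → ℝ≥0∞) z, mixedNorm P p (fun x => H (x, η z)) =
          H ((fun i => X i z), η z) := fun H z => by rw [← e z]; rfl
      simp only [e']
      exact h
  | d + 1, Ω, mΩ, P, _, ℱ, p, ρ, hp0, hpt, hpρ, Y, Z, mY, mZ, Q, _, μ, _, 𝓑, 𝓖, X, η, hXη, h𝓖, t, q,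
      ht, htρ, hq, hqρ, Φ => by
    have hr : 0 < (p (Fin.last d)).toReal := ENNReal.toReal_pos (hp0 _) (hpt _)
    obtain ⟨Φ₁, hΦ₁⟩ := WeightedDom.iterate_mixedNorm (fun i : Fin d => P i.castSucc)
      (fun i : Fin d => ℱ i.castSucc) (fun i : Fin d => p i.castSucc) (fun i => hp0 _)
      (fun i => hpt _) (fun i => hpρ _) (Y := Ω (Fin.last d) × Y) (Z := Z)
      ((P (Fin.last d)).prod Q) μ (pairFiltration (ℱ (Fin.last d)) 𝓑) 𝓖
      (fun i => X i.castSucc) (fun z => (X (Fin.last d) z, η z))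
      ((measurePreserving_snoc_prod P Q).comp hXη) (by
        intro n
        rw [h𝓖 n]
        change _ = _ ⊔ MeasurableSpace.comap _ (MeasurableSpace.comap _ _ ⊔ MeasurableSpace.comap _ _)
        rw [MeasurableSpace.comap_sup, MeasurableSpace.comap_comp, MeasurableSpace.comap_comp,
          ← sup_assoc]
        congr 1
        refine le_antisymm (iSup_le fun i => ?_) (sup_le (iSup_le fun i => ?_) ?_)
        · induction i using Fin.lastCases with
          | last => exact le_sup_right
          | cast i => exact le_trans (le_iSup (fun i : Fin d =>
              MeasurableSpace.comap (X i.castSucc) (ℱ i.castSucc n)) i) le_sup_left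
        · exact le_iSup (fun i => MeasurableSpace.comap (X i) (ℱ i n)) i.castSucc
        · exact le_iSup (fun i => MeasurableSpace.comap (X i) (ℱ i n)) (Fin.last d))
      ht htρ hr (hpρ _) Φ
    -- The induction hypothesis was used at the exponent of the last variable, as Fubini requires;
    -- extrapolation then moves to the requested `q`.
    obtain ⟨Φ₂, hΦ₂⟩ := WeightedDom.extrapolate (μ := Q) (𝓖 := 𝓑) hr (hpρ _) hq hqρ Φ₁
    refine ⟨Φ₂, fun F G hF hG h => ?_⟩
    have hs : Measurable fun w : (∀ i : Fin d, Ω i.castSucc) × (Ω (Fin.last d) × Y) =>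
        ((Fin.snoc (α := Ω) w.1 w.2.1 : ∀ i, Ω i), w.2.2) :=
      (measurable_snoc.comp ((measurable_fst.comp measurable_snd).prodMk measurable_fst)).prodMk
        (measurable_snd.comp measurable_snd)
    have h1 := hΦ₁ (fun w => F ((Fin.snoc (α := Ω) w.1 w.2.1 : ∀ i, Ω i), w.2.2))
      (fun w => G ((Fin.snoc (α := Ω) w.1 w.2.1 : ∀ i, Ω i), w.2.2)) (hF.comp hs) (hG.comp hs) (by
        have e : ∀ z, (Fin.snoc (α := Ω) (fun i : Fin d => X i.castSucc z) (X (Fin.last d) z) :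
            ∀ i, Ω i) = fun i => X i z := by
          intro z
          exact Fin.snoc_init_self (α := Ω) (fun i => X i z)
        simp only [e]
        exact h)
    have hmeas : ∀ H : (∀ i, Ω i) × Y → ℝ≥0∞, Measurable H →
        Measurable fun z : Ω (Fin.last d) × Y => mixedNorm (fun i : Fin d => P i.castSucc)
          (fun i => p i.castSucc) (fun y => H ((Fin.snoc (α := Ω) y z.1 : ∀ i, Ω i), z.2)) := by
      intro H hH
      refine measurable_mixedNorm (X := Ω (Fin.last d) × Y) (fun i => hp0 _) (fun i => hpt _)
        (f := fun z y => H ((Fin.snoc (α := Ω) y z.1 : ∀ i, Ω i), z.2)) ?_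
      exact hH.comp ((measurable_snoc.comp
        ((measurable_fst.comp measurable_fst).prodMk measurable_snd)).prodMk
        (measurable_snd.comp measurable_fst))
    have h2 := WeightedDom.eLpNorm_fst (hp0 _) (hpt _) (hmeas F hF) (hmeas G hG) h1
    refine hΦ₂ _ _ ?_ ?_ h2
    · exact measurable_mixedNorm hp0 hpt (f := fun y x => F (x, y)) (hF.comp measurable_swap)
    · exact measurable_mixedNorm hp0 hpt (f := fun y x => G (x, y)) (hG.comp measurable_swap)

/-- Here the weight-carrying factor is a single point. With the weight `1`, the weighted inequality
is the norm inequality raised to the power `t`. -/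
theorem mixedNorm_le_of_weightedDom {d : ℕ} {Ω : Fin d → Type u} [mΩ : ∀ i, MeasurableSpace (Ω i)]
    (P : ∀ i, Measure (Ω i)) [∀ i, IsProbabilityMeasure (P i)] (ℱ : ∀ i, Filtration ℕ (mΩ i))
    (p : Fin d → ℝ≥0∞) {ρ : ℝ} (hp0 : ∀ i, p i ≠ 0) (hpt : ∀ i, p i ≠ ∞)
    (hpρ : ∀ i, (p i).toReal < ρ) {t : ℝ} (ht : 0 < t) (htρ : t < ρ) (Φ : (ℝ → ℝ≥0) → ℝ≥0) :
    ∃ C : ℝ≥0, ∀ F G : (∀ i, Ω i) → ℝ≥0∞, Measurable F → Measurable G →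
      WeightedDom (Measure.pi P) (prodFiltration ℱ) ρ t Φ F G →
      mixedNorm P p F ≤ C * mixedNorm P p G := by
  obtain ⟨Φ', h⟩ := WeightedDom.iterate_mixedNorm P ℱ p hp0 hpt hpρ (Y := PUnit) (Z := ∀ i, Ω i)
    (Measure.dirac PUnit.unit) (Measure.pi P) ⟨fun _ => ⊤, fun _ _ _ => le_rfl, fun _ => le_rfl⟩
    (prodFiltration ℱ) (fun i ω => ω i) (fun _ => PUnit.unit) (by
      refine ⟨by fun_prop, ?_⟩
      rw [Measure.prod_dirac]) (by
      intro n
      rw [show MeasurableSpace.comap (fun _ : ∀ i, Ω i => PUnit.unit) _ = ⊥ from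
        MeasurableSpace.comap_const _, sup_bot_eq]
      rfl) ht htρ ht htρ Φ
  refine ⟨Φ' 1 ^ (1 / t), fun F G hF hG hFG => ?_⟩
  have := h (fun w => F w.1) (fun w => G w.1) (hF.comp measurable_fst) (hG.comp measurable_fst) hFG
    1 _ isAInf_one
  simp only [ENNReal.one_rpow, mul_one, lintegral_dirac] at this
  rw [ENNReal.coe_rpow_of_nonneg _ (by positivity)]
  calc mixedNorm P p F = (mixedNorm P p F ^ t) ^ (1 / t) := by
        rw [← ENNReal.rpow_mul, mul_one_div_cancel ht.ne', ENNReal.rpow_one]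
    _ ≤ (Φ' 1 * mixedNorm P p G ^ t) ^ (1 / t) := ENNReal.rpow_le_rpow this (by positivity)
    _ = _ := by
        rw [ENNReal.mul_rpow_of_nonneg _ _ (by positivity), ← ENNReal.rpow_mul,
          mul_one_div_cancel ht.ne', ENNReal.rpow_one]

end Iterate

/-! ### A weighted estimate for sums of localized functions -/

section Base

theorem tsum_rpow_le {ι : Type*} (b : ι → ℝ≥0∞) {t : ℝ} (ht0 : 0 < t) (ht1 : t ≤ 1) :
    (∑' i, b i) ^ t ≤ ∑' i, b i ^ t := by
  classical
  have h : ∀ s : Finset ι, (∑ i ∈ s, b i) ^ t ≤ ∑ i ∈ s, b i ^ t := by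
    intro s
    induction s using Finset.induction_on with
    | empty => simp [ht0]
    | insert i s hi ih =>
      rw [Finset.sum_insert hi, Finset.sum_insert hi]
      exact (ENNReal.rpow_add_le_add_rpow _ _ ht0.le ht1).trans (by gcongr)
  have := (ENNReal.continuous_rpow_const (y := t)).continuousAt.tendsto.comp
    (ENNReal.summable (f := b)).hasSum
  exact le_of_tendsto this (Eventually.of_forall fun s => (h s).trans (ENNReal.sum_le_tsum s))

variable {Ω : Type*} {m0 : MeasurableSpace Ω} {μ : Measure Ω} [IsFiniteMeasure μ]

theorem condLExp_indicator_le {m : MeasurableSpace Ω} (hm : m ≤ m0) {D : Set Ω}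
    (hD : MeasurableSet[m] D) {f : Ω → ℝ≥0∞} {c : ℝ≥0∞}
    (h : ∀ A, MeasurableSet[m] A → ∫⁻ ω in A ∩ D, f ω ∂μ ≤ c * μ (A ∩ D)) :
    ∀ᵐ ω ∂μ, condLExp m μ (D.indicator f) ω ≤ D.indicator (fun _ => c) ω := by
  have hE : Measurable[m] (condLExp m μ (D.indicator f)) := measurable_condLExp m μ _
  have hI : Measurable[m] (D.indicator fun _ => c) := measurable_const.indicator hD
  refine ae_of_ae_trim hm (ae_le_of_forall_setLIntegral_le_of_sigmaFinite hE fun s hs _ => ?_)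
  rw [setLIntegral_trim hm hE hs, setLIntegral_trim hm hI hs, setLIntegral_condLExp hm μ _ hs,
    setLIntegral_indicator (hm D hD), setLIntegral_indicator (hm D hD), setLIntegral_const,
    Set.inter_comm D s]
  exact h s hs

variable {𝓖 : Filtration ℕ m0}

/-- The hypothesis says that `𝔼_n(b^ρ) ≤ c^ρ` on `D`. Conditional Hölder with exponents `t/ρ` and `1
- t/ρ` gives a bound by `c^t 𝔼_n(v)^(1-t/ρ)`, and reverse Jensen moves the power back inside the
conditional expectation. -/
theorem IsAInf.setLIntegral_rpow_le {B : ℝ → ℝ≥0} {v : Ω → ℝ≥0∞} (hv : IsAInf μ 𝓖 B v) {n : ℕ}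
    {D : Set Ω} (hD : MeasurableSet[𝓖 n] D) {b : Ω → ℝ≥0∞} (hb : Measurable b) {ρ t : ℝ}
    (ht : 0 < t) (htρ : t < ρ) {c : ℝ≥0∞} (hc : c ≠ ∞)
    (h : ∀ A, MeasurableSet[𝓖 n] A → ∫⁻ ω in A ∩ D, b ω ^ ρ ∂μ ≤ c ^ ρ * μ (A ∩ D)) :
    ∫⁻ ω in D, b ω ^ t * v ω ^ (1 - t / ρ) ∂μ ≤
      3 * B (1 - t / ρ) * c ^ t * ∫⁻ ω in D, v ω ^ (1 - t / ρ) ∂μ := by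
  have hρ : 0 < ρ := ht.trans htρ
  have hθ0 : 0 < t / ρ := by positivity
  have hθ1 : t / ρ < 1 := (div_lt_one hρ).2 htρ
  have hle := 𝓖.le n
  have hDm := hle D hD
  have hvm := hv.measurable
  set f : Ω → ℝ≥0∞ := D.indicator fun ω => b ω ^ ρ with hf
  have hfm : Measurable f := (hb.pow_const ρ).indicator hDm
  have hEf := condLExp_indicator_le hle hD h
  have hcρ : c ^ ρ ≠ ∞ := ENNReal.rpow_ne_top_of_nonneg hρ.le hc
  have hfin : ∀ᵐ ω ∂μ, condLExp (𝓖 n) μ f ω ≠ ∞ := by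
    filter_upwards [hEf] with ω hω
    refine ne_top_of_le_ne_top hcρ (hω.trans ?_)
    exact Set.indicator_le_self' (fun _ _ => zero_le) ω
  have hH := condLExp_rpow_mul_rpow_le (m := 𝓖 n) (μ := μ) hfm hvm hθ0 hθ1 hfin
    (condLExp_ne_top (mΩ := 𝓖 n) hv.lintegral_ne_top)
  have e1 : ∫⁻ ω in D, b ω ^ t * v ω ^ (1 - t / ρ) ∂μ =
      ∫⁻ ω, condLExp (𝓖 n) μ (fun x => f x ^ (t / ρ) * v x ^ (1 - t / ρ)) ω ∂μ := by
    rw [lintegral_condLExp hle, ← lintegral_indicator hDm]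
    refine lintegral_congr fun ω => ?_
    by_cases hω : ω ∈ D
    · simp only [hf, Set.indicator_of_mem hω]
      rw [← ENNReal.rpow_mul, mul_div_cancel₀ _ hρ.ne']
    · simp only [hf, Set.indicator_of_notMem hω]
      rw [ENNReal.zero_rpow_of_pos hθ0, zero_mul]
  have hIm : Measurable[𝓖 n] (D.indicator fun _ => (1 : ℝ≥0∞)) := measurable_const.indicator hD
  have hcm : ∀ {w : Ω → ℝ≥0∞}, Measurable w → ∫⁻ ω, D.indicator (fun _ => (1 : ℝ≥0∞)) ω * w ω ∂μ =
      ∫⁻ ω in D, w ω ∂μ := by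
    intro w hw
    rw [← lintegral_indicator hDm]
    refine lintegral_congr fun ω => ?_
    by_cases hω : ω ∈ D <;> simp [hω]
  have hvs : Measurable fun ω => v ω ^ (1 - t / ρ) := hvm.pow_const _
  rw [e1, ← hcm hvs, ← lintegral_mul_condLExp hle hIm hvs, ← lintegral_const_mul]
  · refine lintegral_mono_ae ?_
    filter_upwards [hH, hEf, hv.rpow_condLExp_le n (1 - t / ρ) (by linarith) (by linarith)]
      with ω a1 a2 a3
    refine a1.trans ?_
    calc 3 * (condLExp (𝓖 n) μ f ω ^ (t / ρ) * condLExp (𝓖 n) μ v ω ^ (1 - t / ρ))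
        ≤ 3 * ((D.indicator (fun _ => c ^ ρ) ω) ^ (t / ρ) *
          (B (1 - t / ρ) * condLExp (𝓖 n) μ (fun x => v x ^ (1 - t / ρ)) ω)) := by gcongr
      _ = _ := by
        by_cases hω : ω ∈ D
        · simp only [Set.indicator_of_mem hω]
          rw [← ENNReal.rpow_mul, mul_div_cancel₀ _ hρ.ne']
          ring
        · simp only [Set.indicator_of_notMem hω]
          rw [ENNReal.zero_rpow_of_pos hθ0]
          ring
  · exact (hIm.mono hle le_rfl).mul (measurable_condLExp' _ _ _)

/-- As `t ≤ 1`, the power passes inside the sum over `k`. For fixed `k` the local estimates add up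
over the disjoint `D k n` to an integral over `{L > 2^k}`, and the dyadic sum over `k` returns
`L^t`. -/
theorem weightedDom_of_localized {ρ t : ℝ} (ht : 0 < t) (ht1 : t ≤ 1) (htρ : t < ρ) {K : ℝ≥0}
    {L : Ω → ℝ≥0∞} {D : ℤ → ℕ → Set Ω}
    (hD : ∀ k n, MeasurableSet[𝓖 n] (D k n)) (hdisj : ∀ k, Pairwise (Function.onFun Disjoint (D k)))
    (hDL : ∀ k, ⋃ n, D k n = {ω | 2 ^ k < L ω}) {b : ℤ → Ω → ℝ≥0∞} (hb : ∀ k, Measurable (b k))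
    (hb0 : ∀ k, ∀ᵐ ω ∂μ, ω ∉ ⋃ n, D k n → b k ω = 0)
    (h : ∀ k n A, MeasurableSet[𝓖 n] A →
      ∫⁻ ω in A ∩ D k n, b k ω ^ ρ ∂μ ≤ (K * 2 ^ k) ^ ρ * μ (A ∩ D k n))
    {F : Ω → ℝ≥0∞} (hF : ∀ᵐ ω ∂μ, F ω ≤ ∑' k, b k ω) :
    WeightedDom μ 𝓖 ρ t (fun B => 3 * B (1 - t / ρ) * K ^ t * (dyadicConst t).toNNReal) F L := by
  intro B v hv
  set s := 1 - t / ρ with hs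
  have hvs : Measurable fun ω => v ω ^ s := hv.measurable.pow_const _
  have hDm : ∀ k n, MeasurableSet (D k n) := fun k n => 𝓖.le n _ (hD k n)
  have hk : ∀ k, ∫⁻ ω, b k ω ^ t * v ω ^ s ∂μ ≤
      3 * B s * K ^ t * ∫⁻ ω, (if 2 ^ k < L ω then ((2 : ℝ≥0∞) ^ k) ^ t else 0) * v ω ^ s ∂μ := by
    intro k
    have hU : MeasurableSet (⋃ n, D k n) := MeasurableSet.iUnion (hDm k)
    calc ∫⁻ ω, b k ω ^ t * v ω ^ s ∂μ = ∫⁻ ω in ⋃ n, D k n, b k ω ^ t * v ω ^ s ∂μ := by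
          rw [← lintegral_indicator hU]
          refine lintegral_congr_ae ?_
          filter_upwards [hb0 k] with ω hω
          by_cases hm : ω ∈ ⋃ n, D k n
          · rw [Set.indicator_of_mem hm]
          · rw [Set.indicator_of_notMem hm, hω hm, ENNReal.zero_rpow_of_pos ht, zero_mul]
      _ = ∑' n, ∫⁻ ω in D k n, b k ω ^ t * v ω ^ s ∂μ := lintegral_iUnion (hDm k) (hdisj k) _
      _ ≤ ∑' n, 3 * B s * (K * 2 ^ k) ^ t * ∫⁻ ω in D k n, v ω ^ s ∂μ :=
          ENNReal.tsum_le_tsum fun n => hv.setLIntegral_rpow_le (hD k n) (hb k) ht htρ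
            (ENNReal.mul_ne_top ENNReal.coe_ne_top (two_zpow_ne_top k)) (h k n)
      _ = 3 * B s * (K * 2 ^ k) ^ t * ∫⁻ ω in ⋃ n, D k n, v ω ^ s ∂μ := by
          rw [ENNReal.tsum_mul_left, lintegral_iUnion (hDm k) (hdisj k)]
      _ = _ := by
          rw [ENNReal.mul_rpow_of_nonneg _ _ ht.le, ← mul_assoc, mul_assoc (_ * _) (_ ^ t) (∫⁻ _ in _, _ ∂μ),
            ← lintegral_const_mul _ hvs, ← lintegral_indicator hU]
          congr 1
          refine lintegral_congr fun ω => ?_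
          by_cases hm : ω ∈ ⋃ n, D k n
          · rw [Set.indicator_of_mem hm, if_pos (by rw [hDL k] at hm; exact hm)]
          · rw [Set.indicator_of_notMem hm, if_neg (by rw [hDL k] at hm; exact hm), zero_mul]
  have hLm : ∀ k : ℤ, MeasurableSet {ω | (2 : ℝ≥0∞) ^ k < L ω} := fun k => by
    rw [← hDL k]; exact MeasurableSet.iUnion (hDm k)
  calc ∫⁻ ω, F ω ^ t * v ω ^ s ∂μ ≤ ∫⁻ ω, ∑' k, b k ω ^ t * v ω ^ s ∂μ := by
        refine lintegral_mono_ae ?_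
        filter_upwards [hF] with ω hω
        rw [ENNReal.tsum_mul_right]
        gcongr
        exact (ENNReal.rpow_le_rpow hω ht.le).trans (tsum_rpow_le _ ht ht1)
    _ = ∑' k, ∫⁻ ω, b k ω ^ t * v ω ^ s ∂μ :=
        lintegral_tsum fun k => (((hb k).pow_const t).mul hvs).aemeasurable
    _ ≤ ∑' k : ℤ, 3 * B s * K ^ t * ∫⁻ ω, (if 2 ^ k < L ω then ((2 : ℝ≥0∞) ^ k) ^ t else 0) * v ω ^ s ∂μ :=
        ENNReal.tsum_le_tsum hk
    _ = 3 * B s * K ^ t * ∫⁻ ω, (∑' k : ℤ, if 2 ^ k < L ω then ((2 : ℝ≥0∞) ^ k) ^ t else 0) * v ω ^ s ∂μ := by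
        rw [ENNReal.tsum_mul_left, ← lintegral_tsum]
        · simp_rw [ENNReal.tsum_mul_right]
        · exact fun k => ((Measurable.ite (hLm k) measurable_const measurable_const).mul hvs).aemeasurable
    _ ≤ 3 * B s * K ^ t * ∫⁻ ω, dyadicConst t * (L ω ^ t * v ω ^ s) ∂μ := by
        refine mul_le_mul' le_rfl (lintegral_mono fun ω => ?_)
        simp only []
        rw [← mul_assoc]
        refine mul_le_mul' ?_ le_rfl
        exact tsum_dyadic_le ht _
    _ = _ := by
        rw [lintegral_const_mul' _ _ (dyadicConst_ne_top ht), ← mul_assoc]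
        push_cast
        rw [ENNReal.coe_toNNReal (dyadicConst_ne_top ht), ENNReal.coe_rpow_of_nonneg _ ht.le]

end Base

/-! ### Martingale transforms by indicators, and `L²`-bounded martingales -/

section Transform

variable {Ω 𝕜 : Type*} [RCLike 𝕜]

/-- The martingale transform `∑_{j < n} χ_{B_j} (f_{j+1} - f_j)`. -/
noncomputable def martTransform (B : ℕ → Set Ω) (f : ℕ → Ω → 𝕜) (n : ℕ) (ω : Ω) : 𝕜 :=
  ∑ j ∈ Finset.range n, (B j).indicator (fun ω => f (j + 1) ω - f j ω) ω

theorem martTransform_zero (B : ℕ → Set Ω) (f : ℕ → Ω → 𝕜) : martTransform B f 0 = 0 := by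
  ext ω; simp [martTransform]

theorem martTransform_succ (B : ℕ → Set Ω) (f : ℕ → Ω → 𝕜) (n : ℕ) (ω : Ω) :
    martTransform B f (n + 1) ω = martTransform B f n ω +
      (B n).indicator (fun ω => f (n + 1) ω - f n ω) ω := Finset.sum_range_succ _ _

theorem martTransform_succ_sub (B : ℕ → Set Ω) (f : ℕ → Ω → 𝕜) (n : ℕ) (ω : Ω) :
    martTransform B f (n + 1) ω - martTransform B f n ω =
      (B n).indicator (fun ω => f (n + 1) ω - f n ω) ω := by
  rw [martTransform_succ]; ring

theorem martTransform_inter (A B : ℕ → Set Ω) (f : ℕ → Ω → 𝕜) :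
    martTransform (fun n => A n ∩ B n) f = martTransform A (martTransform B f) := by
  ext n ω
  refine Finset.sum_congr rfl fun j _ => ?_
  simp_rw [martTransform_succ_sub]
  by_cases h1 : ω ∈ A j <;> by_cases h2 : ω ∈ B j <;> simp [h1, h2]

theorem martTransform_univ (f : ℕ → Ω → 𝕜) (n : ℕ) (ω : Ω) :
    martTransform (fun _ => Set.univ) f n ω = f n ω - f 0 ω := by
  simp only [martTransform, Set.indicator_univ]
  exact Finset.sum_range_sub (fun j => f j ω) n

theorem martTransform_add_of_disjoint {A B : ℕ → Set Ω} (h : ∀ n, Disjoint (A n) (B n))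
    (f : ℕ → Ω → 𝕜) :
    martTransform (fun n => A n ∪ B n) f = martTransform A f + martTransform B f := by
  ext n ω
  simp only [martTransform, Pi.add_apply]
  rw [← Finset.sum_add_distrib]
  refine Finset.sum_congr rfl fun j _ => ?_
  rw [Set.indicator_union_of_disjoint (h j)]

theorem martTransform_eq_zero {B : ℕ → Set Ω} (f : ℕ → Ω → 𝕜) {n : ℕ} {ω : Ω}
    (h : ∀ j < n, ω ∉ B j) : martTransform B f n ω = 0 :=
  Finset.sum_eq_zero fun j hj => Set.indicator_of_notMem (h j (Finset.mem_range.1 hj)) _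

variable {m0 : MeasurableSpace Ω} {μ : Measure Ω} {𝓖 : Filtration ℕ m0}

theorem stronglyAdapted_martTransform {B : ℕ → Set Ω} (hB : ∀ n, MeasurableSet[𝓖 n] (B n))
    {f : ℕ → Ω → 𝕜} (hf : StronglyAdapted 𝓖 f) : StronglyAdapted 𝓖 (martTransform B f) := by
  intro n
  refine Finset.stronglyMeasurable_fun_sum _ fun j hj => ?_
  have hjn : j + 1 ≤ n := Finset.mem_range.1 hj
  exact (((hf (j + 1)).mono (𝓖.mono hjn)).sub ((hf j).mono (𝓖.mono (by omega)))).indicator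
    (𝓖.mono (by omega : j ≤ n) _ (hB j))

theorem IsMart.condExp_succ_sub [IsFiniteMeasure μ] {f : ℕ → Ω → 𝕜} (hf : IsMart μ 𝓖 f) (n : ℕ) :
    μ[f (n + 1) - f n | 𝓖 n] =ᵐ[μ] 0 := by
  refine (condExp_sub (hf.1.integrable _) (hf.1.integrable _) _).trans ?_
  filter_upwards [hf.1.condExp_ae_eq (Nat.le_succ n), hf.1.condExp_ae_eq (le_refl n)] with ω h1 h2
  rw [Pi.sub_apply, h1, h2, sub_self]; rfl

theorem IsMart.martTransform [IsFiniteMeasure μ] {B : ℕ → Set Ω}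
    (hB : ∀ n, MeasurableSet[𝓖 n] (B n)) {f : ℕ → Ω → 𝕜} (hf : IsMart μ 𝓖 f) :
    IsMart μ 𝓖 (martTransform B f) := by
  have hd : ∀ n, Integrable (f (n + 1) - f n) μ :=
    fun n => (hf.1.integrable _).sub (hf.1.integrable _)
  refine ⟨martingale_of_condExp_sub_eq_zero_nat (stronglyAdapted_martTransform hB hf.1.stronglyAdapted)
    (fun n => ?_) fun n => ?_, ?_⟩
  · exact integrable_finsetSum _ fun j _ => (hd j).indicator (𝓖.le j _ (hB j))
  · have : _root_.martTransform B f (n + 1) - _root_.martTransform B f n =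
        (B n).indicator (f (n + 1) - f n) := by
      ext ω; exact martTransform_succ_sub B f n ω
    rw [this]
    refine (condExp_indicator (hd n) (hB n)).trans ?_
    filter_upwards [hf.condExp_succ_sub n] with ω hω
    by_cases h : ω ∈ B n <;> simp [h, hω]
  · rw [martTransform_zero]

theorem IsMart.add {f g : ℕ → Ω → 𝕜} (hf : IsMart μ 𝓖 f) (hg : IsMart μ 𝓖 g) : IsMart μ 𝓖 (f + g) := by
  refine ⟨hf.1.add hg.1, ?_⟩
  filter_upwards [hf.2, hg.2] with ω h1 h2
  simp [h1, h2]

theorem IsMart.const_smul {f : ℕ → Ω → 𝕜} (c : 𝕜) (hf : IsMart μ 𝓖 f) : IsMart μ 𝓖 (c • f) := by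
  refine ⟨⟨fun n => (hf.1.stronglyMeasurable n).const_smul c, fun i j hij => ?_⟩, ?_⟩
  · refine (condExp_smul c (f j) (𝓖 i)).trans ?_
    filter_upwards [hf.1.condExp_ae_eq hij] with ω hω
    simp [hω]
  · filter_upwards [hf.2] with ω h1
    simp [h1]

end Transform

/-! ### Orthogonality of increments and limits of `L²`-bounded martingales -/

section SquareIntegrable

variable {Ω 𝕜 : Type*} [RCLike 𝕜]

section

variable {m m0 : MeasurableSpace Ω} {μ : Measure Ω}

theorem lintegral_enorm_sq_eq {u : Ω → 𝕜} (hu : MemLp u 2 μ) :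
    ∫⁻ ω, ‖u ω‖ₑ ^ 2 ∂μ = ENNReal.ofReal (∫ ω, ‖u ω‖ ^ 2 ∂μ) := by
  rw [ofReal_integral_eq_lintegral_ofReal]
  · refine lintegral_congr fun ω => ?_
    rw [ENNReal.ofReal_pow (norm_nonneg _), ofReal_norm]
  · exact (memLp_two_iff_integrable_sq_norm hu.1).1 hu
  · exact Eventually.of_forall fun ω => by positivity

theorem memLp_two_of_lintegral {u : Ω → 𝕜} (hu : AEStronglyMeasurable u μ)
    (h : ∫⁻ ω, ‖u ω‖ₑ ^ 2 ∂μ ≠ ∞) : MemLp u 2 μ := by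
  refine ⟨hu, ?_⟩
  rw [eLpNorm_lt_top_iff_lintegral_rpow_enorm_lt_top (by norm_num) (by norm_num)]
  simpa using h.lt_top

/-- Conditional orthogonality. -/
theorem lintegral_enorm_add_sq_eq [IsFiniteMeasure μ] (hm : m ≤ m0) {u d : Ω → 𝕜}
    (hum : StronglyMeasurable[m] u) (hu : MemLp u 2 μ) (hd : MemLp d 2 μ) (h : μ[d | m] =ᵐ[μ] 0) :
    ∫⁻ ω, ‖u ω + d ω‖ₑ ^ 2 ∂μ = ∫⁻ ω, ‖u ω‖ₑ ^ 2 ∂μ + ∫⁻ ω, ‖d ω‖ₑ ^ 2 ∂μ := by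
  have hu2 := (memLp_two_iff_integrable_sq_norm hu.1).1 hu
  have hd2 := (memLp_two_iff_integrable_sq_norm hd.1).1 hd
  have hcu : MemLp (fun ω => (starRingEnd 𝕜) (u ω)) 2 μ := hu.star
  have hcm : StronglyMeasurable[m] fun ω => (starRingEnd 𝕜) (u ω) :=
    RCLike.continuous_conj.comp_stronglyMeasurable hum
  have hint : Integrable (fun ω => (starRingEnd 𝕜) (u ω) * d ω) μ := hcu.integrable_mul hd
  -- Conditioning on `m` takes `u` out of the cross term and leaves the vanishing conditional mean
  -- of `d`.
  have hzero : ∫ ω, (starRingEnd 𝕜) (u ω) * d ω ∂μ = 0 := by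
    rw [← integral_condExp hm]
    have := condExp_bilin_of_stronglyMeasurable_left (m := m) (μ := μ) (ContinuousLinearMap.mul ℝ 𝕜)
      hcm hint (hd.integrable (by norm_num))
    rw [integral_congr_ae (g := fun _ => (0 : 𝕜)), integral_zero]
    filter_upwards [this, h] with ω h1 h2
    refine h1.trans ?_
    simp [h2]
  have hre : ∫ ω, RCLike.re ((starRingEnd 𝕜) (u ω) * d ω) ∂μ = 0 :=
    (integral_re hint).trans (by rw [hzero]; simp)
  have hsum := hu.add hd
  rw [lintegral_enorm_sq_eq (u := fun ω => u ω + d ω) hsum, lintegral_enorm_sq_eq hu,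
    lintegral_enorm_sq_eq hd, ← ENNReal.ofReal_add (by positivity) (by positivity)]
  congr 1
  have e : ∀ ω, ‖u ω + d ω‖ ^ 2 = ‖u ω‖ ^ 2 + ‖d ω‖ ^ 2 +
      2 * RCLike.re ((starRingEnd 𝕜) (u ω) * d ω) := by
    intro ω
    have := norm_add_sq (𝕜 := 𝕜) (u ω) (d ω)
    rw [this, RCLike.inner_apply']
    ring
  simp_rw [e]
  rw [integral_add (f := fun ω => ‖u ω‖ ^ 2 + ‖d ω‖ ^ 2) (hu2.add hd2) (hint.re.const_mul 2),
    integral_add hu2 hd2, integral_const_mul, hre]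
  ring

end

variable {m0 : MeasurableSpace Ω} {μ : Measure Ω} {𝓖 : Filtration ℕ m0}

theorem Martingale.comp_clm {E F : Type*} [NormedAddCommGroup E] [NormedSpace ℝ E] [CompleteSpace E]
    [NormedAddCommGroup F] [NormedSpace ℝ F] [CompleteSpace F] {f : ℕ → Ω → E} (hf : Martingale f 𝓖 μ)
    (T : E →L[ℝ] F) : Martingale (fun n ω => T (f n ω)) 𝓖 μ := by
  refine ⟨fun n => T.continuous.comp_stronglyMeasurable (hf.stronglyMeasurable n), fun i j hij => ?_⟩
  refine (T.comp_condExp_comm (hf.integrable j)).symm.trans ?_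
  filter_upwards [hf.condExp_ae_eq hij] with ω hω
  simp [hω]

variable [IsFiniteMeasure μ]

theorem IsMart.lintegral_enorm_sq_le {f : ℕ → Ω → 𝕜} (hf : IsMart μ 𝓖 f)
    (h : ∀ n, ∫⁻ ω, ‖f (n + 1) ω - f n ω‖ₑ ^ 2 ∂μ ≠ ∞) (n : ℕ) :
    ∫⁻ ω, ‖f n ω‖ₑ ^ 2 ∂μ = ∑ j ∈ Finset.range n, ∫⁻ ω, ‖f (j + 1) ω - f j ω‖ₑ ^ 2 ∂μ := by
  have hd : ∀ n, MemLp (f (n + 1) - f n) 2 μ := fun n => memLp_two_of_lintegral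
    ((hf.1.integrable (n + 1)).sub (hf.1.integrable n)).aestronglyMeasurable (h n)
  have hL : ∀ n, MemLp (f n) 2 μ := by
    intro n
    induction n with
    | zero => exact (memLp_congr_ae hf.2).2 MemLp.zero
    | succ n ih =>
      have := ih.add (hd n)
      rwa [add_sub_cancel] at this
  induction n with
  | zero =>
    rw [Finset.sum_range_zero, lintegral_congr_ae (g := fun _ => 0), lintegral_zero]
    filter_upwards [hf.2] with ω hω
    simp [hω]
  | succ n ih =>
    rw [Finset.sum_range_succ, ← ih]
    have := lintegral_enorm_add_sq_eq (𝓖.le n) (hf.1.stronglyMeasurable n) (hL n) (hd n)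
      (hf.condExp_succ_sub n)
    simpa using this

/-- On `{|h_n| ≥ C}` one has `|h_n| ≤ |h_n|² / C`, so the tails are at most `R / C`. -/
theorem uniformIntegrable_of_lintegral_sq_le {h : ℕ → Ω → ℝ} (hm : ∀ n, AEStronglyMeasurable (h n) μ)
    {R : ℝ≥0∞} (hR : R ≠ ∞) (hb : ∀ n, ∫⁻ ω, ‖h n ω‖ₑ ^ 2 ∂μ ≤ R) : UniformIntegrable h 1 μ := by
  refine uniformIntegrable_of le_rfl (by simp) hm fun ε hε => ?_
  lift R to ℝ≥0 using hR
  refine ⟨R / ε.toNNReal + 1, fun n => ?_⟩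
  set C : ℝ≥0 := R / ε.toNNReal + 1 with hC
  have hε' : 0 < ε.toNNReal := Real.toNNReal_pos.2 hε
  have hC0 : 0 < C := by positivity
  rw [eLpNorm_one_eq_lintegral_enorm]
  have key : ∀ ω, ‖{x | C ≤ ‖h n x‖₊}.indicator (h n) ω‖ₑ ≤ (C : ℝ≥0∞)⁻¹ * ‖h n ω‖ₑ ^ 2 := by
    intro ω
    by_cases hω : ω ∈ {x | C ≤ ‖h n x‖₊}
    · rw [Set.indicator_of_mem hω]
      have h1 : (C : ℝ≥0∞) ≤ ‖h n ω‖ₑ := by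
        rw [enorm_eq_nnnorm]; exact ENNReal.coe_le_coe.2 hω
      calc ‖h n ω‖ₑ = (C : ℝ≥0∞)⁻¹ * (C * ‖h n ω‖ₑ) := by
            rw [← mul_assoc, ENNReal.inv_mul_cancel (by simpa using hC0.ne') (by simp), one_mul]
        _ ≤ _ := by rw [sq]; gcongr
    · rw [Set.indicator_of_notMem hω]; simp
  calc ∫⁻ ω, ‖{x | C ≤ ‖h n x‖₊}.indicator (h n) ω‖ₑ ∂μ
      ≤ ∫⁻ ω, (C : ℝ≥0∞)⁻¹ * ‖h n ω‖ₑ ^ 2 ∂μ := lintegral_mono key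
    _ = (C : ℝ≥0∞)⁻¹ * ∫⁻ ω, ‖h n ω‖ₑ ^ 2 ∂μ :=
        lintegral_const_mul' _ _ (ENNReal.inv_ne_top.2 (by simpa using hC0.ne'))
    _ ≤ (C : ℝ≥0∞)⁻¹ * R := by gcongr; exact hb n
    _ ≤ ENNReal.ofReal ε := by
        rw [mul_comm, ← div_eq_mul_inv]
        refine ENNReal.div_le_of_le_mul ?_
        rw [ENNReal.ofReal, ← ENNReal.coe_mul, ENNReal.coe_le_coe, hC, mul_add,
          mul_div_cancel₀ _ hε'.ne']
        exact le_self_add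

theorem Martingale.exists_limit_of_lintegral_sq_le_real {h : ℕ → Ω → ℝ} (hh : Martingale h 𝓖 μ)
    {R : ℝ≥0∞} (hR : R ≠ ∞) (hb : ∀ n, ∫⁻ ω, ‖h n ω‖ₑ ^ 2 ∂μ ≤ R) :
    ∃ a : Ω → ℝ, Integrable a μ ∧ (∀ n, μ[a | 𝓖 n] =ᵐ[μ] h n) ∧
      ∀ᵐ ω ∂μ, Tendsto (fun n => h n ω) atTop (𝓝 (a ω)) := by
  have hUI := uniformIntegrable_of_lintegral_sq_le (fun n => (hh.integrable n).1) hR hb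
  obtain ⟨R', hR'⟩ := hUI.2.2
  exact ⟨_,
    (Filtration.memLp_limitProcess_of_eLpNorm_bdd hUI.1 hR').integrable le_rfl,
    fun n => (hh.ae_eq_condExp_limitProcess hUI n).symm, hh.submartingale.ae_tendsto_limitProcess hR'⟩

theorem Martingale.exists_limit_of_lintegral_sq_le {f : ℕ → Ω → 𝕜} (hf : Martingale f 𝓖 μ)
    {R : ℝ≥0∞} (hR : R ≠ ∞) (hb : ∀ n, ∫⁻ ω, ‖f n ω‖ₑ ^ 2 ∂μ ≤ R) :
    ∃ a : Ω → 𝕜, Integrable a μ ∧ (∀ n, μ[a | 𝓖 n] =ᵐ[μ] f n) ∧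
      ∀ᵐ ω ∂μ, Tendsto (fun n => f n ω) atTop (𝓝 (a ω)) := by
  obtain ⟨a, ha, hae, hat⟩ := Martingale.exists_limit_of_lintegral_sq_le_real
    (Martingale.comp_clm hf RCLike.reCLM) hR fun n => (lintegral_mono fun ω => by
      gcongr
      rw [enorm_le_iff_norm_le]
      exact RCLike.norm_re_le_norm _).trans (hb n)
  obtain ⟨b, hbi, hbe, hbt⟩ := Martingale.exists_limit_of_lintegral_sq_le_real
    (Martingale.comp_clm hf RCLike.imCLM) hR fun n => (lintegral_mono fun ω => by
      gcongr
      rw [enorm_le_iff_norm_le]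
      exact RCLike.norm_im_le_norm _).trans (hb n)
  -- Multiplication of a real number by the scalar `z`, as a continuous linear map: it commutes with
  -- conditional expectations, so limits of the real and imaginary parts can be recombined.
  set T : 𝕜 → ℝ →L[ℝ] 𝕜 := fun z => ContinuousLinearMap.toSpanSingleton ℝ z with hT
  have hz : ∀ z : 𝕜, T 1 (RCLike.re z) + T RCLike.I (RCLike.im z) = z := by
    intro z
    simp only [hT, ContinuousLinearMap.toSpanSingleton_apply]
    rw [RCLike.real_smul_eq_coe_mul, RCLike.real_smul_eq_coe_mul, mul_one]
    exact RCLike.re_add_im z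
  refine ⟨(T 1 ∘ a) + (T RCLike.I ∘ b), ((T 1).integrable_comp ha).add
    ((T RCLike.I).integrable_comp hbi), fun n => ?_, ?_⟩
  · refine (condExp_add ((T 1).integrable_comp ha) ((T RCLike.I).integrable_comp hbi) _).trans ?_
    filter_upwards [(T 1).comp_condExp_comm (m := 𝓖 n) ha,
      (T RCLike.I).comp_condExp_comm (m := 𝓖 n) hbi, hae n, hbe n] with ω h1 h2 h3 h4
    refine (congrArg₂ (· + ·) h1.symm h2.symm).trans ?_
    simp only [Function.comp_apply, h3, h4]
    exact hz _
  · filter_upwards [hat, hbt] with ω h1 h2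
    have := (((T 1).continuous.tendsto _).comp h1).add (((T RCLike.I).continuous.tendsto _).comp h2)
    refine this.congr fun n => ?_
    exact hz _

end SquareIntegrable

/-! ### Gauges of a martingale: the processes controlled by `λ` -/

section Gauge

variable {Ω 𝕜 : Type*} [RCLike 𝕜] {m0 : MeasurableSpace Ω}

/-- The properties shared by the processes `(∑_{k ≤ n + 1} 𝔼_{k-1} |f_k - f_{k-1}|²)^{1/2}`,
`S_{n+1}(f)` and `sup_{k ≤ n+1} |f_k|`. -/
structure IsGauge (μ : Measure Ω) (𝓖 : Filtration ℕ m0)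
    (E : (ℕ → Ω → 𝕜) → ℕ → Ω → ℝ≥0∞) : Prop where
  congr : ∀ {f g : ℕ → Ω → 𝕜}, (∀ n, f n =ᵐ[μ] g n) → ∀ n, E f n =ᵐ[μ] E g n
  add_le : ∀ {f g : ℕ → Ω → 𝕜}, StronglyAdapted 𝓖 f → StronglyAdapted 𝓖 g →
    ∀ n, ∀ᵐ ω ∂μ, E (f + g) n ω ≤ 2 * (E f n ω + E g n ω)
  smul_le : ∀ {f : ℕ → Ω → 𝕜} (c : 𝕜), StronglyAdapted 𝓖 f →
    ∀ n, ∀ᵐ ω ∂μ, E (c • f) n ω ≤ ‖c‖ₑ * E f n ω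
  -- For `V n = {n < τ}` the transform is the martingale stopped at `τ`. As index `n` covers times
  -- up to `n + 1`, a bound before stopping also covers the last jump.
  transform_antitone : ∀ {f : ℕ → Ω → 𝕜}, IsMart μ 𝓖 f → ∀ {V : ℕ → Set Ω},
    (∀ n, MeasurableSet[𝓖 n] (V n)) → Antitone V → ∀ {φ : ℕ → Ω → ℝ≥0∞},
    (∀ ω, Monotone fun n => φ n ω) → (∀ n, ∀ᵐ ω ∂μ, ω ∈ V n → E f n ω ≤ φ n ω) →
    ∀ n, ∀ᵐ ω ∂μ, E (martTransform V f) n ω ≤ φ n ω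
  -- For `U n = {τ ≤ n}` the transform is the martingale started at `τ`; the factor `2` is what the
  -- maximal function needs.
  transform_monotone : ∀ {f : ℕ → Ω → 𝕜}, IsMart μ 𝓖 f → ∀ {U : ℕ → Set Ω},
    (∀ n, MeasurableSet[𝓖 n] (U n)) → Monotone U →
    ∀ n, ∀ᵐ ω ∂μ, E (martTransform U f) n ω ≤ (U n).indicator (fun ω => 2 * E f n ω) ω
  lintegral_sq_le : ∀ {f : ℕ → Ω → 𝕜}, IsMart μ 𝓖 f → ∀ {c : ℝ≥0∞}, c ≠ ∞ →
    (∀ n, ∀ᵐ ω ∂μ, E f n ω ≤ c) → ∀ n, ∫⁻ ω, ‖f n ω‖ₑ ^ 2 ∂μ ≤ c ^ 2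

theorem ENNReal.add_sq_le (a b : ℝ≥0∞) : (a + b) ^ 2 ≤ 2 * (a ^ 2 + b ^ 2) := by
  have := ENNReal.rpow_add_le_mul_rpow_add_rpow a b (p := 2) (by norm_num)
  simpa [show (2 : ℝ) - 1 = 1 by norm_num] using this

theorem ENNReal.sqrt_two_mul_add_le (a b : ℝ≥0∞) :
    (2 * (a + b)) ^ (1 / 2 : ℝ) ≤ 2 * (a ^ (1 / 2 : ℝ) + b ^ (1 / 2 : ℝ)) := by
  rw [ENNReal.mul_rpow_of_nonneg _ _ (by norm_num)]
  gcongr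
  · calc (2 : ℝ≥0∞) ^ (1 / 2 : ℝ) ≤ 2 ^ (1 : ℝ) :=
        ENNReal.rpow_le_rpow_of_exponent_le (by norm_num) (by norm_num)
      _ = 2 := ENNReal.rpow_one 2
  · exact ENNReal.rpow_add_le_add_rpow _ _ (by norm_num) (by norm_num)

theorem ENNReal.sqrt_sq (a : ℝ≥0∞) : (a ^ 2) ^ (1 / 2 : ℝ) = a := by
  rw [← ENNReal.rpow_natCast, ← ENNReal.rpow_mul]; norm_num

theorem ENNReal.sq_sqrt (a : ℝ≥0∞) : (a ^ (1 / 2 : ℝ)) ^ 2 = a := by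
  rw [← ENNReal.rpow_natCast, ← ENNReal.rpow_mul]; norm_num

variable {μ : Measure Ω} [IsProbabilityMeasure μ] {𝓖 : Filtration ℕ m0}

/-- Covers `s` and `S`: the gauge is the square root of a sum of increments, and a transform by `B`
multiplies the increment of index `n` by the indicator of `B n`. The `L²` bound comes from
orthogonality. -/
theorem isGauge_of_additive {e : (ℕ → Ω → 𝕜) → ℕ → Ω → ℝ≥0∞}
    (congr : ∀ {f g : ℕ → Ω → 𝕜}, (∀ n, f n =ᵐ[μ] g n) → ∀ n, e f n =ᵐ[μ] e g n)
    (add_le : ∀ {f g : ℕ → Ω → 𝕜}, StronglyAdapted 𝓖 f → StronglyAdapted 𝓖 g →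
      ∀ n, ∀ᵐ ω ∂μ, e (f + g) n ω ≤ 2 * (e f n ω + e g n ω))
    (smul : ∀ {f : ℕ → Ω → 𝕜} (c : 𝕜), StronglyAdapted 𝓖 f →
      ∀ n, ∀ᵐ ω ∂μ, e (c • f) n ω = ‖c‖ₑ ^ 2 * e f n ω)
    (transform : ∀ {f : ℕ → Ω → 𝕜}, StronglyAdapted 𝓖 f → ∀ {B : ℕ → Set Ω},
      (∀ n, MeasurableSet[𝓖 n] (B n)) → ∀ n, ∀ᵐ ω ∂μ,
        e (martTransform B f) n ω = (B n).indicator (e f n) ω)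
    (lintegral_le : ∀ {f : ℕ → Ω → 𝕜}, StronglyAdapted 𝓖 f →
      ∀ n, ∫⁻ ω, ‖f (n + 1) ω - f n ω‖ₑ ^ 2 ∂μ ≤ ∫⁻ ω, e f n ω ∂μ)
    (measurable : ∀ {f : ℕ → Ω → 𝕜}, StronglyAdapted 𝓖 f → ∀ n, Measurable (e f n)) :
    IsGauge μ 𝓖 fun (f : ℕ → Ω → 𝕜) n ω => (∑ j ∈ Finset.range (n + 1), e f j ω) ^ (1 / 2 : ℝ) where
  congr h n := by
    filter_upwards [ae_all_iff.2 (congr h)] with ω hω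
    simp [hω]
  add_le hf hg n := by
    filter_upwards [ae_all_iff.2 (add_le hf hg)] with ω hω
    refine le_trans ?_ (ENNReal.sqrt_two_mul_add_le _ _)
    refine ENNReal.rpow_le_rpow ?_ (by norm_num)
    rw [← Finset.sum_add_distrib, Finset.mul_sum]
    exact Finset.sum_le_sum fun j _ => hω j
  smul_le c hf n := by
    filter_upwards [ae_all_iff.2 (smul c hf)] with ω hω
    simp only [hω]
    rw [← Finset.mul_sum, ENNReal.mul_rpow_of_nonneg _ _ (by norm_num), ENNReal.sqrt_sq]
  transform_antitone {f} hf {V} hV hVa {φ} hφ h n := by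
    filter_upwards [ae_all_iff.2 (transform hf.1.stronglyAdapted hV), ae_all_iff.2 h] with ω h1 h2
    simp only [h1]
    induction n with
    | zero =>
      by_cases hω : ω ∈ V 0
      · simpa [hω] using h2 0 hω
      · simp [hω]
    | succ n ih =>
      by_cases hω : ω ∈ V (n + 1)
      · refine le_trans (le_of_eq ?_) (h2 (n + 1) hω)
        congr 1
        refine Finset.sum_congr rfl fun j hj => ?_
        rw [Set.indicator_of_mem (hVa (Nat.lt_succ_iff.1 (Finset.mem_range.1 hj)) hω)]
      · rw [Finset.sum_range_succ, Set.indicator_of_notMem hω, add_zero]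
        exact ih.trans (hφ ω (Nat.le_succ n))
  transform_monotone {f} hf {U} hU hUm n := by
    filter_upwards [ae_all_iff.2 (transform hf.1.stronglyAdapted hU)] with ω h1
    simp only [h1]
    by_cases hω : ω ∈ U n
    · rw [Set.indicator_of_mem hω]
      refine le_trans (ENNReal.rpow_le_rpow (Finset.sum_le_sum fun j _ =>
        Set.indicator_le_self' (fun _ _ => zero_le) ω) (by norm_num)) ?_
      exact le_mul_of_one_le_left zero_le (by norm_num)
    · rw [Finset.sum_eq_zero fun j hj => Set.indicator_of_notMem (fun hj' => hω
        (hUm (Nat.lt_succ_iff.1 (Finset.mem_range.1 hj)) hj')) _]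
      simp
  lintegral_sq_le {f} hf {c} hc h n := by
    have hsum : ∀ n, ∑ j ∈ Finset.range n, ∫⁻ ω, e f j ω ∂μ ≤ c ^ 2 := by
      intro n
      rw [← lintegral_finsetSum _ fun j _ => measurable hf.1.stronglyAdapted j]
      calc ∫⁻ ω, ∑ j ∈ Finset.range n, e f j ω ∂μ ≤ ∫⁻ _, c ^ 2 ∂μ := by
            refine lintegral_mono_ae ?_
            filter_upwards [h n] with ω hω
            rw [← ENNReal.sq_sqrt (∑ j ∈ Finset.range n, e f j ω)]
            gcongr
            refine le_trans (ENNReal.rpow_le_rpow ?_ (by norm_num)) hω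
            exact Finset.sum_le_sum_of_subset (Finset.range_mono (Nat.le_succ n))
        _ = c ^ 2 := by simp
    have hle := lintegral_le hf.1.stronglyAdapted
    rw [hf.lintegral_enorm_sq_le fun n => ?_]
    · exact (Finset.sum_le_sum fun j _ => hle j).trans (hsum n)
    · refine ne_top_of_le_ne_top (ENNReal.pow_ne_top hc (n := 2)) ((hle n).trans ?_)
      exact le_trans (Finset.single_le_sum (f := fun j => ∫⁻ ω, e f j ω ∂μ)
        (fun _ _ => zero_le) (Finset.self_mem_range_succ n)) (hsum (n + 1))

theorem enorm_sq_add_le (a b : 𝕜) : ‖a + b‖ₑ ^ 2 ≤ 2 * (‖a‖ₑ ^ 2 + ‖b‖ₑ ^ 2) :=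
  (pow_le_pow_left₀ zero_le (enorm_add_le a b) 2).trans (ENNReal.add_sq_le _ _)

theorem diff_add (f g : ℕ → Ω → 𝕜) (n : ℕ) (ω : Ω) :
    (f + g) (n + 1) ω - (f + g) n ω = (f (n + 1) ω - f n ω) + (g (n + 1) ω - g n ω) := by
  simp only [Pi.add_apply]; ring

theorem diff_smul (c : 𝕜) (f : ℕ → Ω → 𝕜) (n : ℕ) (ω : Ω) :
    (c • f) (n + 1) ω - (c • f) n ω = c * (f (n + 1) ω - f n ω) := by
  simp only [Pi.smul_apply, smul_eq_mul]; ring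

theorem measurable_enorm_diff_sq {f : ℕ → Ω → 𝕜} (hf : StronglyAdapted 𝓖 f) (n : ℕ) :
    Measurable fun ω => ‖f (n + 1) ω - f n ω‖ₑ ^ 2 :=
  have hm : ∀ n, Measurable (f n) := fun n =>
    StronglyMeasurable.measurable (β := 𝕜) ((hf n).mono (𝓖.le n))
  have h : Measurable fun ω => f (n + 1) ω - f n ω := (hm (n + 1)).sub (hm n)
  h.enorm.pow_const 2

theorem enorm_martTransform_diff_sq (B : ℕ → Set Ω) (f : ℕ → Ω → 𝕜) (n : ℕ) :
    (fun ω => ‖martTransform B f (n + 1) ω - martTransform B f n ω‖ₑ ^ 2) =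
      (B n).indicator fun ω => ‖f (n + 1) ω - f n ω‖ₑ ^ 2 := by
  ext ω
  rw [martTransform_succ_sub]
  by_cases h : ω ∈ B n <;> simp [h]

theorem isGauge_quadVarUpTo :
    IsGauge μ 𝓖 fun (f : ℕ → Ω → 𝕜) n ω => quadVarUpTo f (n + 1) ω := by
  refine isGauge_of_additive (e := fun f n ω => ‖f (n + 1) ω - f n ω‖ₑ ^ 2) ?_ ?_ ?_ ?_ ?_ ?_
  · intro f g h n
    filter_upwards [h n, h (n + 1)] with ω h1 h2
    rw [h1, h2]
  · intro f g _ _ n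
    refine Eventually.of_forall fun ω => ?_
    rw [diff_add]
    exact enorm_sq_add_le _ _
  · intro f c _ n
    refine Eventually.of_forall fun ω => ?_
    rw [diff_smul, enorm_mul, mul_pow]
  · intro f _ B _ n
    exact Eventually.of_forall fun ω => congrFun (enorm_martTransform_diff_sq B f n) ω
  · exact fun _ n => le_rfl
  · exact fun hf n => measurable_enorm_diff_sq hf n

/-- `(∑_{k ≤ n + 1} 𝔼_{k-1} |f_k - f_{k-1}|²)^{1/2}`. -/
noncomputable def condQuadVarUpTo (μ : Measure Ω) (𝓖 : Filtration ℕ m0) (f : ℕ → Ω → 𝕜) (n : ℕ)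
    (ω : Ω) : ℝ≥0∞ :=
  (∑ j ∈ Finset.range (n + 1),
    condLExp (𝓖 j) μ (fun x => ‖f (j + 1) x - f j x‖ₑ ^ 2) ω) ^ (1 / 2 : ℝ)

theorem isGauge_condQuadVarUpTo :
    IsGauge μ 𝓖 (condQuadVarUpTo μ 𝓖 : (ℕ → Ω → 𝕜) → ℕ → Ω → ℝ≥0∞) := by
  refine isGauge_of_additive
    (e := fun f n => condLExp (𝓖 n) μ (fun x => ‖f (n + 1) x - f n x‖ₑ ^ 2)) ?_ ?_ ?_ ?_ ?_ ?_
  · intro f g h n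
    refine condLExp_congr_ae ?_
    filter_upwards [h n, h (n + 1)] with ω h1 h2
    rw [h1, h2]
  · intro f g hf hg n
    have h1 := condLExp_mono (P := μ) (mΩ := 𝓖 n)
      (X := fun x => ‖(f + g) (n + 1) x - (f + g) n x‖ₑ ^ 2)
      (Y := fun x => 2 * (‖f (n + 1) x - f n x‖ₑ ^ 2 + ‖g (n + 1) x - g n x‖ₑ ^ 2))
      (Eventually.of_forall fun x => by
        simp only []
        rw [diff_add]
        exact enorm_sq_add_le _ _)
    have hfm := measurable_enorm_diff_sq hf n
    have hgm := measurable_enorm_diff_sq hg n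
    filter_upwards [h1, condLExp_const_mul (m := 𝓖 n) (μ := μ) (hfm.add hgm) 2,
      condLExp_add_left (P := μ) (mΩ := 𝓖 n) (X := fun x => ‖f (n + 1) x - f n x‖ₑ ^ 2)
        (fun x => ‖g (n + 1) x - g n x‖ₑ ^ 2) hfm.aemeasurable] with ω a1 a2 a3
    refine a1.trans (a2.le.trans ?_)
    refine mul_le_mul' le_rfl ?_
    exact a3.le
  · intro f c hf n
    have : (fun x => ‖(c • f) (n + 1) x - (c • f) n x‖ₑ ^ 2) =
        fun x => ‖c‖ₑ ^ 2 * ‖f (n + 1) x - f n x‖ₑ ^ 2 := by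
      ext x; rw [diff_smul, enorm_mul, mul_pow]
    rw [this]
    exact condLExp_const_mul (measurable_enorm_diff_sq hf n) _
  · intro f hf B hB n
    rw [enorm_martTransform_diff_sq]
    exact condLExp_indicator' (𝓖.le n) (hB n) (measurable_enorm_diff_sq hf n)
  · exact fun _ n => (lintegral_condLExp (𝓖.le n) μ _).ge
  · exact fun _ n => measurable_condLExp' _ _ _

/-- `sup_{k ≤ n + 1} |f_k|`. -/
noncomputable def maxUpTo (f : ℕ → Ω → 𝕜) (n : ℕ) (ω : Ω) : ℝ≥0∞ :=
  (Finset.range (n + 2)).sup fun m => ‖f m ω‖ₑ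

theorem enorm_le_maxUpTo (f : ℕ → Ω → 𝕜) {m n : ℕ} (h : m ≤ n + 1) (ω : Ω) :
    ‖f m ω‖ₑ ≤ maxUpTo f n ω :=
  Finset.le_sup (f := fun m => ‖f m ω‖ₑ) (Finset.mem_range.2 (by omega))

theorem maxUpTo_le {f : ℕ → Ω → 𝕜} {n : ℕ} {ω : Ω} {c : ℝ≥0∞} (h : ∀ m ≤ n + 1, ‖f m ω‖ₑ ≤ c) :
    maxUpTo f n ω ≤ c :=
  Finset.sup_le fun m hm => h m (by have := Finset.mem_range.1 hm; omega)

/-- A stopped martingale takes a value of `f` at a time `j + 1` such that stopping had not occurred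
at time `j`. -/
theorem exists_martTransform_eq_of_antitone (f : ℕ → Ω → 𝕜) {V : ℕ → Set Ω} (hV : Antitone V)
    (ω : Ω) (n : ℕ) : martTransform V f n ω = 0 ∨
      ∃ j < n, ω ∈ V j ∧ martTransform V f n ω = f (j + 1) ω - f 0 ω := by
  -- The induction must also record whether `ω` has already left the sets `V`, for then the
  -- transform stays frozen.
  suffices h : (martTransform V f n ω = 0 ∧ n = 0) ∨ (martTransform V f n ω = 0 ∧ ω ∉ V (n - 1)) ∨
      ∃ j < n, ω ∈ V j ∧ (j + 1 < n → ω ∉ V (n - 1)) ∧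
        martTransform V f n ω = f (j + 1) ω - f 0 ω by
    rcases h with h | h | ⟨j, h1, h2, -, h3⟩
    · exact Or.inl h.1
    · exact Or.inl h.1
    · exact Or.inr ⟨j, h1, h2, h3⟩
  induction n with
  | zero => simp [martTransform_zero]
  | succ n ih =>
    by_cases hω : ω ∈ V n
    · have hω' : ω ∈ V (n - 1) := hV (Nat.sub_le n 1) hω
      refine Or.inr (Or.inr ⟨n, Nat.lt_succ_self n, hω, by simp, ?_⟩)
      rw [martTransform_succ, Set.indicator_of_mem hω]
      rcases ih with ⟨h, rfl⟩ | ⟨h, h'⟩ | ⟨j, h1, h2, h3, h4⟩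
      · rw [h]; simp
      · exact absurd hω' h'
      · have : j + 1 = n := by
          by_contra hne
          exact h3 (by omega) hω'
        rw [h4, this]; ring
    · rw [martTransform_succ, Set.indicator_of_notMem hω, add_zero]
      rcases ih with ⟨h, h'⟩ | ⟨h, h'⟩ | ⟨j, h1, h2, h3, h4⟩
      · exact Or.inr (Or.inl ⟨h, hω⟩)
      · exact Or.inr (Or.inl ⟨h, hω⟩)
      · exact Or.inr (Or.inr ⟨j, by omega, h2, fun _ => hω, h4⟩)

/-- Once `ω` has entered the sets `U`, every later increment is counted; `i` is the entry time, or
`n` before entry. -/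
theorem exists_martTransform_eq_of_monotone (f : ℕ → Ω → 𝕜) {U : ℕ → Set Ω} (hU : Monotone U)
    (ω : Ω) (n : ℕ) : ∃ i ≤ n, martTransform U f n ω = f n ω - f i ω := by
  suffices h : ∃ i ≤ n, martTransform U f n ω = f n ω - f i ω ∧ (ω ∉ U (n - 1) → i = n) by
    obtain ⟨i, h1, h2, -⟩ := h
    exact ⟨i, h1, h2⟩
  induction n with
  | zero => exact ⟨0, le_rfl, by simp [martTransform_zero], fun _ => rfl⟩
  | succ n ih =>
    obtain ⟨i, h1, h2, h3⟩ := ih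
    by_cases hω : ω ∈ U n
    · refine ⟨i, by omega, ?_, fun h => absurd hω h⟩
      rw [martTransform_succ, Set.indicator_of_mem hω, h2]; ring
    · refine ⟨n + 1, le_rfl, ?_, fun _ => rfl⟩
      have : i = n := h3 fun h => hω (hU (Nat.sub_le n 1) h)
      rw [martTransform_succ, Set.indicator_of_notMem hω, h2, this]; ring

theorem isGauge_maxUpTo : IsGauge μ 𝓖 (maxUpTo : (ℕ → Ω → 𝕜) → ℕ → Ω → ℝ≥0∞) where
  congr h n := by
    filter_upwards [ae_all_iff.2 h] with ω hω
    simp [maxUpTo, hω]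
  add_le {f g} _ _ n := Eventually.of_forall fun ω => by
    refine maxUpTo_le fun m hm => ?_
    calc ‖(f + g) m ω‖ₑ ≤ ‖f m ω‖ₑ + ‖g m ω‖ₑ := enorm_add_le _ _
      _ ≤ maxUpTo f n ω + maxUpTo g n ω :=
          add_le_add (enorm_le_maxUpTo f hm ω) (enorm_le_maxUpTo g hm ω)
      _ ≤ _ := le_mul_of_one_le_left zero_le (by norm_num)
  smul_le {f} c _ n := Eventually.of_forall fun ω => by
    refine maxUpTo_le fun m hm => ?_
    calc ‖(c • f) m ω‖ₑ = ‖c‖ₑ * ‖f m ω‖ₑ := by simp [enorm_mul]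
      _ ≤ _ := by gcongr; exact enorm_le_maxUpTo f hm ω
  transform_antitone {f} hf {V} hV hVa {φ} hφ h n := by
    filter_upwards [hf.2, ae_all_iff.2 h] with ω h0 h1
    refine maxUpTo_le fun m hm => ?_
    rcases exists_martTransform_eq_of_antitone f hVa ω m with h2 | ⟨j, h2, h3, h4⟩
    · rw [h2]; simp
    · rw [h4, h0, Pi.zero_apply, sub_zero]
      exact (enorm_le_maxUpTo f le_rfl ω).trans ((h1 j h3).trans (hφ ω (by omega)))
  transform_monotone {f} hf {U} hU hUm n := Eventually.of_forall fun ω => by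
    refine maxUpTo_le fun m hm => ?_
    by_cases hω : ω ∈ U n
    · rw [Set.indicator_of_mem hω]
      obtain ⟨i, h1, h2⟩ := exists_martTransform_eq_of_monotone f hUm ω m
      rw [h2, two_mul]
      exact (enorm_sub_le (a := f m ω) (b := f i ω)).trans
        (add_le_add (enorm_le_maxUpTo f hm ω) (enorm_le_maxUpTo f (by omega) ω))
    · rw [martTransform_eq_zero f fun j hj h => hω (hUm (by omega) h)]
      simp
  lintegral_sq_le {f} hf {c} hc h n := by
    calc ∫⁻ ω, ‖f n ω‖ₑ ^ 2 ∂μ ≤ ∫⁻ _, c ^ 2 ∂μ := by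
          refine lintegral_mono_ae ?_
          filter_upwards [h n] with ω hω
          gcongr
          exact (enorm_le_maxUpTo f (Nat.le_succ n) ω).trans hω
      _ = c ^ 2 := by simp

end Gauge

/-! ### The atomic decomposition relative to a control -/

section FirstTime

variable {Ω : Type*} {m0 : MeasurableSpace Ω} {𝓖 : Filtration ℕ m0}

open Classical in
/-- The first time at which `ω` belongs to `U n`. -/
noncomputable def firstTime (U : ℕ → Set Ω) (ω : Ω) : WithTop ℕ :=
  if h : ∃ n, ω ∈ U n then ((Nat.find h : ℕ) : WithTop ℕ) else ⊤

theorem firstTime_le_iff {U : ℕ → Set Ω} (hU : Monotone U) {ω : Ω} {n : ℕ} :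
    firstTime U ω ≤ n ↔ ω ∈ U n := by
  classical
  unfold firstTime
  split_ifs with h
  · rw [Nat.cast_le]
    exact ⟨fun hn => hU hn (Nat.find_spec h), fun hn => Nat.find_min' h hn⟩
  · simp only [top_le_iff, WithTop.natCast_ne_top, false_iff]
    exact fun hn => h ⟨n, hn⟩

theorem le_firstTime_iff {U : ℕ → Set Ω} (hU : Monotone U) {ω : Ω} {n : ℕ} :
    (n : WithTop ℕ) ≤ firstTime U ω ↔ ∀ j < n, ω ∉ U j := by
  constructor
  · intro h j hj hω
    have := h.trans ((firstTime_le_iff hU).2 hω)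
    exact absurd (Nat.cast_le.1 this) (by omega)
  · intro h
    by_contra hlt
    rw [not_le] at hlt
    obtain ⟨j, hj⟩ := WithTop.ne_top_iff_exists.1 hlt.ne_top
    rw [← hj] at hlt
    exact h j (WithTop.coe_lt_coe.1 hlt) ((firstTime_le_iff hU).1 hj.ge)

theorem firstTime_lt_top_iff {U : ℕ → Set Ω} (hU : Monotone U) {ω : Ω} :
    firstTime U ω < ⊤ ↔ ∃ n, ω ∈ U n := by
  constructor
  · intro h
    obtain ⟨j, hj⟩ := WithTop.ne_top_iff_exists.1 h.ne_top
    exact ⟨j, (firstTime_le_iff hU).1 hj.ge⟩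
  · rintro ⟨n, hn⟩
    exact lt_of_le_of_lt ((firstTime_le_iff hU).2 hn) (WithTop.coe_lt_top n)

theorem isStoppingTime_firstTime {U : ℕ → Set Ω} (hU : Monotone U)
    (hUm : ∀ n, MeasurableSet[𝓖 n] (U n)) : IsStoppingTime 𝓖 (firstTime U) := by
  intro n
  have : {ω | firstTime U ω ≤ n} = U n := by
    ext ω; exact firstTime_le_iff hU
  exact this ▸ hUm n

theorem iUnion_firstTime_eq {U : ℕ → Set Ω} (hU : Monotone U) :
    ⋃ n : ℕ, {ω | firstTime U ω = n} = ⋃ n, U n := by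
  ext ω
  rw [Set.mem_iUnion, Set.mem_iUnion, ← firstTime_lt_top_iff hU, WithTop.lt_top_iff_ne_top,
    WithTop.ne_top_iff_exists]
  exact exists_congr fun n => eq_comm

end FirstTime

/-! ### Dyadic level sets of a control and the pieces they cut from a martingale -/

section Levels

variable {Ω 𝕜 : Type*} [RCLike 𝕜] {m0 : MeasurableSpace Ω} {𝓖 : Filtration ℕ m0}

/-- The sets `{λ_n > c}`. -/
def levelSet (l : ℕ → Ω → ℝ) (c : ℝ≥0∞) (n : ℕ) : Set Ω := {ω | c < ENNReal.ofReal (l n ω)}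

/-- The sets `{2^j < λ_n ≤ 2^k}`. -/
def layer (l : ℕ → Ω → ℝ) (j k : ℤ) (n : ℕ) : Set Ω :=
  levelSet l (2 ^ j) n ∩ (levelSet l (2 ^ k) n)ᶜ

variable {l : ℕ → Ω → ℝ}

theorem IsControl.measurableSet_levelSet (hl : IsControl 𝓖 l) (c : ℝ≥0∞) (n : ℕ) :
    MeasurableSet[𝓖 n] (levelSet l c n) := by
  have h : Measurable[𝓖 n] (l n) := StronglyMeasurable.measurable (β := ℝ) (hl.adapted n)
  exact (ENNReal.measurable_ofReal.comp h) (measurableSet_Ioi (a := c))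

theorem IsControl.monotone_levelSet (hl : IsControl 𝓖 l) (c : ℝ≥0∞) : Monotone (levelSet l c) :=
  fun _ _ hmn ω hω => lt_of_lt_of_le hω (ENNReal.ofReal_le_ofReal (hl.mono ω hmn))

theorem levelSet_anti (l : ℕ → Ω → ℝ) {c c' : ℝ≥0∞} (h : c ≤ c') (n : ℕ) :
    levelSet l c' n ⊆ levelSet l c n := fun _ hω => lt_of_le_of_lt h hω

theorem iUnion_levelSet (l : ℕ → Ω → ℝ) (c : ℝ≥0∞) :
    ⋃ n, levelSet l c n = {ω | c < controlLimit l ω} := by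
  ext ω
  simp only [Set.mem_iUnion, levelSet, Set.mem_ofPred_eq, controlLimit, lt_iSup_iff]

theorem IsControl.measurableSet_layer (hl : IsControl 𝓖 l) (j k : ℤ) (n : ℕ) :
    MeasurableSet[𝓖 n] (layer l j k n) :=
  (hl.measurableSet_levelSet _ n).inter (hl.measurableSet_levelSet _ n).compl

theorem IsControl.measurable_controlLimit (hl : IsControl 𝓖 l) : Measurable (controlLimit l) :=
  Measurable.iSup fun n => ENNReal.measurable_ofReal.comp
    (StronglyMeasurable.measurable (β := ℝ) ((hl.adapted n).mono (𝓖.le n)))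

theorem martTransform_layer_self (l : ℕ → Ω → ℝ) (k : ℤ) (f : ℕ → Ω → 𝕜) :
    martTransform (layer l k k) f = 0 := by
  ext n ω
  exact martTransform_eq_zero f fun j _ h => h.2 h.1

theorem martTransform_layer_add (l : ℕ → Ω → ℝ) {i j k : ℤ} (hij : i ≤ j) (hjk : j ≤ k)
    (f : ℕ → Ω → 𝕜) :
    martTransform (layer l i j) f + martTransform (layer l j k) f = martTransform (layer l i k) f := by
  rw [← martTransform_add_of_disjoint]
  · congr 1
    ext n ω
    have h1 := @levelSet_anti _ l _ _ (two_zpow_mono hij) n ω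
    have h2 := @levelSet_anti _ l _ _ (two_zpow_mono hjk) n ω
    simp only [layer, Set.mem_union, Set.mem_inter_iff, Set.mem_compl_iff]
    tauto
  · intro n
    rw [Set.disjoint_left]
    exact fun ω h1 h2 => h1.2 h2.1

/-- The remainder consists of the increments with `λ > 2^k`, a started martingale, and those with `λ
≤ 2^i`, a stopped one; each gauge axiom handles one of them. -/
theorem sub_martTransform_layer (l : ℕ → Ω → ℝ) {i k : ℤ} (hik : i ≤ k) (f : ℕ → Ω → 𝕜) (n : ℕ) (ω : Ω) :
    f n ω - f 0 ω - martTransform (layer l i k) f n ω =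
      (martTransform (levelSet l (2 ^ k)) f + martTransform (fun n => (levelSet l (2 ^ i) n)ᶜ) f) n ω := by
  have h1 : ∀ n, Disjoint (levelSet l (2 ^ k) n) (levelSet l (2 ^ i) n)ᶜ := fun n => by
    rw [Set.disjoint_compl_right_iff_subset]
    exact levelSet_anti l (two_zpow_mono hik) n
  have h2 : ∀ n, Disjoint (levelSet l (2 ^ k) n ∪ (levelSet l (2 ^ i) n)ᶜ) (layer l i k n) := fun n => by
    rw [Set.disjoint_left]
    rintro ω (h | h) h'
    · exact h'.2 h
    · exact h h'.1
  rw [← martTransform_add_of_disjoint h1, ← martTransform_univ f n ω, sub_eq_iff_eq_add,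
    ← Pi.add_apply, ← Pi.add_apply, ← martTransform_add_of_disjoint h2]
  congr 1
  ext n ω
  simp only [layer, Set.mem_union, Set.mem_inter_iff, Set.mem_compl_iff, Set.mem_univ]
  tauto

/-- An enumeration of the integers whose initial segments are intervals. -/
def intEnum (K : ℕ) : ℤ := if K % 2 = 0 then (K / 2 : ℕ) else -((K / 2 : ℕ) + 1)

theorem intEnum_injective : Function.Injective intEnum := by
  intro a b h
  unfold intEnum at h
  split_ifs at h <;> omega

/-- The order is `0, -1, 1, -2, …`, so each partial sum telescopes to one long layer with ends
tending to `-∞` and `+∞`. -/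
theorem sum_martTransform_layer (l : ℕ → Ω → ℝ) (f : ℕ → Ω → 𝕜) (K : ℕ) :
    ∑ j ∈ Finset.range K, martTransform (layer l (intEnum j) (intEnum j + 1)) f =
      martTransform (layer l (-(K / 2 : ℕ)) ((K + 1) / 2 : ℕ)) f := by
  induction K with
  | zero => simpa using (martTransform_layer_self l 0 f).symm
  | succ K ih =>
    rw [Finset.sum_range_succ, ih]
    by_cases hK : K % 2 = 0
    · have e1 : intEnum K = ((K + 1) / 2 : ℕ) := by
        rw [intEnum, if_pos hK]; congr 1; omega
      have e2 : ((K + 1 + 1) / 2 : ℕ) = (K + 1) / 2 + 1 := by omega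
      have e3 : (K + 1) / 2 = K / 2 := by omega
      rw [e1, martTransform_layer_add l (by omega) (by omega), e2, e3]
      push_cast
      rfl
    · have e1 : intEnum K = -((K + 1) / 2 : ℕ) := by
        rw [intEnum, if_neg hK]; omega
      have e2 : (K + 1 + 1) / 2 = (K + 1) / 2 := by omega
      have e3 : -(((K + 1) / 2 : ℕ) : ℤ) + 1 = -(K / 2 : ℕ) := by omega
      rw [e1, e3, add_comm, martTransform_layer_add l (by omega) (by omega), e2]

theorem IsMart.sub {μ : Measure Ω} {f g : ℕ → Ω → 𝕜} (hf : IsMart μ 𝓖 f) (hg : IsMart μ 𝓖 g) :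
    IsMart μ 𝓖 (f - g) := by
  have := hf.add (hg.const_smul (-1))
  rwa [neg_one_smul, ← sub_eq_add_neg] at this

variable {μ : Measure Ω} [IsProbabilityMeasure μ] {E : (ℕ → Ω → 𝕜) → ℕ → Ω → ℝ≥0∞}

/-- Stop when `λ` exceeds `2^(k+1)`, which bounds the gauge by `2^(k+1)`; then start when `λ`
exceeds `2^k`, at the cost of a factor `2`. -/
theorem IsGauge.layer_le (hE : IsGauge μ 𝓖 E) {f : ℕ → Ω → 𝕜} (hf : IsMart μ 𝓖 f)
    (hl : IsControl 𝓖 l) (hfl : ∀ n, ∀ᵐ ω ∂μ, E f n ω ≤ ENNReal.ofReal (l n ω)) (k : ℤ) (n : ℕ) :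
    ∀ᵐ ω ∂μ, E (martTransform (layer l k (k + 1)) f) n ω ≤
      (levelSet l (2 ^ k) n).indicator (fun _ => 4 * 2 ^ k) ω := by
  have hV : ∀ n, MeasurableSet[𝓖 n] (levelSet l (2 ^ (k + 1)) n)ᶜ :=
    fun n => (hl.measurableSet_levelSet _ n).compl
  have h1 := hE.transform_antitone hf (V := fun n => (levelSet l (2 ^ (k + 1)) n)ᶜ) hV
    (fun m n hmn => Set.compl_subset_compl.2 (hl.monotone_levelSet _ hmn))
    (φ := fun _ _ => 2 ^ (k + 1)) (fun _ => monotone_const) fun n => by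
      filter_upwards [hfl n] with ω hω h
      exact hω.trans (not_lt.1 h)
  have h2 := hE.transform_monotone (hf.martTransform hV) (hl.measurableSet_levelSet (2 ^ k))
    (hl.monotone_levelSet _) n
  rw [← martTransform_inter] at h2
  filter_upwards [h1 n, h2] with ω a1 a2
  refine a2.trans ?_
  by_cases hω : ω ∈ levelSet l (2 ^ k) n
  · rw [Set.indicator_of_mem hω, Set.indicator_of_mem hω]
    calc 2 * E (martTransform (fun n => (levelSet l (2 ^ (k + 1)) n)ᶜ) f) n ω ≤ 2 * 2 ^ (k + 1) := by
          gcongr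
      _ = 4 * 2 ^ k := by
          rw [ENNReal.zpow_add (by simp) (by simp), zpow_one]; ring
  · rw [Set.indicator_of_notMem hω, Set.indicator_of_notMem hω]

/-- The control of the remainder of the atomic decomposition. -/
noncomputable def tailControl (l : ℕ → Ω → ℝ) (i k : ℤ) (n : ℕ) (ω : Ω) : ℝ :=
  2 * ((levelSet l (2 ^ k) n).indicator (fun ω => 2 * l n ω) ω + min (l n ω) (2 ^ i))

theorem IsControl.tailControl (hl : IsControl 𝓖 l) (i k : ℤ) : IsControl 𝓖 (tailControl l i k) where
  nonneg n ω := by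
    have h1 := hl.nonneg n ω
    have h2 : 0 ≤ (levelSet l (2 ^ k) n).indicator (fun ω => 2 * l n ω) ω :=
      Set.indicator_nonneg (fun ω _ => mul_nonneg zero_le_two (hl.nonneg n ω)) ω
    have h3 : 0 ≤ min (l n ω) ((2 : ℝ) ^ i) := le_min h1 (by positivity)
    unfold _root_.tailControl
    linarith
  mono ω m n hmn := by
    have h1 : l m ω ≤ l n ω := hl.mono ω hmn
    have h2 : (levelSet l (2 ^ k) m).indicator (fun ω => 2 * l m ω) ω ≤
        (levelSet l (2 ^ k) n).indicator (fun ω => 2 * l n ω) ω := by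
      by_cases hm : ω ∈ levelSet l (2 ^ k) m
      · rw [Set.indicator_of_mem hm, Set.indicator_of_mem (hl.monotone_levelSet _ hmn hm)]
        linarith
      · rw [Set.indicator_of_notMem hm]
        exact Set.indicator_nonneg (fun ω _ => mul_nonneg zero_le_two (hl.nonneg n ω)) ω
    have h3 : min (l m ω) ((2 : ℝ) ^ i) ≤ min (l n ω) (2 ^ i) := min_le_min h1 le_rfl
    simp only [_root_.tailControl]
    linarith
  adapted n := by
    have h : StronglyMeasurable[𝓖 n] (l n) := hl.adapted n
    have h1 : StronglyMeasurable[𝓖 n] ((levelSet l (2 ^ k) n).indicator fun ω => 2 * l n ω) :=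
      StronglyMeasurable.indicator (h.const_mul 2) (hl.measurableSet_levelSet _ n)
    have h2 : StronglyMeasurable[𝓖 n] fun ω => min (l n ω) ((2 : ℝ) ^ i) :=
      (continuous_id.min continuous_const).comp_stronglyMeasurable h
    exact (h1.add h2).const_mul 2

theorem ofReal_two_zpow (i : ℤ) : ENNReal.ofReal ((2 : ℝ) ^ i) = 2 ^ i := by
  have h : (2 : ℝ) ^ i = (((2 : ℝ≥0) ^ i : ℝ≥0) : ℝ) := by push_cast; rfl
  rw [h, ENNReal.ofReal_coe_nnreal, ENNReal.coe_zpow (by norm_num)]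
  rfl

theorem ofReal_tailControl (hl : IsControl 𝓖 l) (i k : ℤ) (n : ℕ) (ω : Ω) :
    ENNReal.ofReal (tailControl l i k n ω) =
      2 * ((levelSet l (2 ^ k) n).indicator (fun ω => 2 * ENNReal.ofReal (l n ω)) ω +
        min (ENNReal.ofReal (l n ω)) (2 ^ i)) := by
  have h1 := hl.nonneg n ω
  have h2 : 0 ≤ (levelSet l (2 ^ k) n).indicator (fun ω => 2 * l n ω) ω :=
    Set.indicator_nonneg (fun ω _ => mul_nonneg zero_le_two (hl.nonneg n ω)) ω
  have h3 : 0 ≤ min (l n ω) ((2 : ℝ) ^ i) := le_min h1 (by positivity)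
  rw [tailControl, ENNReal.ofReal_mul (by norm_num), ENNReal.ofReal_add h2 h3, ENNReal.ofReal_min,
    ofReal_two_zpow]
  by_cases hm : ω ∈ levelSet l (2 ^ k) n
  · rw [Set.indicator_of_mem hm, Set.indicator_of_mem hm, ENNReal.ofReal_mul (by norm_num)]
    simp
  · rw [Set.indicator_of_notMem hm, Set.indicator_of_notMem hm]
    simp

theorem controlLimit_tailControl_le (hl : IsControl 𝓖 l) (i k : ℤ) (ω : Ω) :
    controlLimit (tailControl l i k) ω ≤
      2 * ({ω | 2 ^ k < controlLimit l ω}.indicator (fun ω => 2 * controlLimit l ω) ω +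
        min (controlLimit l ω) (2 ^ i)) := by
  refine iSup_le fun n => ?_
  rw [ofReal_tailControl hl]
  have h : ENNReal.ofReal (l n ω) ≤ controlLimit l ω := le_iSup (fun n => ENNReal.ofReal (l n ω)) n
  gcongr
  by_cases hm : ω ∈ levelSet l (2 ^ k) n
  · have hm' : ω ∈ {ω | 2 ^ k < controlLimit l ω} := lt_of_lt_of_le hm h
    rw [Set.indicator_of_mem hm, Set.indicator_of_mem hm']
    gcongr
  · rw [Set.indicator_of_notMem hm]
    exact zero_le

/-- In `tailControl` the outer `2` is the quasi-triangle constant of the gauge and the inner `2`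
that of starting a martingale; the minimum controls the part stopped at level `2^i`. -/
theorem IsGauge.tail_le (hE : IsGauge μ 𝓖 E) {f : ℕ → Ω → 𝕜} (hf : IsMart μ 𝓖 f)
    (hl : IsControl 𝓖 l) (hfl : ∀ n, ∀ᵐ ω ∂μ, E f n ω ≤ ENNReal.ofReal (l n ω)) {i k : ℤ}
    (hik : i ≤ k) (n : ℕ) :
    ∀ᵐ ω ∂μ, E (f - martTransform (layer l i k) f) n ω ≤ ENNReal.ofReal (tailControl l i k n ω) := by
  have hV : ∀ n, MeasurableSet[𝓖 n] (levelSet l (2 ^ i) n)ᶜ :=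
    fun n => (hl.measurableSet_levelSet _ n).compl
  have hU := hl.measurableSet_levelSet (2 ^ k)
  have h0 : ∀ n, (f - martTransform (layer l i k) f) n =ᵐ[μ] (martTransform (levelSet l (2 ^ k)) f +
      martTransform (fun n => (levelSet l (2 ^ i) n)ᶜ) f) n := by
    intro n
    filter_upwards [hf.2] with ω hω
    rw [← sub_martTransform_layer l hik, hω]
    simp
  have h1 := hE.transform_antitone hf (V := fun n => (levelSet l (2 ^ i) n)ᶜ) hV
    (fun m n hmn => Set.compl_subset_compl.2 (hl.monotone_levelSet _ hmn))
    (φ := fun n ω => min (ENNReal.ofReal (l n ω)) (2 ^ i))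
    (fun ω m n hmn => min_le_min (ENNReal.ofReal_le_ofReal (hl.mono ω hmn)) le_rfl) fun n => by
      filter_upwards [hfl n] with ω hω h
      exact le_min hω (hω.trans (not_lt.1 h))
  have h2 := hE.transform_monotone hf hU (hl.monotone_levelSet _) n
  filter_upwards [hE.congr h0 n, h1 n, h2, hfl n, hE.add_le (hf.martTransform hU).1.stronglyAdapted
    (hf.martTransform hV).1.stronglyAdapted n] with ω a0 a1 a2 a3 a4
  rw [a0, ofReal_tailControl hl]
  refine a4.trans ?_
  gcongr
  refine a2.trans ?_
  by_cases hm : ω ∈ levelSet l (2 ^ k) n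
  · rw [Set.indicator_of_mem hm, Set.indicator_of_mem hm]
    gcongr
  · rw [Set.indicator_of_notMem hm]
    exact zero_le

/-- No layer ever reaches `{λ_n = 0}`, so nothing of `f` may be lost there: the martingale stopped
on leaving `{λ = 0}` has gauge zero and vanishes by the `L²` bound. -/
theorem IsGauge.ae_diff_eq_zero (hE : IsGauge μ 𝓖 E) {f : ℕ → Ω → 𝕜} (hf : IsMart μ 𝓖 f)
    (hl : IsControl 𝓖 l) (hfl : ∀ n, ∀ᵐ ω ∂μ, E f n ω ≤ ENNReal.ofReal (l n ω)) (n : ℕ) :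
    ∀ᵐ ω ∂μ, ω ∉ levelSet l 0 n → f (n + 1) ω - f n ω = 0 := by
  have hV : ∀ n, MeasurableSet[𝓖 n] (levelSet l 0 n)ᶜ :=
    fun n => (hl.measurableSet_levelSet _ n).compl
  have h1 := hE.transform_antitone hf (V := fun n => (levelSet l 0 n)ᶜ) hV
    (fun m n hmn => Set.compl_subset_compl.2 (hl.monotone_levelSet _ hmn))
    (φ := fun _ _ => 0) (fun _ => monotone_const) fun n => by
      filter_upwards [hfl n] with ω hω h
      exact hω.trans (not_lt.1 h)
  have hm := hf.martTransform hV
  have h2 : ∀ n, ∀ᵐ ω ∂μ, martTransform (fun n => (levelSet l 0 n)ᶜ) f n ω = 0 := by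
    intro n
    have h3 := hE.lintegral_sq_le hm (c := 0) (by simp) h1 n
    rw [zero_pow two_ne_zero, nonpos_iff_eq_zero, lintegral_eq_zero_iff'] at h3
    · filter_upwards [h3] with ω hω
      simpa using hω
    · exact ((hm.1.integrable n).aestronglyMeasurable.enorm).pow_const 2
  filter_upwards [h2 n, h2 (n + 1)] with ω a1 a2 hω
  have := martTransform_succ_sub (fun n => (levelSet l 0 n)ᶜ) f n ω
  rw [a1, a2, Set.indicator_of_mem (by exact hω)] at this
  simpa using this.symm

/-- For each fixed time the convergence is eventually an equality: a positive `λ_j(ω)` lies in all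
sufficiently long layers, and increments with `λ_j(ω) = 0` vanish. -/
theorem IsGauge.ae_tendsto_layers (hE : IsGauge μ 𝓖 E) {f : ℕ → Ω → 𝕜} (hf : IsMart μ 𝓖 f)
    (hl : IsControl 𝓖 l) (hfl : ∀ n, ∀ᵐ ω ∂μ, E f n ω ≤ ENNReal.ofReal (l n ω)) {i k : ℕ → ℤ}
    (hi : Tendsto i atTop atBot) (hk : Tendsto k atTop atTop) (n : ℕ) :
    ∀ᵐ ω ∂μ, Tendsto (fun K => martTransform (layer l (i K) (k K)) f n ω) atTop (𝓝 (f n ω)) := by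
  filter_upwards [hf.2, ae_all_iff.2 (hE.ae_diff_eq_zero hf hl hfl)] with ω h0 h1
  have e : f n ω = ∑ j ∈ Finset.range n, (f (j + 1) ω - f j ω) := by
    rw [Finset.sum_range_sub (fun j => f j ω) n, h0]; simp
  rw [e]
  refine tendsto_finsetSum _ fun j _ => ?_
  by_cases hω : ω ∈ levelSet l 0 j
  · have hpos : 0 < ENNReal.ofReal (l j ω) := hω
    obtain ⟨z, hz1, hz2⟩ := ENNReal.exists_mem_Ioc_zpow (x := ENNReal.ofReal (l j ω)) (y := 2)
      hpos.ne' ENNReal.ofReal_ne_top (by norm_num) (by simp)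
    refine tendsto_const_nhds.congr' ?_
    filter_upwards [hi.eventually (eventually_le_atBot z), hk.eventually (eventually_ge_atTop (z + 1))]
      with K a1 a2
    rw [Set.indicator_of_mem]
    refine ⟨lt_of_le_of_lt (two_zpow_mono a1) hz1, ?_⟩
    exact not_lt.2 (hz2.trans (two_zpow_mono a2))
  · have := h1 j hω
    refine tendsto_const_nhds.congr fun K => ?_
    rw [this]
    by_cases h : ω ∈ layer l (i K) (k K) j <;> simp [h, this]

end Levels

/-! ### Terminal values of bounded pieces and their restrictions -/

section Terminal

variable {Ω 𝕜 : Type*} [RCLike 𝕜] {m0 : MeasurableSpace Ω} {𝓖 : Filtration ℕ m0} {μ : Measure Ω}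
  [IsProbabilityMeasure μ] {E : (ℕ → Ω → 𝕜) → ℕ → Ω → ℝ≥0∞}

/-- A bounded gauge makes `g` bounded in `L²`, so it is generated by its limit `a`. Almost
everywhere convergence locates the zeros of `a`. -/
theorem IsGauge.exists_terminal (hE : IsGauge μ 𝓖 E) {g : ℕ → Ω → 𝕜} (hg : IsMart μ 𝓖 g)
    {c : ℝ≥0∞} (hc : c ≠ ∞) (h : ∀ n, ∀ᵐ ω ∂μ, E g n ω ≤ c) :
    ∃ a : Ω → 𝕜, Integrable a μ ∧ (∀ n, martOf μ 𝓖 a n =ᵐ[μ] g n) ∧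
      ∀ᵐ ω ∂μ, (∀ n, g n ω = 0) → a ω = 0 := by
  obtain ⟨a, h1, h2, h3⟩ := Martingale.exists_limit_of_lintegral_sq_le hg.1
    (ENNReal.pow_ne_top hc) (hE.lintegral_sq_le hg hc h)
  refine ⟨a, h1, h2, ?_⟩
  filter_upwards [h3] with ω hω h0
  simp only [h0] at hω
  exact tendsto_nhds_unique hω tendsto_const_nhds

theorem martTransform_ite (A : Set Ω) (m : ℕ) (f : ℕ → Ω → 𝕜) (n : ℕ) (ω : Ω) :
    martTransform (fun j => if m ≤ j then A else ∅) f n ω =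
      if m ≤ n then A.indicator (fun ω => f n ω - f m ω) ω else 0 := by
  induction n with
  | zero =>
    rw [martTransform_zero]
    split_ifs with h
    · obtain rfl : m = 0 := by omega
      by_cases hω : ω ∈ A <;> simp [hω]
    · rfl
  | succ n ih =>
    rw [martTransform_succ, ih]
    by_cases h : m ≤ n
    · rw [if_pos h, if_pos h, if_pos (by omega)]
      by_cases hω : ω ∈ A <;> simp [hω]
    · rw [if_neg h, if_neg h]
      by_cases h' : m ≤ n + 1
      · obtain rfl : m = n + 1 := by omega
        by_cases hω : ω ∈ A <;> simp [hω]
      · rw [if_neg h']; simp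

/-- From time `m` on, the indicator comes out of the conditional expectation; earlier everything
vanishes, since `𝔼_m(a χ_A) = 0`. Thus `a χ_A` generates a started martingale, to which
`transform_monotone` applies. -/
theorem martOf_indicator {a : Ω → 𝕜} (ha : Integrable a μ) {A : Set Ω} {m : ℕ}
    (hA : MeasurableSet[𝓖 m] A) (h0 : ∀ᵐ ω ∂μ, ω ∈ A → martOf μ 𝓖 a m ω = 0) (n : ℕ) :
    martOf μ 𝓖 (A.indicator a) n =ᵐ[μ]
      martTransform (fun j => if m ≤ j then A else ∅) (martOf μ 𝓖 a) n := by
  by_cases h : m ≤ n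
  · filter_upwards [condExp_indicator (m := 𝓖 n) ha (𝓖.mono h _ hA), h0] with ω h1 h2
    rw [martTransform_ite, if_pos h]
    refine h1.trans ?_
    by_cases hω : ω ∈ A
    · rw [Set.indicator_of_mem hω, Set.indicator_of_mem hω, h2 hω, sub_zero]; rfl
    · rw [Set.indicator_of_notMem hω, Set.indicator_of_notMem hω]
  · have h3 : μ[A.indicator a | 𝓖 m] =ᵐ[μ] 0 := by
      filter_upwards [condExp_indicator (m := 𝓖 m) ha hA, h0] with ω h1 h2
      rw [h1]
      by_cases hω : ω ∈ A
      · rw [Set.indicator_of_mem hω]; exact h2 hω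
      · rw [Set.indicator_of_notMem hω]; rfl
    have h4 : martOf μ 𝓖 (A.indicator a) n =ᵐ[μ] 0 := by
      refine (condExp_condExp_of_le (𝓖.mono (by omega : n ≤ m)) (𝓖.le m)).symm.trans ?_
      refine (condExp_congr_ae h3).trans ?_
      rw [condExp_zero]
    filter_upwards [h4] with ω hω
    rw [hω, martTransform_ite, if_neg h]; rfl

theorem isMart_martOf {a : Ω → 𝕜} (h0 : martOf μ 𝓖 a 0 =ᵐ[μ] 0) : IsMart μ 𝓖 (martOf μ 𝓖 a) :=
  ⟨martingale_condExp a 𝓖 μ, h0⟩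

end Terminal

/-! ### Boundedness of operators that are local on atoms -/

section LocalOperators

universe u

variable {d : ℕ} {Ω : Fin d → Type u} [mΩ : ∀ i, MeasurableSpace (Ω i)] {𝕜 : Type*}
  {P : ∀ i, Measure (Ω i)} [∀ i, IsProbabilityMeasure (P i)] {ℱ : ∀ i, Filtration ℕ (mΩ i)}
  {p : Fin d → ℝ≥0∞} {r : ℝ≥0∞}

/-- For finite `r` the constant-exponent mixed norm is the ordinary `L_r`-norm and `ρ = r`. For `r =
∞` the bound is pointwise on `A`, so any `ρ` will do. -/
theorem setLIntegral_rpow_le_of_mixedNorm_le (hr0 : r ≠ 0) {ρ : ℝ} (hρ : 0 < ρ)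
    (hρr : r ≠ ∞ → ρ = r.toReal) {A : Set (∀ i, Ω i)} (hA : MeasurableSet A)
    {h : (∀ i, Ω i) → ℝ≥0∞} (hh : Measurable h) {K : ℝ≥0} {c : ℝ≥0∞}
    (hK : mixedNorm P (fun _ => r) (A.indicator h) ≤
      K * mixedNorm P (fun _ => r) (A.indicator fun _ => c)) :
    ∫⁻ ω in A, h ω ^ ρ ∂Measure.pi P ≤ (K * c) ^ ρ * Measure.pi P A := by
  by_cases hr : r = ∞
  · subst hr
    have h1 : mixedNorm P (fun _ => ∞) (A.indicator fun _ => c) ≤ c :=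
      (mixedNorm_mono_ae _ (Eventually.of_forall
        (Set.indicator_le_self' fun _ _ => zero_le))).trans (mixedNorm_const (fun _ => by simp) c).le
    rw [← setLIntegral_const]
    refine setLIntegral_mono_ae measurable_const.aemeasurable ?_
    filter_upwards [ae_le_mixedNorm_top (P := P) (hh.indicator hA)] with ω h2 hω
    rw [Set.indicator_of_mem hω] at h2
    gcongr
    exact h2.trans (hK.trans (by gcongr))
  · rw [hρr hr] at hρ ⊢
    have key : ∀ w : (∀ i, Ω i) → ℝ≥0∞, Measurable w →
        mixedNorm P (fun _ => r) (A.indicator w) ^ r.toReal =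
          ∫⁻ ω in A, w ω ^ r.toReal ∂Measure.pi P := by
      intro w hw
      rw [mixedNorm_const_exponent hr0 hr (hw.indicator hA), ← lintegral_indicator hA]
      refine lintegral_congr fun ω => ?_
      by_cases hω : ω ∈ A <;> simp [hω, hρ]
    rw [← key h hh, ENNReal.mul_rpow_of_nonneg _ _ hρ.le, mul_assoc, ← setLIntegral_const,
      ← key _ measurable_const, ← ENNReal.mul_rpow_of_nonneg _ _ hρ.le]
    exact ENNReal.rpow_le_rpow hK hρ.le

variable {E : (ℕ → (∀ i, Ω i) → 𝕜) → ℕ → (∀ i, Ω i) → ℝ≥0∞}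
  {O : (ℕ → (∀ i, Ω i) → 𝕜) → (∀ i, Ω i) → ℝ≥0∞}
  {N : (Fin d → ℝ≥0∞) → (ℕ → (∀ i, Ω i) → 𝕜) → ℝ≥0∞}
  {T : (ℕ → (∀ i, Ω i) → 𝕜) → (∀ i, Ω i) → 𝕜}

/-- The quasi-norms `N q` are bounded by the mixed norms of the controls of the gauge `E`. -/
def BoundedByControls (P : ∀ i, Measure (Ω i)) (ℱ : ∀ i, Filtration ℕ (mΩ i))
    (E : (ℕ → (∀ i, Ω i) → 𝕜) → ℕ → (∀ i, Ω i) → ℝ≥0∞)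
    (N : (Fin d → ℝ≥0∞) → (ℕ → (∀ i, Ω i) → 𝕜) → ℝ≥0∞) : Prop :=
  ∀ (q : Fin d → ℝ≥0∞) (f : ℕ → (∀ i, Ω i) → 𝕜) (l : ℕ → (∀ i, Ω i) → ℝ),
    IsControl (prodFiltration ℱ) l →
    (∀ n, ∀ᵐ ω ∂Measure.pi P, E f n ω ≤ ENNReal.ofReal (l n ω)) →
    N q f ≤ mixedNorm P q (controlLimit l)

/-- The process `c χ_{W_n}` is itself a control, with limit at most `c χ_A`. -/
theorem BoundedByControls.le_indicator (hN : BoundedByControls P ℱ E N) (q : Fin d → ℝ≥0∞)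
    {f : ℕ → (∀ i, Ω i) → 𝕜} {W : ℕ → Set (∀ i, Ω i)} (hW : Monotone W)
    (hWm : ∀ n, MeasurableSet[prodFiltration ℱ n] (W n)) {A : Set (∀ i, Ω i)} (hWA : ∀ n, W n ⊆ A)
    {c : ℝ≥0∞} (hc : c ≠ ∞)
    (h : ∀ n, ∀ᵐ ω ∂Measure.pi P, E f n ω ≤ (W n).indicator (fun _ => c) ω) :
    N q f ≤ mixedNorm P q (A.indicator fun _ => c) := by
  have e : ∀ n ω, ENNReal.ofReal ((W n).indicator (fun _ => c.toReal) ω) =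
      (W n).indicator (fun _ => c) ω := by
    intro n ω
    by_cases hω : ω ∈ W n
    · simp [hω, ENNReal.ofReal_toReal hc]
    · simp [hω]
  refine (hN q f (fun n => (W n).indicator fun _ => c.toReal) ⟨?_, ?_, ?_⟩ ?_).trans
    (mixedNorm_mono_ae q (Eventually.of_forall fun ω => ?_))
  · exact fun n ω => Set.indicator_nonneg (fun _ _ => ENNReal.toReal_nonneg) ω
  · exact fun ω m n hmn => Set.indicator_le_indicator_of_subset (hW hmn)
      (fun _ => ENNReal.toReal_nonneg) ω
  · exact fun n => StronglyMeasurable.indicator (@stronglyMeasurable_const _ _ (prodFiltration ℱ n) _ _)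
      (hWm n)
  · intro n
    filter_upwards [h n] with ω hω
    rwa [e]
  · refine iSup_le fun n => ?_
    rw [e]
    exact Set.indicator_le_indicator_of_subset (hWA n) (fun _ => zero_le) ω

theorem mixedNorm_indicator_le {q : Fin d → ℝ≥0∞} (hq : ∀ i, q i ≠ 0) (A : Set (∀ i, Ω i)) (c : ℝ≥0∞) :
    mixedNorm P q (A.indicator fun _ => c) ≤ c :=
  (mixedNorm_mono_ae q (Eventually.of_forall
    (Set.indicator_le_self' fun _ _ => zero_le))).trans (mixedNorm_const hq c).le

variable [RCLike 𝕜]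

theorem IsGauge.zero_le {Ω : Type*} {m0 : MeasurableSpace Ω} {μ : Measure Ω} {𝓖 : Filtration ℕ m0}
    {E : (ℕ → Ω → 𝕜) → ℕ → Ω → ℝ≥0∞} (hE : IsGauge μ 𝓖 E) {w : ℕ → Ω → 𝕜}
    (hw : ∀ n, w n =ᵐ[μ] 0) (n : ℕ) : ∀ᵐ ω ∂μ, E w n ω ≤ 0 := by
  have h1 := hE.smul_le (f := 0) (0 : 𝕜) (fun n => stronglyMeasurable_zero) n
  filter_upwards [hE.congr (g := 0) hw n, h1] with ω a1 a2
  rw [a1]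
  simpa using a2

theorem isMart_zero {Ω : Type*} {m0 : MeasurableSpace Ω} {μ : Measure Ω} {𝓖 : Filtration ℕ m0} :
    IsMart μ 𝓖 (0 : ℕ → Ω → 𝕜) := ⟨martingale_zero 𝕜 𝓖 μ, EventuallyEq.rfl⟩

/-- `T` is not assumed to respect almost everywhere equality. Still, `w` is the sum of a series of
zero martingales, and `T 0 = 0` by homogeneity with the scalar `0`. -/
theorem IsSigmaSublinear.ae_eq_zero (hp0 : ∀ i, p i ≠ 0)
    (hE : IsGauge (Measure.pi P) (prodFiltration ℱ) E) (hN : BoundedByControls P ℱ E N)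
    (hT : IsSigmaSublinear (Measure.pi P) (prodFiltration ℱ) (N p) T) {w : ℕ → (∀ i, Ω i) → 𝕜}
    (hw : IsMart (Measure.pi P) (prodFiltration ℱ) w) (hw0 : ∀ n, w n =ᵐ[Measure.pi P] 0) :
    ∀ᵐ ω ∂Measure.pi P, ‖T w ω‖ₑ = 0 := by
  have hNz : ∀ w : ℕ → (∀ i, Ω i) → 𝕜, (∀ n, w n =ᵐ[Measure.pi P] 0) → N p w = 0 := by
    intro w hw0
    refine nonpos_iff_eq_zero.1 ((hN.le_indicator p (W := fun _ => ∅) (A := ∅) monotone_const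
      (fun n => @MeasurableSet.empty _ (prodFiltration ℱ n)) (fun _ => subset_rfl) ENNReal.zero_ne_top (c := 0) fun n => ?_).trans
      (mixedNorm_indicator_le hp0 _ _))
    simpa using hE.zero_le hw0 n
  have h0 : MemHardy (Measure.pi P) (prodFiltration ℱ) (N p) (0 : ℕ → (∀ i, Ω i) → 𝕜) :=
    ⟨isMart_zero, by rw [hNz 0 fun _ => EventuallyEq.rfl]; simp⟩
  have h1 := hT.series_le w (fun _ => 0) ⟨hw, by rw [hNz w hw0]; simp⟩ (fun _ => h0)
    (fun n => by
      filter_upwards [hw0 n] with ω hω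
      simp [hω])
    (by simp [hNz w hw0])
  filter_upwards [h1, hT.smul_eq 0 0 h0] with ω a1 a2
  rw [smul_zero, enorm_zero, zero_mul] at a2
  simpa [a2] using a1

/-- Since `A` lies in `ℱ_m` and in `{τ = m}`, it belongs to `ℱ_τ`, and locality reduces the claim to
the `L_r` bound for `a χ_A`. This restriction starts at time `m` on `A`, so its gauge is at most
`2κ` on `A` and vanishes elsewhere; hence its norm in `X_r` is at most that of `2κ χ_A`. -/
theorem IsAtomLocal.setLIntegral_le (hr0 : r ≠ 0)
    {ρ : ℝ} (hρ : 0 < ρ) (hρr : r ≠ ∞ → ρ = r.toReal)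
    (hE : IsGauge (Measure.pi P) (prodFiltration ℱ) E) (hN : BoundedByControls P ℱ E N) {K : ℝ≥0}
    (hK : ∀ f, MemHardy (Measure.pi P) (prodFiltration ℱ) (N fun _ => r) f →
      mixedNorm P (fun _ => r) (fun ω => ‖T f ω‖ₑ) ≤ K * N (fun _ => r) f)
    (hA : IsAtomLocal P ℱ p O T) {a : (∀ i, Ω i) → 𝕜} {τ : (∀ i, Ω i) → WithTop ℕ}
    (ha : IsHardyAtom P ℱ p O a τ) {κ : ℝ≥0∞} (hκ : κ ≠ ∞)
    (hEa : ∀ n, ∀ᵐ ω ∂Measure.pi P, E (martOf (Measure.pi P) (prodFiltration ℱ) a) n ω ≤ κ)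
    {h : (∀ i, Ω i) → ℝ≥0∞} (hh : Measurable h)
    (hTh : ∀ᵐ ω ∂Measure.pi P, ‖T (martOf (Measure.pi P) (prodFiltration ℱ) a) ω‖ₑ = h ω)
    {m : ℕ} {A : Set (∀ i, Ω i)} (hAm : MeasurableSet[prodFiltration ℱ m] A)
    (hAτ : ∀ ω ∈ A, τ ω = m) :
    ∫⁻ ω in A, h ω ^ ρ ∂Measure.pi P ≤ (K * (2 * κ)) ^ ρ * Measure.pi P A := by
  set μ := Measure.pi P
  set 𝓖 := prodFiltration ℱ
  have hA' : MeasurableSet A := 𝓖.le m _ hAm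
  have ha0 : ∀ n : ℕ, n ≤ m → ∀ᵐ ω ∂μ, ω ∈ A → martOf μ 𝓖 a n ω = 0 := by
    intro n hn
    filter_upwards [ha.condExp_eq_zero n] with ω h1 h2
    refine h1 ?_
    rw [hAτ ω h2]
    exact Nat.cast_le.2 hn
  have hmart : IsMart μ 𝓖 (martOf μ 𝓖 a) := isMart_martOf (by
    filter_upwards [ha.condExp_eq_zero 0] with ω h1
    exact h1 (by simp))
  set W : ℕ → Set (∀ i, Ω i) := fun j => if m ≤ j then A else ∅ with hWdef
  have hWm : ∀ n, MeasurableSet[𝓖 n] (W n) := by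
    intro n
    by_cases hmn : m ≤ n
    · simp only [hWdef, if_pos hmn]; exact 𝓖.mono hmn _ hAm
    · simp only [hWdef, if_neg hmn]; exact @MeasurableSet.empty _ (𝓖 n)
  have hWmono : Monotone W := by
    intro j k hjk
    simp only [hWdef]
    split_ifs with h1 h2
    · exact le_rfl
    · omega
    · exact Set.empty_subset _
    · exact le_rfl
  have hWA : ∀ n, W n ⊆ A := by
    intro n
    simp only [hWdef]
    split_ifs
    · exact subset_rfl
    · exact Set.empty_subset _
  set w := martOf μ 𝓖 (A.indicator a) with hw
  have hwt := martOf_indicator (μ := μ) (𝓖 := 𝓖) ha.integrable hAm (ha0 m le_rfl)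
  have hwmart : IsMart μ 𝓖 w := isMart_martOf (by
    refine (hwt 0).trans ?_
    rw [martTransform_zero])
  have hEw : ∀ n, ∀ᵐ ω ∂μ, E w n ω ≤ (W n).indicator (fun _ => 2 * κ) ω := by
    intro n
    filter_upwards [hE.congr hwt n, hE.transform_monotone hmart hWm hWmono n, hEa n] with ω b1 b2 b3
    rw [b1]
    refine b2.trans ?_
    by_cases hω : ω ∈ W n
    · rw [Set.indicator_of_mem hω, Set.indicator_of_mem hω]; gcongr
    · rw [Set.indicator_of_notMem hω]; exact _root_.zero_le
  have h2κ : 2 * κ ≠ ∞ := ENNReal.mul_ne_top (by simp) hκ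
  have hNw := hN.le_indicator (fun _ => r) hWmono hWm hWA h2κ hEw
  have hKw := hK w ⟨hwmart, (hNw.trans (mixedNorm_indicator_le (fun _ => hr0) _ _)).trans_lt
    h2κ.lt_top⟩
  have hAi : ∀ i : ℕ, MeasurableSet[𝓖 i] (A ∩ {ω | τ ω ≤ i}) := fun i => by
    by_cases hmi : m ≤ i
    · have : A ∩ {ω | τ ω ≤ i} = A := Set.inter_eq_left.2 fun ω hω => by
        change τ ω ≤ i
        rw [hAτ ω hω]; exact Nat.cast_le.2 hmi
      rw [this]
      exact 𝓖.mono hmi _ hAm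
    · have : A ∩ {ω | τ ω ≤ i} = ∅ := Set.eq_empty_of_forall_notMem fun ω hω => by
        have h1 : τ ω ≤ i := hω.2
        rw [hAτ ω hω.1] at h1
        exact hmi (Nat.cast_le.1 h1)
      rw [this]
      exact @MeasurableSet.empty _ (𝓖 i)
  have hloc := hA a τ ha A ⟨(le_iSup 𝓖.seq m) _ hAm, hAi⟩
  refine setLIntegral_rpow_le_of_mixedNorm_le hr0 hρ hρr hA' hh (le_trans (le_of_eq ?_)
    (hKw.trans (by gcongr)))
  refine mixedNorm_congr_ae _ ?_
  filter_upwards [hloc, hTh] with ω b1 b2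
  rw [← b1]
  by_cases hω : ω ∈ A
  · rw [Set.indicator_of_mem hω, Set.indicator_of_mem hω, b2]
  · rw [Set.indicator_of_notMem hω, Set.indicator_of_notMem hω, enorm_zero]

/-- The set `{τ = ∞}` is in `ℱ_τ` and `a` restricted to it vanishes, so locality applies with a null
martingale. -/
theorem IsAtomLocal.ae_eq_zero (hp0 : ∀ i, p i ≠ 0)
    (hE : IsGauge (Measure.pi P) (prodFiltration ℱ) E) (hN : BoundedByControls P ℱ E N)
    (hT : IsSigmaSublinear (Measure.pi P) (prodFiltration ℱ) (N p) T)
    (hA : IsAtomLocal P ℱ p O T) {a : (∀ i, Ω i) → 𝕜} {τ : (∀ i, Ω i) → WithTop ℕ}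
    (ha : IsHardyAtom P ℱ p O a τ) (ha0 : ∀ᵐ ω ∂Measure.pi P, τ ω = ⊤ → a ω = 0) :
    ∀ᵐ ω ∂Measure.pi P, τ ω = ⊤ → ‖T (martOf (Measure.pi P) (prodFiltration ℱ) a) ω‖ₑ = 0 := by
  set μ := Measure.pi P
  set 𝓖 := prodFiltration ℱ
  have hae : {ω | τ ω = ⊤}.indicator a =ᵐ[μ] 0 := by
    filter_upwards [ha0] with ω h1
    by_cases hω : τ ω = ⊤
    · rw [Set.indicator_of_mem (by exact hω), h1 hω]; rfl
    · rw [Set.indicator_of_notMem (by exact hω)]; rfl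
  have hw0 : ∀ n, martOf μ 𝓖 ({ω | τ ω = ⊤}.indicator a) n =ᵐ[μ] 0 := by
    intro n
    refine (condExp_congr_ae hae).trans ?_
    rw [condExp_zero]
  have hinf : MeasurableSet[⨆ n, 𝓖 n] {ω | τ ω = ⊤} := by
    have : {ω | τ ω = ⊤} = ⋂ i : ℕ, {ω | τ ω ≤ i}ᶜ := by
      ext ω
      simp only [Set.mem_iInter, Set.mem_compl_iff]
      constructor
      · intro h1 i h2
        have h2' : τ ω ≤ i := h2
        rw [show τ ω = ⊤ from h1] at h2'
        exact WithTop.coe_ne_top (top_le_iff.1 h2')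
      · intro h1
        by_contra h2
        obtain ⟨i, hi⟩ := WithTop.ne_top_iff_exists.1 h2
        exact h1 i hi.ge
    rw [this]
    refine @MeasurableSet.iInter _ _ (⨆ n, 𝓖 n) _ _ fun i => ?_
    exact ((le_iSup 𝓖.seq i) _ (ha.isStoppingTime i)).compl
  have hAi : ∀ i : ℕ, MeasurableSet[𝓖 i] ({ω | τ ω = ⊤} ∩ {ω | τ ω ≤ i}) := fun i => by
    have : {ω | τ ω = ⊤} ∩ {ω | τ ω ≤ i} = ∅ := Set.eq_empty_of_forall_notMem fun ω hω => by
      have h1 : τ ω ≤ i := hω.2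
      rw [show τ ω = ⊤ from hω.1] at h1
      exact WithTop.coe_ne_top (top_le_iff.1 h1)
    rw [this]
    exact @MeasurableSet.empty _ (𝓖 i)
  have hloc := hA a τ ha {ω | τ ω = ⊤} ⟨hinf, hAi⟩
  filter_upwards [hloc, hT.ae_eq_zero hp0 hE hN (isMart_martOf (hw0 0)) hw0] with ω h1 h2 hω
  rw [Set.indicator_of_mem (by exact hω)] at h1
  rw [h1, h2]

end LocalOperators

/-! ### The atomic decomposition and the resulting bound for the operator -/

section AtomicDecomposition

universe u

variable {d : ℕ} {Ω : Fin d → Type u} [mΩ : ∀ i, MeasurableSpace (Ω i)] {𝕜 : Type*} [RCLike 𝕜]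
  {P : ∀ i, Measure (Ω i)} [∀ i, IsProbabilityMeasure (P i)] {ℱ : ∀ i, Filtration ℕ (mΩ i)}
  {p : Fin d → ℝ≥0∞} {r : ℝ≥0∞}
  {E : (ℕ → (∀ i, Ω i) → 𝕜) → ℕ → (∀ i, Ω i) → ℝ≥0∞}
  {O : (ℕ → (∀ i, Ω i) → 𝕜) → (∀ i, Ω i) → ℝ≥0∞}
  {N : (Fin d → ℝ≥0∞) → (ℕ → (∀ i, Ω i) → 𝕜) → ℝ≥0∞}
  {T : (ℕ → (∀ i, Ω i) → 𝕜) → (∀ i, Ω i) → 𝕜}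

/-- A martingale with bounded gauge, started at a stopping time, is a multiple of an atom. -/
theorem IsGauge.exists_atom (hp0 : ∀ i, p i ≠ 0) (hpt : ∀ i, p i ≠ ∞)
    (hE : IsGauge (Measure.pi P) (prodFiltration ℱ) E) (hO : ∀ f ω, O f ω ≤ ⨆ n, E f n ω)
    {U : ℕ → Set (∀ i, Ω i)} (hU : Monotone U) (hUm : ∀ n, MeasurableSet[prodFiltration ℱ n] (U n))
    {g : ℕ → (∀ i, Ω i) → 𝕜} (hg : IsMart (Measure.pi P) (prodFiltration ℱ) g)
    (hg0 : ∀ n ω, (∀ j < n, ω ∉ U j) → g n ω = 0) {c : ℝ≥0}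
    (hgE : ∀ n, ∀ᵐ ω ∂Measure.pi P, E g n ω ≤ c) :
    ∃ (s : 𝕜) (a : (∀ i, Ω i) → 𝕜) (κ : ℝ≥0∞), κ ≠ ∞ ∧ ‖s‖ₑ * κ ≤ c ∧
      IsHardyAtom P ℱ p O a (firstTime U) ∧
      (∀ n, ∀ᵐ ω ∂Measure.pi P, E (martOf (Measure.pi P) (prodFiltration ℱ) a) n ω ≤ κ) ∧
      (∀ n, (s • martOf (Measure.pi P) (prodFiltration ℱ) a) n =ᵐ[Measure.pi P] g n) ∧
      ∀ᵐ ω ∂Measure.pi P, firstTime U ω = ⊤ → a ω = 0 := by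
  set μ := Measure.pi P
  set 𝓖 := prodFiltration ℱ
  obtain ⟨a, ha1, ha2, ha3⟩ := hE.exists_terminal hg ENNReal.coe_ne_top hgE
  set M : ℝ≥0∞ := mixedNorm P p ({ω | firstTime U ω < ⊤}.indicator fun _ => 1) with hM
  have hM1 : M ≤ 1 := mixedNorm_indicator_le hp0 _ _
  have hMt : M ≠ ∞ := ne_top_of_le_ne_top (by simp) hM1
  -- The normalization under which `s⁻¹ • a` meets the size condition of atoms: `‖s‖ₑ = c M`.
  set s : 𝕜 := ((c * M.toReal : ℝ) : 𝕜) with hs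
  have hsn : ‖s‖ₑ = c * M := by
    rw [hs, ← ofReal_norm, RCLike.norm_ofReal, abs_of_nonneg (by positivity),
      ENNReal.ofReal_mul (by positivity), ENNReal.ofReal_toReal hMt, ENNReal.ofReal_coe_nnreal]
  have hgtop : ∀ ω, firstTime U ω = ⊤ → ∀ n, g n ω = 0 := by
    intro ω hω n
    refine hg0 n ω fun j _ hj => ?_
    have := (firstTime_lt_top_iff hU).2 ⟨j, hj⟩
    exact this.ne hω
  have hmart : ∀ n, martOf μ 𝓖 (s⁻¹ • a) n =ᵐ[μ] (s⁻¹ • g) n := by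
    intro n
    filter_upwards [condExp_smul (μ := μ) s⁻¹ a (𝓖 n), ha2 n] with ω h1 h2
    refine h1.trans ?_
    simp only [Pi.smul_apply]
    rw [← h2]; rfl
  have hEa : ∀ n, ∀ᵐ ω ∂μ, E (martOf μ 𝓖 (s⁻¹ • a)) n ω ≤ ‖s⁻¹‖ₑ * c := by
    intro n
    filter_upwards [hE.congr hmart n, hE.smul_le s⁻¹ hg.1.stronglyAdapted n, hgE n] with ω h1 h2 h3
    rw [h1]
    exact h2.trans (by gcongr)
  have hss : ‖s‖ₑ * ‖s⁻¹‖ₑ ≤ 1 := by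
    rw [← enorm_mul]
    by_cases h0 : s = 0
    · simp [h0]
    · rw [mul_inv_cancel₀ h0]; simp
  refine ⟨s, s⁻¹ • a, ‖s⁻¹‖ₑ * c, ENNReal.mul_ne_top (by simp) ENNReal.coe_ne_top, ?_, ⟨?_, ?_, ?_, ?_⟩,
    hEa, ?_, ?_⟩
  · rw [← mul_assoc]
    exact mul_le_of_le_one_left _root_.zero_le hss
  · exact ha1.smul s⁻¹
  · exact isStoppingTime_firstTime hU hUm
  · intro n
    filter_upwards [hmart n] with ω h1 h2
    rw [h1, Pi.smul_apply, Pi.smul_apply, hg0 n ω ((le_firstTime_iff hU).1 h2), smul_zero]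
  · refine (eLpNorm_exponent_top (μ := μ)).le.trans (essSup_le_of_ae_le _ ?_)
    filter_upwards [ae_all_iff.2 hEa] with ω h1
    rw [enorm_eq_self]
    refine (Set.indicator_le_self' (fun _ _ => _root_.zero_le) ω).trans
      ((hO _ ω).trans (iSup_le fun n => (h1 n).trans ?_))
    rw [ENNReal.le_inv_iff_mul_le, mul_assoc, ← hsn, mul_comm]
    exact hss
  · intro n
    -- Degenerate case, where the atom is zero: either `c = 0` or `{τ < ∞}` is null, and in both
    -- cases `g` vanishes.
    by_cases h0 : s = 0
    · have hcM : (c : ℝ≥0∞) * M = 0 := by rw [← hsn, h0, enorm_zero]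
      have hgz : g n =ᵐ[μ] 0 := by
        rcases mul_eq_zero.1 hcM with hc | hM0
        · have := hE.lintegral_sq_le hg ENNReal.coe_ne_top hgE n
          rw [hc, zero_pow two_ne_zero, nonpos_iff_eq_zero, lintegral_eq_zero_iff'] at this
          · filter_upwards [this] with ω hω
            simpa using hω
          · exact ((hg.1.integrable n).aestronglyMeasurable.enorm).pow_const 2
        · have hmeas : MeasurableSet {ω | firstTime U ω < ⊤} := by
            have : {ω | firstTime U ω < ⊤} = ⋃ n, U n := by
              ext ω; rw [Set.mem_iUnion]; exact firstTime_lt_top_iff hU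
            rw [this]
            exact MeasurableSet.iUnion fun n => 𝓖.le n _ (hUm n)
          have h1 := ae_eq_zero_of_mixedNorm_eq_zero (P := P) hp0 hpt
            ((measurable_const (a := (1 : ℝ≥0∞))).indicator hmeas) hM0
          filter_upwards [h1] with ω hω
          refine hgtop ω ?_ n
          by_contra h2
          rw [Set.indicator_of_mem (by exact lt_top_iff_ne_top.2 h2)] at hω
          exact one_ne_zero hω
      filter_upwards [hgz] with ω hω
      rw [h0, zero_smul, hω]; rfl
    · filter_upwards [hmart n] with ω hω
      rw [Pi.smul_apply, Pi.smul_apply, hω, Pi.smul_apply, Pi.smul_apply, smul_inv_smul₀ h0]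
  · filter_upwards [ha3] with ω h1 h2
    rw [Pi.smul_apply, h1 (hgtop ω h2), smul_zero]

theorem exists_exponent (hpt : ∀ i, p i ≠ ∞) (hr : ∀ i, p i < r) (hr0 : r ≠ 0) :
    ∃ ρ : ℝ, 0 < ρ ∧ (∀ i, (p i).toReal < ρ) ∧ (r ≠ ∞ → ρ = r.toReal) := by
  by_cases h : r = ∞
  · refine ⟨∑ i, (p i).toReal + 1, by positivity, fun i => ?_, fun h' => absurd h h'⟩
    have := Finset.single_le_sum (f := fun i => (p i).toReal) (fun _ _ => ENNReal.toReal_nonneg)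
      (Finset.mem_univ i)
    have h' : (p i).toReal ≤ ∑ i, (p i).toReal := this
    linarith
  · exact ⟨r.toReal, ENNReal.toReal_pos hr0 h, fun i =>
      (ENNReal.toReal_lt_toReal (hpt i) h).2 (hr i), fun _ => rfl⟩

/-- Pointwise, the part above level `2^k` is eventually absent where `λ_∞` is finite, and the part
below is at most `2 · 2^(-u)`; a multiple of `λ_∞` dominates. -/
theorem tendsto_mixedNorm_tailControl (hp0 : ∀ i, p i ≠ 0) (hpt : ∀ i, p i ≠ ∞)
    {l : ℕ → (∀ i, Ω i) → ℝ} (hl : IsControl (prodFiltration ℱ) l)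
    (hfin : mixedNorm P p (controlLimit l) < ∞) {u : ℕ → ℕ} {k : ℕ → ℤ}
    (hu : Tendsto u atTop atTop) (hk : Tendsto k atTop atTop) :
    Tendsto (fun K => mixedNorm P p (controlLimit (tailControl l (-(u K : ℤ)) (k K)))) atTop (𝓝 0) := by
  have hL := hl.measurable_controlLimit
  have hLfin := ae_lt_top_of_mixedNorm_lt_top (P := P) hp0 hpt hL hfin
  refine tendsto_mixedNorm_zero hp0 hpt (F := fun ω => 8 * controlLimit l ω)
    (fun K => (hl.tailControl _ _).measurable_controlLimit) (hL.const_mul 8) (fun K => ?_) ?_ ?_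
  · refine Eventually.of_forall fun ω => (controlLimit_tailControl_le hl _ _ ω).trans ?_
    calc 2 * ({ω | 2 ^ k K < controlLimit l ω}.indicator (fun ω => 2 * controlLimit l ω) ω +
          min (controlLimit l ω) (2 ^ (-(u K : ℤ)))) ≤ 2 * (2 * controlLimit l ω + controlLimit l ω) := by
          gcongr
          · exact Set.indicator_le_self' (fun _ _ => _root_.zero_le) ω
          · exact min_le_left _ _
      _ = 6 * controlLimit l ω := by ring
      _ ≤ 8 * controlLimit l ω := by gcongr; norm_num
  · have h8 : (8 : ℝ≥0∞) = ((8 : ℝ≥0) : ℝ≥0∞) := rfl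
    rw [h8, mixedNorm_const_mul ENNReal.coe_ne_top hp0 hpt]
    exact ENNReal.mul_lt_top ENNReal.coe_lt_top hfin
  · filter_upwards [hLfin] with ω hω
    have h1 : Tendsto (fun K => 2 * (2 : ℝ≥0∞) ^ (-(u K : ℤ))) atTop (𝓝 0) := by
      have h2 : Tendsto (fun n : ℕ => (2 : ℝ≥0∞) ^ (-(n : ℤ))) atTop (𝓝 0) := by
        refine (ENNReal.tendsto_pow_atTop_nhds_zero_of_lt_one (r := 2⁻¹) (by norm_num)).congr fun n => ?_
        rw [ENNReal.zpow_neg, zpow_natCast, ENNReal.inv_pow]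
      simpa using ENNReal.Tendsto.const_mul (h2.comp hu) (Or.inr (by simp : (2 : ℝ≥0∞) ≠ ∞))
    refine tendsto_of_tendsto_of_tendsto_of_le_of_le' tendsto_const_nhds h1
      (Eventually.of_forall fun _ => _root_.zero_le) ?_
    obtain ⟨z, hz⟩ : ∃ z : ℤ, controlLimit l ω ≤ 2 ^ z := by
      by_cases h0 : controlLimit l ω = 0
      · exact ⟨0, by rw [h0]; exact _root_.zero_le⟩
      · obtain ⟨z, -, hz⟩ := ENNReal.exists_mem_Ioc_zpow (x := controlLimit l ω) (y := 2)
          h0 hω.ne (by norm_num) (by simp)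
        exact ⟨z + 1, hz⟩
    filter_upwards [hk.eventually (eventually_ge_atTop z)] with K hK
    refine (controlLimit_tailControl_le hl _ _ ω).trans ?_
    have hnot : ω ∉ {ω | 2 ^ k K < controlLimit l ω} := fun h =>
      absurd (hz.trans (two_zpow_mono hK)) (not_le.2 h)
    rw [Set.indicator_of_notMem hnot, zero_add]
    gcongr
    exact min_le_right _ _

/-- The common core of the three cases: the atomic decomposition along `l`, the local estimates for
`T` on its atoms, and the weighted machinery with `F = |Tf|` and `G = λ_∞`. -/
theorem IsAtomLocal.exists_bound (hp0 : ∀ i, p i ≠ 0) (hpt : ∀ i, p i ≠ ∞)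
    (hr : ∀ i, p i < r) (hr0 : r ≠ 0)
    (hE : IsGauge (Measure.pi P) (prodFiltration ℱ) E) (hO : ∀ f ω, O f ω ≤ ⨆ n, E f n ω)
    (hN : BoundedByControls P ℱ E N)
    (hT : IsSigmaSublinear (Measure.pi P) (prodFiltration ℱ) (N p) T)
    (hB : IsBoundedToLp P ℱ (N fun _ => r) (fun _ => r) T) (hA : IsAtomLocal P ℱ p O T) :
    ∃ C : ℝ≥0, C ≠ 0 ∧ ∀ f l, IsMart (Measure.pi P) (prodFiltration ℱ) f →
      IsControl (prodFiltration ℱ) l →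
      (∀ n, ∀ᵐ ω ∂Measure.pi P, E f n ω ≤ ENNReal.ofReal (l n ω)) →
      mixedNorm P p (fun ω => ‖T f ω‖ₑ) ≤ C * mixedNorm P p (controlLimit l) := by
  obtain ⟨ρ, hρ0, hpρ, hρr⟩ := exists_exponent hpt hr hr0
  obtain ⟨K, hK⟩ := hB
  -- Any starting exponent with `t ≤ 1` and `t < ρ` serves; extrapolation does the rest.
  set t : ℝ := min 1 (ρ / 2) with ht
  have ht0 : 0 < t := lt_min one_pos (by positivity)
  have ht1 : t ≤ 1 := min_le_left _ _
  have htρ : t < ρ := (min_le_right _ _).trans_lt (by linarith)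
  obtain ⟨C, hC⟩ := mixedNorm_le_of_weightedDom P ℱ p hp0 hpt hpρ ht0 htρ
    (fun B => 3 * B (1 - t / ρ) * (8 * K) ^ t * (dyadicConst t).toNNReal)
  -- A nonzero constant keeps the bound valid when the norm of the control is infinite.
  refine ⟨C + 1, by positivity, fun f l hf hl hfl => ?_⟩
  by_cases hfin : mixedNorm P p (controlLimit l) = ∞
  · rw [hfin, ENNReal.mul_top (by simp)]
    exact le_top
  have hlt := lt_top_iff_ne_top.2 hfin
  set μ := Measure.pi P with hμ
  set 𝓖 := prodFiltration ℱ with h𝓖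
  have hU : ∀ k : ℤ, Monotone (levelSet l (2 ^ k)) := fun k => hl.monotone_levelSet _
  have hUm : ∀ (k : ℤ) n, MeasurableSet[𝓖 n] (levelSet l (2 ^ k) n) :=
    fun k => hl.measurableSet_levelSet _
  have hgm : ∀ j k, IsMart μ 𝓖 (martTransform (layer l j k) f) :=
    fun j k => hf.martTransform (hl.measurableSet_layer j k)
  have hcoe : ∀ k : ℤ, ((4 * 2 ^ k : ℝ≥0) : ℝ≥0∞) = 4 * 2 ^ k := fun k => by
    rw [ENNReal.coe_mul, ENNReal.coe_zpow (by norm_num)]; rfl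
  have hatoms : ∀ k : ℤ, _ := fun k => hE.exists_atom hp0 hpt hO (hU k) (hUm k)
    (hgm k (k + 1)) (fun n ω h => martTransform_eq_zero f fun j hj hω => h j hj hω.1)
    (c := 4 * 2 ^ k) (fun n => by
      filter_upwards [hE.layer_le hf hl hfl k n] with ω hω
      rw [hcoe]
      exact hω.trans (Set.indicator_le_self' (fun _ _ => _root_.zero_le) ω))
  choose s a κ hκ hsκ hatom hEa hsa hatop using hatoms
  have hmart : ∀ k, IsMart μ 𝓖 (martOf μ 𝓖 (a k)) := fun k => isMart_martOf (by
    filter_upwards [(hatom k).condExp_eq_zero 0] with ω h1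
    exact h1 (by simp))
  have hNa : ∀ k, N p (martOf μ 𝓖 (a k)) ≤ κ k := fun k =>
    (hN.le_indicator p (W := fun _ => Set.univ) (A := Set.univ) monotone_const
      (fun n => @MeasurableSet.univ _ (𝓖 n)) (fun _ => subset_rfl) (hκ k)
      (fun n => by simpa using hEa k n)).trans (mixedNorm_indicator_le hp0 _ _)
  have hmem : ∀ k, MemHardy μ 𝓖 (N p) (martOf μ 𝓖 (a k)) :=
    fun k => ⟨hmart k, (hNa k).trans_lt (hκ k).lt_top⟩
  have hEsa : ∀ k n, ∀ᵐ ω ∂μ, E (s k • martOf μ 𝓖 (a k)) n ω ≤ ((4 * 2 ^ k : ℝ≥0) : ℝ≥0∞) := by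
    intro k n
    filter_upwards [hE.smul_le (s k) (hmart k).1.stronglyAdapted n, hEa k n] with ω h1 h2
    exact h1.trans ((mul_le_mul' le_rfl h2).trans (hsκ k))
  have hmems : ∀ k, MemHardy μ 𝓖 (N p) (s k • martOf μ 𝓖 (a k)) := fun k =>
    ⟨(hmart k).const_smul _, ((hN.le_indicator p (W := fun _ => Set.univ) (A := Set.univ) monotone_const
      (fun n => @MeasurableSet.univ _ (𝓖 n)) (fun _ => subset_rfl) ENNReal.coe_ne_top
      (fun n => by simpa only [Set.indicator_univ] using hEsa k n)).trans (mixedNorm_indicator_le hp0 _ _)).trans_lt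
      ENNReal.coe_lt_top⟩
  have hfmem : MemHardy μ 𝓖 (N p) f := ⟨hf, (hN p f l hl hfl).trans_lt hlt⟩
  have hu : Tendsto (fun K : ℕ => K / 2) atTop atTop := Nat.tendsto_div_const_atTop (by norm_num)
  have hi : Tendsto (fun K : ℕ => -((K / 2 : ℕ) : ℤ)) atTop atBot :=
    tendsto_neg_atTop_atBot.comp (tendsto_natCast_atTop_atTop.comp hu)
  have hk : Tendsto (fun K : ℕ => (((K + 1) / 2 : ℕ) : ℤ)) atTop atTop :=
    tendsto_natCast_atTop_atTop.comp ((Nat.tendsto_div_const_atTop (by norm_num)).comp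
      (tendsto_add_atTop_nat 1))
  have hsum : ∀ K n, (∑ j ∈ Finset.range K, s (intEnum j) • martOf μ 𝓖 (a (intEnum j))) n =ᵐ[μ]
      martTransform (layer l (-(K / 2 : ℕ)) ((K + 1) / 2 : ℕ)) f n := by
    intro K n
    filter_upwards [ae_all_iff.2 fun k => hsa k n] with ω hω
    rw [← sum_martTransform_layer, Finset.sum_apply, Finset.sum_apply, Finset.sum_apply,
      Finset.sum_apply]
    exact Finset.sum_congr rfl fun j _ => hω _
  have hseries := hT.series_le f (fun j => s (intEnum j) • martOf μ 𝓖 (a (intEnum j))) hfmem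
    (fun j => hmems _) (fun n => by
      filter_upwards [hE.ae_tendsto_layers hf hl hfl hi hk n, ae_all_iff.2 fun K => hsum K n] with ω h1 h2
      refine h1.congr fun K => ?_
      rw [← h2 K, Finset.sum_apply, Finset.sum_apply])
    (by
      -- Convergence in quasi-norm: the remainders are controlled by `tailControl`, whose norms tend
      -- to zero.
      refine tendsto_of_tendsto_of_tendsto_of_le_of_le tendsto_const_nhds
        (tendsto_mixedNorm_tailControl hp0 hpt hl hlt hu hk) (fun _ => _root_.zero_le) fun K => ?_
      refine hN p _ _ (hl.tailControl _ _) fun n => ?_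
      have h0 : ∀ n, (f - ∑ j ∈ Finset.range K, s (intEnum j) • martOf μ 𝓖 (a (intEnum j))) n =ᵐ[μ]
          (f - martTransform (layer l (-(K / 2 : ℕ)) ((K + 1) / 2 : ℕ)) f) n := by
        intro n
        filter_upwards [hsum K n] with ω hω
        simp only [Pi.sub_apply, hω]
      filter_upwards [hE.congr h0 n, hE.tail_le hf hl hfl
        (i := -(K / 2 : ℕ)) (k := ((K + 1) / 2 : ℕ)) (by omega) n] with ω h1 h2
      rw [h1]
      exact h2)
  -- The values of `T` are only almost everywhere measurable, whereas the weighted estimates are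
  -- stated for measurable functions; hence the modifications.
  have hTm : ∀ k, AEMeasurable (fun ω => ‖T (martOf μ 𝓖 (a k)) ω‖ₑ) μ :=
    fun k => (hT.aestronglyMeasurable _ (hmem k)).enorm
  have hTfm : AEMeasurable (fun ω => ‖T f ω‖ₑ) μ := (hT.aestronglyMeasurable _ hfmem).enorm
  have key := weightedDom_of_localized (μ := μ) (𝓖 := 𝓖) (L := controlLimit l) ht0 ht1 htρ (K := 8 * K)
    (D := fun k n => {ω | firstTime (levelSet l (2 ^ k)) ω = n})
    (fun k n => (isStoppingTime_firstTime (hU k) (hUm k)).measurableSet_eq n)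
    (fun k m n hmn => Set.disjoint_left.2 fun ω h1 h2 => hmn (Nat.cast_inj.1
      ((show firstTime _ ω = m from h1).symm.trans h2)))
    (fun k => by rw [iUnion_firstTime_eq (hU k), iUnion_levelSet])
    (b := fun k ω => ‖s k‖ₑ * (hTm k).mk _ ω) (fun k => (hTm k).measurable_mk.const_mul _)
    (fun k => by
      filter_upwards [hA.ae_eq_zero hp0 hE hN hT (hatom k) (hatop k), (hTm k).ae_eq_mk] with ω h1 h2 h3
      rw [← h2, h1, mul_zero]
      rw [iUnion_firstTime_eq (hU k), Set.mem_iUnion, ← firstTime_lt_top_iff (hU k)] at h3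
      simpa using h3)
    (fun k n A hAm => by
      have hDm := (isStoppingTime_firstTime (hU k) (hUm k)).measurableSet_eq n
      have h1 := hA.setLIntegral_le hr0 hρ0 hρr hE hN hK (hatom k) (hκ k) (hEa k)
        (hTm k).measurable_mk (hTm k).ae_eq_mk (m := n)
        (A := A ∩ {ω | firstTime (levelSet l (2 ^ k)) ω = n}) (hAm.inter hDm) (fun ω hω => hω.2)
      simp_rw [ENNReal.mul_rpow_of_nonneg _ _ hρ0.le]
      rw [lintegral_const_mul' _ _ (ENNReal.rpow_ne_top_of_nonneg hρ0.le (by simp))]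
      refine (mul_le_mul' le_rfl h1).trans ?_
      rw [← mul_assoc, ← ENNReal.mul_rpow_of_nonneg _ _ hρ0.le, ← ENNReal.mul_rpow_of_nonneg _ _ hρ0.le]
      refine mul_le_mul' (ENNReal.rpow_le_rpow ?_ hρ0.le) le_rfl
      calc ‖s k‖ₑ * (K * (2 * κ k)) = K * 2 * (‖s k‖ₑ * κ k) := by ring
        _ ≤ K * 2 * ((4 * 2 ^ k : ℝ≥0) : ℝ≥0∞) := by gcongr; exact hsκ k
        _ = _ := by rw [hcoe]; push_cast; ring)
    (F := hTfm.mk _) (by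
      filter_upwards [hseries, hTfm.ae_eq_mk, ae_all_iff.2 fun k => hT.smul_eq (s k) _ (hmem k),
        ae_all_iff.2 fun k => (hTm k).ae_eq_mk] with ω h1 h2 h3 h4
      rw [← h2]
      refine h1.trans ?_
      simp only [h3, h4]
      exact ENNReal.tsum_comp_le_tsum_of_injective intEnum_injective _)
  have hfinal := hC _ _ hTfm.measurable_mk hl.measurable_controlLimit key
  rw [mixedNorm_congr_ae p hTfm.ae_eq_mk]
  refine hfinal.trans ?_
  gcongr
  simp

end AtomicDecomposition

/-! ### The three scales of Hardy spaces -/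

section HardySpaces

universe u

variable {d : ℕ} {Ω : Fin d → Type u} [mΩ : ∀ i, MeasurableSpace (Ω i)] {𝕜 : Type*} [RCLike 𝕜]
  {P : ∀ i, Measure (Ω i)} {ℱ : ∀ i, Filtration ℕ (mΩ i)} {p : Fin d → ℝ≥0∞}

theorem sqrt_tsum_le_iSup (e : ℕ → ℝ≥0∞) :
    (∑' n, e n) ^ (1 / 2 : ℝ) ≤ ⨆ n, (∑ j ∈ Finset.range (n + 1), e j) ^ (1 / 2 : ℝ) := by
  have h := (ENNReal.continuous_rpow_const (y := (1 / 2 : ℝ))).continuousAt.tendsto.comp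
    (ENNReal.tendsto_nat_tsum e)
  refine le_of_tendsto h (Eventually.of_forall fun n => ?_)
  refine le_trans (ENNReal.rpow_le_rpow ?_ (by norm_num))
    (le_iSup (fun n => (∑ j ∈ Finset.range (n + 1), e j) ^ (1 / 2 : ℝ)) n)
  exact Finset.sum_le_sum_of_subset (Finset.range_mono (Nat.le_succ n))

theorem condQuadVar_le_iSup {Ω : Type*} {m0 : MeasurableSpace Ω} (μ : Measure Ω) (𝓖 : Filtration ℕ m0)
    (f : ℕ → Ω → 𝕜) (ω : Ω) : condQuadVar μ 𝓖 f ω ≤ ⨆ n, condQuadVarUpTo μ 𝓖 f n ω :=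
  sqrt_tsum_le_iSup _

theorem quadVar_le_iSup {Ω : Type*} (f : ℕ → Ω → 𝕜) (ω : Ω) :
    quadVar f ω ≤ ⨆ n, quadVarUpTo f (n + 1) ω := sqrt_tsum_le_iSup _

theorem maxFun_le_iSup {Ω : Type*} (f : ℕ → Ω → 𝕜) (ω : Ω) : maxFun f ω ≤ ⨆ n, maxUpTo f n ω :=
  iSup_mono fun n => enorm_le_maxUpTo f (Nat.le_succ n) ω

theorem boundedByControls_normQ : BoundedByControls P ℱ
    (fun (f : ℕ → (∀ i, Ω i) → 𝕜) n ω => quadVarUpTo f (n + 1) ω) (normQ P ℱ) :=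
  fun _ _ l hl h => iInf_le_of_le l (iInf_le_of_le hl (iInf_le _ h))

theorem boundedByControls_normP : BoundedByControls P ℱ
    (maxUpTo : (ℕ → (∀ i, Ω i) → 𝕜) → _) (normP P ℱ) := by
  intro q f l hl h
  refine iInf_le_of_le l (iInf_le_of_le hl (iInf_le _ fun n => ?_))
  filter_upwards [h n] with ω hω
  exact (enorm_le_maxUpTo f le_rfl ω).trans hω

/-- Division by `C ≠ 0` brings the constant inside the infimum, including an empty one, whose value
is `∞`. -/
theorem le_mul_iInf_controls {A : Set (ℕ → (∀ i, Ω i) → ℝ)} {x : ℝ≥0∞} {C : ℝ≥0} (hC : C ≠ 0)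
    (h : ∀ l ∈ A, IsControl (prodFiltration ℱ) l → x ≤ C * mixedNorm P p (controlLimit l)) :
    x ≤ C * ⨅ (l : ℕ → (∀ i, Ω i) → ℝ) (_ : IsControl (prodFiltration ℱ) l) (_ : l ∈ A),
      mixedNorm P p (controlLimit l) := by
  have hC' : (C : ℝ≥0∞) ≠ 0 := by simpa using hC
  rw [← ENNReal.div_le_iff' hC' ENNReal.coe_ne_top]
  refine le_iInf fun l => le_iInf fun hl => le_iInf fun hA => ?_
  rw [ENNReal.div_le_iff' hC' ENNReal.coe_ne_top]
  exact h l hA hl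

/-- The controls of `𝒫_p` bound `|f_{n+1}|` only; monotonicity of `λ` and `f₀ = 0` extend this to
the running maximum. -/
theorem maxUpTo_le_of_control {f : ℕ → (∀ i, Ω i) → 𝕜} (hf : f 0 =ᵐ[Measure.pi P] 0)
    {l : ℕ → (∀ i, Ω i) → ℝ} (hl : IsControl (prodFiltration ℱ) l)
    (h : ∀ n, ∀ᵐ ω ∂Measure.pi P, ‖f (n + 1) ω‖ₑ ≤ ENNReal.ofReal (l n ω)) (n : ℕ) :
    ∀ᵐ ω ∂Measure.pi P, maxUpTo f n ω ≤ ENNReal.ofReal (l n ω) := by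
  filter_upwards [hf, ae_all_iff.2 h] with ω h0 h1
  refine maxUpTo_le fun m hm => ?_
  rcases m with - | m
  · rw [h0]; simp
  · exact (h1 m).trans (ENNReal.ofReal_le_ofReal (hl.mono ω (by omega)))

variable [∀ i, IsProbabilityMeasure (P i)]

theorem boundedByControls_normHs : BoundedByControls P ℱ
    (condQuadVarUpTo (Measure.pi P) (prodFiltration ℱ) : (ℕ → (∀ i, Ω i) → 𝕜) → _) (normHs P ℱ) := by
  intro q f l _ h
  refine mixedNorm_mono_ae q ?_
  filter_upwards [ae_all_iff.2 h] with ω hω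
  exact (condQuadVar_le_iSup _ _ f ω).trans (iSup_mono hω)

/-- The conditional quadratic variation is predictable: its sum up to `n + 1` is already measurable
at time `n`. So it serves as its own control, with limit at most `s(f)`. -/
theorem le_mul_normHs (hp0 : ∀ i, p i ≠ 0) (hpt : ∀ i, p i ≠ ∞) {f : ℕ → (∀ i, Ω i) → 𝕜}
    (hf : normHs P ℱ p f < ∞) {x : ℝ≥0∞} {C : ℝ≥0}
    (h : ∀ l, IsControl (prodFiltration ℱ) l →
      (∀ n, ∀ᵐ ω ∂Measure.pi P, condQuadVarUpTo (Measure.pi P) (prodFiltration ℱ) f n ω ≤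
        ENNReal.ofReal (l n ω)) → x ≤ C * mixedNorm P p (controlLimit l)) :
    x ≤ C * normHs P ℱ p f := by
  set 𝓖 := prodFiltration ℱ with h𝓖
  set e : ℕ → (∀ i, Ω i) → ℝ≥0∞ := condQuadVarUpTo (Measure.pi P) 𝓖 f with he
  have hem : ∀ n, Measurable[𝓖 n] (e n) := fun n =>
    (Finset.measurable_fun_sum _ fun j hj => (measurable_condLExp (𝓖 j) _ _).mono
      (𝓖.mono (Nat.lt_succ_iff.1 (Finset.mem_range.1 hj))) le_rfl).pow_const _
  have hle : ∀ n ω, e n ω ≤ condQuadVar (Measure.pi P) 𝓖 f ω := fun n ω =>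
    ENNReal.rpow_le_rpow (ENNReal.sum_le_tsum _) (by norm_num)
  have hmeas : Measurable (condQuadVar (Measure.pi P) 𝓖 f) :=
    (Measurable.tsum fun n => measurable_condLExp' _ _ _).pow_const _
  have hfin := ae_lt_top_of_mixedNorm_lt_top hp0 hpt hmeas hf
  -- Where a partial sum is infinite, `toReal` returns `0` and destroys monotonicity; the running
  -- maximum restores it everywhere. Finiteness of the norm makes this set null.
  refine (h (fun n ω => partialSups (fun m => (e m ω).toReal) n) ⟨?_, ?_, ?_⟩ ?_).trans ?_
  · intro n ω
    exact ENNReal.toReal_nonneg.trans (le_partialSups_of_le (fun m => (e m ω).toReal) (Nat.zero_le n))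
  · intro ω m n hmn
    exact (partialSups (fun m => (e m ω).toReal)).monotone hmn
  · intro n
    refine Measurable.stronglyMeasurable ?_
    induction n with
    | zero => simpa using (hem 0).ennreal_toReal
    | succ n ih =>
      simp only [partialSups_add_one]
      exact (ih.mono (𝓖.mono (Nat.le_succ n)) le_rfl).sup (hem (n + 1)).ennreal_toReal
  · intro n
    filter_upwards [hfin] with ω hω
    rw [← ENNReal.ofReal_toReal ((hle n ω).trans_lt hω).ne]
    exact ENNReal.ofReal_le_ofReal (le_partialSups (fun m => (e m ω).toReal) n)
  · gcongr
    refine mixedNorm_mono_ae p (Eventually.of_forall fun ω => iSup_le fun n => ?_)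
    obtain ⟨m, -, hm⟩ := exists_partialSups_eq (fun m => (e m ω).toReal) n
    simp only [hm]
    exact ENNReal.ofReal_toReal_le.trans (hle m ω)

end HardySpaces

theorem theorem7 {𝕜 : Type*} [RCLike 𝕜] {d : ℕ} (hd : 1 ≤ d) {Ω : Fin d → Type*}
    [mΩ : ∀ i, MeasurableSpace (Ω i)] (P : ∀ i, Measure (Ω i)) [∀ i, IsProbabilityMeasure (P i)]
    (ℱ : ∀ i, Filtration ℕ (mΩ i)) (hℱ : ∀ i, ⨆ n, ℱ i n = mΩ i)
    (p : Fin d → ℝ≥0∞) (hp : ∀ i, 0 < p i ∧ p i < ∞) (r : ℝ≥0∞) (hr : ∀ i, p i < r) :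
    (∀ T : (ℕ → (∀ i, Ω i) → 𝕜) → (∀ i, Ω i) → 𝕜,
      IsSigmaSublinear (Measure.pi P) (prodFiltration ℱ) (normHs P ℱ p) T →
      IsBoundedToLp P ℱ (normHs P ℱ fun _ => r) (fun _ => r) T →
      IsAtomLocal P ℱ p (condQuadVar (Measure.pi P) (prodFiltration ℱ)) T →
      IsBoundedToLp P ℱ (normHs P ℱ p) p T) ∧
    (∀ T : (ℕ → (∀ i, Ω i) → 𝕜) → (∀ i, Ω i) → 𝕜,
      IsSigmaSublinear (Measure.pi P) (prodFiltration ℱ) (normQ P ℱ p) T →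
      IsBoundedToLp P ℱ (normQ P ℱ fun _ => r) (fun _ => r) T →
      IsAtomLocal P ℱ p quadVar T →
      IsBoundedToLp P ℱ (normQ P ℱ p) p T) ∧
    (∀ T : (ℕ → (∀ i, Ω i) → 𝕜) → (∀ i, Ω i) → 𝕜,
      IsSigmaSublinear (Measure.pi P) (prodFiltration ℱ) (normP P ℱ p) T →
      IsBoundedToLp P ℱ (normP P ℱ fun _ => r) (fun _ => r) T →
      IsAtomLocal P ℱ p maxFun T →
      IsBoundedToLp P ℱ (normP P ℱ p) p T) := by
  have hp0 : ∀ i, p i ≠ 0 := fun i => (hp i).1.ne'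
  have hpt : ∀ i, p i ≠ ∞ := fun i => (hp i).2.ne
  have hr0 : r ≠ 0 := ((hp ⟨0, hd⟩).1.trans (hr ⟨0, hd⟩)).ne'
  refine ⟨fun T hT hB hA => ?_, fun T hT hB hA => ?_, fun T hT hB hA => ?_⟩
  · obtain ⟨C, -, h⟩ := hA.exists_bound hp0 hpt hr hr0 isGauge_condQuadVarUpTo
      (fun f ω => condQuadVar_le_iSup _ _ f ω) boundedByControls_normHs hT hB
    exact ⟨C, fun f hf => le_mul_normHs hp0 hpt hf.2 fun l hl hfl => h f l hf.1 hl hfl⟩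
  · obtain ⟨C, hC, h⟩ := hA.exists_bound hp0 hpt hr hr0 isGauge_quadVarUpTo quadVar_le_iSup
      boundedByControls_normQ hT hB
    exact ⟨C, fun f hf => le_mul_iInf_controls (A := {l | ∀ n, ∀ᵐ ω ∂Measure.pi P,
      quadVarUpTo f (n + 1) ω ≤ ENNReal.ofReal (l n ω)}) hC fun l hfl hl => h f l hf.1 hl hfl⟩
  · obtain ⟨C, hC, h⟩ := hA.exists_bound hp0 hpt hr hr0 isGauge_maxUpTo maxFun_le_iSup
      boundedByControls_normP hT hB
    exact ⟨C, fun f hf => le_mul_iInf_controls (A := {l | ∀ n, ∀ᵐ ω ∂Measure.pi P,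
      ‖f (n + 1) ω‖ₑ ≤ ENNReal.ofReal (l n ω)}) hC fun l hfl hl =>
        h f l hf.1 hl (maxUpTo_le_of_control hf.1.2 hl hfl)⟩
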